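/- **Setting.** Fix integers $n\ge1$, $\mu\ge1$, $N\ge0$, complex numbers $a(0),\dots,a(N)$ and $P_0>0$. For a stochastic sequence $\{\xi(m):m\in\mathbb Z\}$ put $\xi^{(n)}(m,s)=\sum_{l=0}^n(-1)^l\binom nl\xi(m-ls)$, $m,s\in\mathbb Z$. The sequence has stationary $n$th increments with spectral density $f\ge0$, $f\in L_1(-\pi,\pi)$, if the increments are square integrable with mean $0$ and, for all $m_0,m,s_1,s_2\in\mathbb Z$, $$E\,\xi^{(n)}(m_0+m,s_1)\overline{\xi^{(n)}(m_0,s_2)}=\frac1{2\pi}\int_{-\pi}^{\pi}e^{i\lambda m}(1-e^{-is_1\lambda})^n(1-e^{is_2\lambda})^n\lambda^{-2n}f(\lambda)\,d\lambda .$$ Define $d_\mu(k)$ by $\sum_{k\ge0} d_\mu(k)x^k=\big(\sum_{j\ge0}x^{\mu j}\big)^n$, and set $b(k)=\sum_{m=k}^Na(m)d_\mu(m-k)$ for $0\le k\le N$ and $v(k)=\sum_{0\le l\le n,\;0\le l\mu+k\le N}(-1)^l\binom nl b(l\mu+k)$ for $-\mu n\le k\le-1$. The functional $A_N\xi=\sum_{k=0}^Na(k)\xi(k)$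 is estimated from the past $m\le-1$ by the linear estimates $\hat A=-\sum_{k=-\mu n}^{-1}v(k)\xi(k)+L$, where $L$ is in the closed linear span of the increments $\xi^{(n)}(k,\mu)$, $k\le-1$. Let $$\Delta(f)=\min_h\frac1{2\pi}\int_{-\pi}^{\pi}\Big|\sum_{k=0}^Nb(k)e^{i\lambda k}-h(\lambda)\Big|^2\frac{|1-e^{-i\lambda\mu}|^{2n}}{\lambda^{2n}}f(\lambda)\,d\lambda ,$$ the minimum being over those $h$ for which $h(\lambda)(1-e^{-i\lambda\mu})^n(i\lambda)^{-n}$ lies in the closed linear span in $L_2(f)$ of the functions $e^{i\lambda k}(1-e^{-i\lambda\mu})^n(i\lambda)^{-n}$, $k\le-1$. Let $D_0$ be the class of densities $f$ with $\frac1{2\pi}\int_{-\pi}^{\pi}f\,d\lambda\le P_0$. A density $f^0\in D_0$ is *least favorable* in $D_0$ if $\Delta(f^0)=\max_{f\in D_0}\Delta(f)$. Let $w_\mu(z)=\sum_{k\ge0}w_\mu(k)z^k=\exp\Big\{\frac1{4\pi}\int_{-\pi}^{\pi}\frac{e^{i\lambda}+z}{e^{i\lambda}-z}\ln\frac{|1-e^{-i\lambda\mu}|^{2n}}{\lambda^{2n}}d\lambda\Big\}$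 for $|z|<1$. For $0\le k,j\le N$ let $D_{k,j}=d_\mu(j-k)$ if $k\le j$, $\hat D_{k,j}=d_\mu(j+k-N)$ if $j+k\ge N$, $A_{k,j}=a(k+j)$ if $k+j\le N$, and $W_{j,k}=w_\mu(j-k)$ if $k\le j$, all other entries being $0$. For $\varphi=(\varphi(0),\dots,\varphi(N))\in\mathbb C^{N+1}$ let $\varphi_\mu=W\varphi$. We say that $\varphi$ *defines the canonical factorization* of $f$ if $f(\lambda)=|\sum_{k=0}^N\varphi(k)e^{-i\lambda k}|^2$ and $\sum_{k=0}^N\varphi(k)z^k\ne0$ for $|z|\le1$. Consider the equations $$\text{(49)}\quad DAW\varphi=\alpha\overline{\varphi},\ \alpha\in\mathbb C,\qquad\qquad\text{(50)}\quad \hat DAW\varphi=\beta\overline{\varphi},\ \beta\in\mathbb C,$$ and the densities $$\text{(41)}\quad f^0(\lambda)=\Big|\sum_{k=0}^N\varphi(k)e^{-i\lambda k}\Big|^2,\qquad\text{(46)}\quad f^0(\lambda)=\Big|c\sum_{k=0}^N(DA\varphi_\mu)_ke^{i\lambda k}\Big|^2,\ c\in\mathbb C .$$ Let $\nu_0P_0$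 be the maximum of $\|DAW\varphi\|^2$ over the solutions $\varphi$ of (49) or (50) with $\|\varphi\|^2=P_0$ that define the canonical factorization of (41). Let $\nu_0^+P_0$ be the maximum of $\|DAW\varphi\|^2$ over the $\varphi$ with $\|\varphi\|^2=P_0$ that define the canonical factorization of (46) for some $c$. The maximum over an empty set is $-\infty$. **Theorem 5.2.** (i) For every $f\in D_0$ and every sequence $\xi$ with stationary $n$th increments and spectral density $f$, $\Delta(f)$ is the least mean square error $E|A_N\xi-\hat A|^2$ of the above linear estimates. (ii) If $\varphi^0$ is a solution of (49) or (50) with $\|\varphi^0\|^2=P_0$ and $\nu_0P_0=\nu_0^+P_0=\|DAW\varphi^0\|^2$, then the density (41) with $\varphi=\varphi^0$ is least favorable in $D_0$. If moreover $\varphi^0$ defines the canonical factorization of this density, then for every sequence $\xi$ with this spectral density the increments are a one-sided moving average of order $N$, $\xi^{(n)}(m,\mu)=\sum_{k=0}^N\varphi^0(k)\eta(m-k)$, where $\eta(m)=\sum_{j\ge0}w_\mu(j)\varepsilon(m-j)$ (in mean square) and the $\varepsilon(m)$ are uncorrelated, have mean $0$ and variance $1$, and lie in the closed linear span of $\{\xi^{(n)}(j,\mu):j\le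 m\}$. (iii) If $\nu_0<\nu_0^+$, there are $\varphi$ and $c$ such that $\varphi$ defines the canonical factorization of the density (46) and $\int_{-\pi}^{\pi}f^0\,d\lambda=2\pi P_0$. Each density (46) with these properties is least favorable in $D_0$. Its parameters are fixed by $\varphi_\mu=W\varphi$, the extremum problem $$\text{(42)}\quad \|DA\varphi_\mu\|^2\to\max,\qquad \Big|\sum_{k=0}^N\varphi(k)e^{-i\lambda k}\Big|^2\in D_0,$$ and the power constraint, in the following sense. Every such $\varphi$ solves (42). Conversely, if $\varphi$ solves (42) and defines the canonical factorization of the density (41), and this density has integral $2\pi P_0$ over $(-\pi,\pi)$, then there are $c$ for which (46) has integral $2\pi P_0$, and for every such $c$ the density (46) coincides with (41). -/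

import Mathlib

open MeasureTheory Filter Topology Matrix
open scoped ENNReal

namespace IncrementExtrapolation

noncomputable section

/-! ## Closed linear spans in L² -/

/-- `g` is square integrable and is an `L²(ν)`-limit of finite linear combinations of
`e 0, e 1, e 2, …`, that is, `g` lies in the closed linear span of these functions. -/
def InClosedSpan {X : Type*} [MeasurableSpace X] (ν : Measure X) (e : ℕ → X → ℂ)
    (g : X → ℂ) : Prop :=
  MemLp g 2 ν ∧ ∀ δ : ℝ≥0∞, 0 < δ → ∃ c : ℕ →₀ ℂ,
    eLpNorm (fun x => g x - ∑ j ∈ c.support, c j * e j x) 2 ν < δ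

/-! ## Stochastic sequences with stationary `n`th increments -/

/-- The `n`th increment with step `s`:
`ξ⁽ⁿ⁾(m, s) = ∑_{l=0}^{n} (-1)^l C(n,l) ξ(m - l s)`. -/
def increment {Ω : Type*} (n : ℕ) (ξ : ℤ → Ω → ℂ) (m s : ℤ) (x : Ω) : ℂ :=
  ∑ l ∈ Finset.range (n + 1), (-1 : ℂ) ^ l * (n.choose l : ℂ) * ξ (m - (l : ℤ) * s) x

/-- `ξ` is a sequence with (wide sense) stationary `n`th increments of zero mean whose spectral
function is absolutely continuous with spectral density `f`, i.e. `dF(θ) = f(θ) dθ / 2π`. -/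
structure HasSpectralDensity {Ω : Type*} [MeasurableSpace Ω] (P : Measure Ω) (n : ℕ)
    (ξ : ℤ → Ω → ℂ) (f : ℝ → ℝ) : Prop where
  memLp : ∀ m s : ℤ, MemLp (increment n ξ m s) 2 P
  mean_zero : ∀ m s : ℤ, ∫ x, increment n ξ m s x ∂P = 0
  structural : ∀ m₀ m s₁ s₂ : ℤ,
    ∫ x, increment n ξ (m₀ + m) s₁ x * star (increment n ξ m₀ s₂ x) ∂P =
      (1 / (2 * Real.pi) : ℂ) * ∫ θ in (-Real.pi)..Real.pi,
        Complex.exp (Complex.I * θ * m) *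
          (1 - Complex.exp (-(Complex.I * s₁ * θ))) ^ n *
          (1 - Complex.exp (Complex.I * s₂ * θ)) ^ n *
          (1 / (θ : ℂ) ^ (2 * n)) * (f θ : ℂ)

/-! ## The coefficients `d_μ`, `b_μ`, `v_μ` attached to the functional -/

/-- `d_μ(k)`, the coefficient of `x^k` in `(∑_{j ≥ 0} x^{μ j})^n` (for `μ ≥ 1`). -/
def dCoef (n μ k : ℕ) : ℂ :=
  PowerSeries.coeff k ((PowerSeries.mk fun j : ℕ => if μ ∣ j then (1 : ℂ) else 0) ^ n)

/-- `b_{μ,N}(k) = ∑_{m=k}^{N} a(m) d_μ(m-k)`. -/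
def bCoef (n μ N : ℕ) (a : ℕ → ℂ) (k : ℕ) : ℂ :=
  ∑ m ∈ Finset.Icc k N, a m * dCoef n μ (m - k)

/-- `v_{μ,N}(-k) = ∑_l (-1)^l C(n,l) b_{μ,N}(lμ - k)`, the sum being over those
`0 ≤ l ≤ n` for which `0 ≤ lμ - k ≤ N`. -/
def vCoef (n μ N : ℕ) (a : ℕ → ℂ) (k : ℕ) : ℂ :=
  ∑ l ∈ (Finset.range (n + 1)).filter (fun l => k ≤ l * μ ∧ l * μ - k ≤ N),
    (-1 : ℂ) ^ l * (n.choose l : ℂ) * bCoef n μ N a (l * μ - k)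

/-- The functional `A_N ξ = ∑_{k=0}^{N} a(k) ξ(k)`. -/
def functionalA {Ω : Type*} (N : ℕ) (a : ℕ → ℂ) (ξ : ℤ → Ω → ℂ) (x : Ω) : ℂ :=
  ∑ k ∈ Finset.range (N + 1), a k * ξ (k : ℤ) x

/-- `V_N ξ = ∑_{k=-μn}^{-1} v_{μ,N}(k) ξ(k)`, a combination of observed values. -/
def functionalV {Ω : Type*} (n μ N : ℕ) (a : ℕ → ℂ) (ξ : ℤ → Ω → ℂ) (x : Ω) : ℂ :=
  ∑ k ∈ Finset.Icc 1 (μ * n), vCoef n μ N a k * ξ (-(k : ℤ)) x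

/-- The mean square errors `E|A_N ξ - Â|²` of all linear estimates `Â = -V_N ξ + L`, where `L`
runs through the closed linear span of the observed increments `ξ⁽ⁿ⁾(k, μ)`, `k ≤ -1`. -/
def linearEstimateErrors {Ω : Type*} [MeasurableSpace Ω] (P : Measure Ω) (n μ N : ℕ)
    (a : ℕ → ℂ) (ξ : ℤ → Ω → ℂ) : Set ℝ :=
  {e | ∃ L : Ω → ℂ,
    InClosedSpan P (fun j x => increment n ξ (-1 - (j : ℤ)) (μ : ℤ) x) L ∧
    e = ∫ x, ‖functionalA N a ξ x - (-functionalV n μ N a ξ x + L x)‖ ^ 2 ∂P}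

/-! ## The same problem in the spectral domain -/

/-- `(1 - e^{-iμθ})^n / (iθ)^n`. -/
def kernel (n μ : ℕ) (θ : ℝ) : ℂ :=
  (1 - Complex.exp (-(Complex.I * μ * θ))) ^ n / (Complex.I * θ) ^ n

/-- `f(θ) dθ` on `(-π, π]`; `L²` of this measure is `L₂(f)`. -/
def densityMeasure (f : ℝ → ℝ) : Measure ℝ :=
  (volume.restrict (Set.Ioc (-Real.pi) Real.pi)).withDensity fun θ => ENNReal.ofReal (f θ)

/-- `h` is the spectral characteristic of a linear estimate for the density `f`:
`h(θ) (1 - e^{-iμθ})^n / (iθ)^n` belongs to `L₂⁰⁻(f)`, the closed linear span in `L₂(f)` of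
`e^{iθk} (1 - e^{-iμθ})^n / (iθ)^n`, `k ≤ -1`. -/
def IsSpectralCharacteristic (n μ : ℕ) (f : ℝ → ℝ) (h : ℝ → ℂ) : Prop :=
  InClosedSpan (densityMeasure f)
    (fun j θ => Complex.exp (-(Complex.I * θ * ((j : ℂ) + 1))) * kernel n μ θ)
    (fun θ => h θ * kernel n μ θ)

/-- The mean square error `Δ(h; f)` of the estimate with spectral characteristic `h`. -/
def mse (n μ N : ℕ) (a : ℕ → ℂ) (h : ℝ → ℂ) (f : ℝ → ℝ) : ℝ :=
  1 / (2 * Real.pi) * ∫ θ in (-Real.pi)..Real.pi,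
    ‖(∑ k ∈ Finset.range (N + 1), bCoef n μ N a k * Complex.exp (Complex.I * θ * k)) - h θ‖ ^ 2 *
      (‖1 - Complex.exp (-(Complex.I * μ * θ))‖ ^ (2 * n) / θ ^ (2 * n)) * f θ

/-- `Δ(f) = Δ(h(f); f)`, the mean square error of the optimal linear estimate: the smallest value
of `Δ(h; f)` over all spectral characteristics `h` of linear estimates. -/
def optimalError (n μ N : ℕ) (a : ℕ → ℂ) (f : ℝ → ℝ) : ℝ :=
  ⨅ h : {h : ℝ → ℂ // IsSpectralCharacteristic n μ f h}, mse n μ N a h.1 f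

/-- The class `D₀` of spectral densities with `(1/2π) ∫ f ≤ P₀`. -/
def classD0 (P₀ : ℝ) : Set (ℝ → ℝ) :=
  {f | (∀ θ ∈ Set.Icc (-Real.pi) Real.pi, 0 ≤ f θ) ∧
    IntervalIntegrable f volume (-Real.pi) Real.pi ∧
    1 / (2 * Real.pi) * ∫ θ in (-Real.pi)..Real.pi, f θ ≤ P₀}

/-- `f₀` is least favorable in the class `D` for the optimal linear estimation of `A_N ξ`. -/
def IsLeastFavorable (n μ N : ℕ) (a : ℕ → ℂ) (D : Set (ℝ → ℝ)) (f₀ : ℝ → ℝ) : Prop :=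
  f₀ ∈ D ∧ ∀ f ∈ D, optimalError n μ N a f ≤ optimalError n μ N a f₀

/-- The canonical factorization `f(θ) = |Φ(e^{-iθ})|²`, `Φ(z) = ∑ φ(k) z^k`, where the power
series has radius of convergence `> 1` and no zeros in the closed unit disk. -/
def IsCanonicalFactorization (f : ℝ → ℝ) (φ : ℕ → ℂ) : Prop :=
  (∃ r : ℝ, 1 < r ∧ Summable fun k => ‖φ k‖ * r ^ k) ∧
  (∀ z : ℂ, ‖z‖ ≤ 1 → ∑' k, φ k * z ^ k ≠ 0) ∧
  ∀ θ : ℝ, f θ = ‖∑' k, φ k * Complex.exp (-(Complex.I * θ)) ^ k‖ ^ 2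

/-! ## The matrices -/

/-- `w_μ(z) = exp((1/4π) ∫ (e^{iθ}+z)/(e^{iθ}-z) ln(|1-e^{-iθμ}|^{2n}/θ^{2n}) dθ)`, `|z| < 1`. -/
def wFun (n μ : ℕ) (z : ℂ) : ℂ :=
  Complex.exp ((1 / (4 * Real.pi) : ℂ) * ∫ θ in (-Real.pi)..Real.pi,
    (Complex.exp (Complex.I * θ) + z) / (Complex.exp (Complex.I * θ) - z) *
      (Real.log (‖1 - Complex.exp (-(Complex.I * θ * μ))‖ ^ (2 * n) / θ ^ (2 * n)) : ℂ))

/-- The Taylor coefficients in `w_μ(z) = ∑ w_μ(k) z^k`. -/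
def wCoef (n μ k : ℕ) : ℂ := iteratedDeriv k (wFun n μ) 0 / (k.factorial : ℂ)

def matD (n μ N : ℕ) : Matrix (Fin (N + 1)) (Fin (N + 1)) ℂ :=
  Matrix.of fun k j => if k ≤ j then dCoef n μ (j.val - k.val) else 0

/-- `D̂`, with `(D̂ x)_k = ∑_{l=N-k}^{N} d_μ(l+k-N) x_l`. -/
def matDhat (n μ N : ℕ) : Matrix (Fin (N + 1)) (Fin (N + 1)) ℂ :=
  Matrix.of fun k l => if N ≤ l.val + k.val then dCoef n μ (l.val + k.val - N) else 0

def matA (N : ℕ) (a : ℕ → ℂ) : Matrix (Fin (N + 1)) (Fin (N + 1)) ℂ :=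
  Matrix.of fun k j => if k.val + j.val ≤ N then a (k.val + j.val) else 0

def matW (n μ N : ℕ) : Matrix (Fin (N + 1)) (Fin (N + 1)) ℂ :=
  Matrix.of fun j k => if k ≤ j then wCoef n μ (j.val - k.val) else 0

/-- The squared Euclidean norm. -/
def sqNorm {N : ℕ} (x : Fin (N + 1) → ℂ) : ℝ := ∑ k, ‖x k‖ ^ 2

/-- `φ_{μ,N} = W φ_N`. -/
def phiMu (n μ : ℕ) {N : ℕ} (φ : Fin (N + 1) → ℂ) : Fin (N + 1) → ℂ := matW n μ N *ᵥ φ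

/-- `D A φ_{μ,N} = D A W φ_N`. -/
def rVec (n μ : ℕ) {N : ℕ} (a : ℕ → ℂ) (φ : Fin (N + 1) → ℂ) : Fin (N + 1) → ℂ :=
  matD n μ N *ᵥ (matA N a *ᵥ phiMu n μ φ)

/-- `D̂ A W φ_N`. -/
def rVecHat (n μ : ℕ) {N : ℕ} (a : ℕ → ℂ) (φ : Fin (N + 1) → ℂ) : Fin (N + 1) → ℂ :=
  matDhat n μ N *ᵥ (matA N a *ᵥ phiMu n μ φ)

/-- `φ_N` solves `D A W φ = α φ̄` or `D̂ A W φ = β φ̄` for some complex number `α` or `β`. -/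
def SolvesEigenEquation (n μ : ℕ) {N : ℕ} (a : ℕ → ℂ) (φ : Fin (N + 1) → ℂ) : Prop :=
  (∃ α : ℂ, rVec n μ a φ = α • star φ) ∨ (∃ β : ℂ, rVecHat n μ a φ = β • star φ)

/-- A finite sequence continued by zeros. -/
def extendZero {N : ℕ} (φ : Fin (N + 1) → ℂ) (k : ℕ) : ℂ :=
  if h : k < N + 1 then φ ⟨k, h⟩ else 0

/-- `|∑_{k=0}^{N} φ(k) e^{-iθk}|²`. -/
def maDensity {N : ℕ} (φ : Fin (N + 1) → ℂ) (θ : ℝ) : ℝ :=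
  ‖∑ k : Fin (N + 1), φ k * Complex.exp (-(Complex.I * θ * (k.val : ℂ)))‖ ^ 2

/-- `|c ∑_{k=0}^{N} (D A φ_{μ,N})_k e^{iθk}|²`. -/
def rDensity (n μ : ℕ) {N : ℕ} (a : ℕ → ℂ) (c : ℂ) (φ : Fin (N + 1) → ℂ) (θ : ℝ) : ℝ :=
  ‖c * ∑ k : Fin (N + 1), rVec n μ a φ k * Complex.exp (Complex.I * θ * (k.val : ℂ))‖ ^ 2

/-- `φ_N` solves the extremum problem `‖D A φ_{μ,N}‖² → max`, `|∑ φ(k) e^{-iθk}|² ∈ D`. -/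
def SolvesExtremum (n μ : ℕ) {N : ℕ} (a : ℕ → ℂ) (D : Set (ℝ → ℝ))
    (φ : Fin (N + 1) → ℂ) : Prop :=
  maDensity φ ∈ D ∧
    ∀ ψ : Fin (N + 1) → ℂ, maDensity ψ ∈ D → sqNorm (rVec n μ a ψ) ≤ sqNorm (rVec n μ a φ)

/-- `ν₀ P₀`: the maximum of `‖D A W φ‖²` over the solutions `φ` of the two equations with
`‖φ‖² = P₀` that define the canonical factorization of `|∑ φ(k) e^{-iθk}|²`
(`-∞` if there are none). -/
def nuP (n μ N : ℕ) (a : ℕ → ℂ) (P₀ : ℝ) : EReal :=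
  ⨆ φ ∈ {φ : Fin (N + 1) → ℂ | SolvesEigenEquation n μ a φ ∧ sqNorm φ = P₀ ∧
      IsCanonicalFactorization (maDensity φ) (extendZero φ)},
    (sqNorm (rVec n μ a φ) : EReal)

/-- `ν₀⁺ P₀`: the maximum of `‖D A W φ‖²` over the `φ` with `‖φ‖² = P₀` that define the canonical
factorization of the density `|c ∑ (D A W φ)_k e^{iθk}|²` for some `c` (`-∞` if there are none). -/
def nuPlusP (n μ N : ℕ) (a : ℕ → ℂ) (P₀ : ℝ) : EReal :=
  ⨆ φ ∈ {φ : Fin (N + 1) → ℂ | sqNorm φ = P₀ ∧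
      ∃ c : ℂ, IsCanonicalFactorization (rDensity n μ a c φ) (extendZero φ)},
    (sqNorm (rVec n μ a φ) : EReal)

/-- The step-`μ` increments of `ξ` are a one-sided moving average of order `N` with coefficients
`φ(0), …, φ(N)`: `ξ⁽ⁿ⁾(m, μ) = ∑_{k=0}^{N} φ(k) η(m-k)`. The driving sequence is the filtered white
noise `η(m) = ∑_{j ≥ 0} w_μ(j) ε(m-j)` that corresponds to the factor
`|1 - e^{-iθμ}|^{2n} / θ^{2n}`, which every step-`μ` increment carries; the `ε(m)` are
uncorrelated, have mean `0` and variance `1`, and `ε(m)` is in the closed linear span of the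
increments `ξ⁽ⁿ⁾(j, μ)`, `j ≤ m`. -/
def HasMovingAverage {Ω : Type*} [MeasurableSpace Ω] (P : Measure Ω) (n μ : ℕ) {N : ℕ}
    (ξ : ℤ → Ω → ℂ) (φ : Fin (N + 1) → ℂ) : Prop :=
  ∃ ε η : ℤ → Ω → ℂ,
    (∀ m, InClosedSpan P (fun j x => increment n ξ (m - (j : ℤ)) (μ : ℤ) x) (ε m)) ∧
    (∀ m, ∫ x, ε m x ∂P = 0) ∧
    (∀ m k, ∫ x, ε m x * star (ε k x) ∂P = if m = k then 1 else 0) ∧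
    (∀ m, MemLp (η m) 2 P) ∧
    (∀ m, Tendsto (fun K : ℕ => eLpNorm
      (fun x => η m x - ∑ j ∈ Finset.range K, wCoef n μ j * ε (m - (j : ℤ)) x) 2 P)
      atTop (𝓝 0)) ∧
    ∀ m, ∀ᵐ x ∂P, increment n ξ m (μ : ℤ) x = ∑ k : Fin (N + 1), φ k * η (m - (k.val : ℤ)) x

end

end IncrementExtrapolation

namespace IncrementExtrapolation

open Complex Metric

/-! ## The Schwarz integral formula -/

/-! Put z = e^{-iθ}, B = ∑ b(k) z^{-k} and Φ = ∑ φ(k) z^k. On the circle the factor |1 -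
e^{-iθμ}|^{2n}/θ^{2n} is |w(z)|², where w extends w_μ continuously to the closed disk
(`exists_isOuterWeight`). The prediction problem becomes the approximation of B by polynomials in z
vanishing at 0, with weight |w|² f. Sorting powers gives BwΦ = R + zF, where R = ∑ r(k) z^{-k} has
the coefficients r = DAWφ and F lies in the disk algebra (`exists_bFun_mul_eq`). So DAW is a Hankel
operator with symbol Bw, restricted to polynomials of degree at most N.

Lower bound: for f = |Φ|² an estimate alters only the part zF, which is orthogonal to R; hence Δ(f)
≥ ‖DAWφ‖² (`sqNorm_rVec_le_optimalError`).

Upper bound: suppose Φ has no zeros in the closed disk and |R|² = s|Φ|² on the circle. Then Bw = R/Φ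
+ zF/Φ, so modulo analytic functions vanishing at 0 the symbol has constant modulus √s, as in
Nehari's theorem. Polynomials p_k with p_k w → F/Φ boundedly yield estimates whose errors tend to
s·(1/2π)∫f for every density f (`IsExtremal.optimalError_le`). The same decomposition tested on ψ
gives ‖DAWψ‖² ≤ s‖ψ‖², and equality forces |R_ψ|² = s|Ψ|² (`IsExtremal.sqNorm_rVec_le`).

A φ that canonically factors |cR|² is such a maximal vector with s = |c|^{-2}. If ν₀⁺ is not -∞, one
exists, and then ν₀⁺P₀ = sP₀. Any φ₀ with ‖φ₀‖² = P₀ and ‖DAWφ₀‖² = sP₀ is caught between the two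
bounds, so its density is least favorable; the equality case identifies the solutions of the
extremum problem.

For the probabilistic meaning of Δ(f), the identity (1 - x^μ)^n ∑ d_μ(k) x^k = 1 turns the
functional plus the observed correction into ∑ b(k) ξ^{(n)}(k, μ), and finite combinations of
increments are isometric to trigonometric polynomials (`isLeast_linearEstimateErrors`). The moving
average arises by whitening the increments with polynomial approximate inverses of wΦ
(`hasMovingAverage`). -/

/-- `e^{-iθ}`. -/
noncomputable def cpt (θ : ℝ) : ℂ := Complex.exp (-(Complex.I * θ))

lemma norm_cpt (θ : ℝ) : ‖cpt θ‖ = 1 := by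
  simp [cpt, Complex.norm_exp]

lemma cpt_ne_zero (θ : ℝ) : cpt θ ≠ 0 := Complex.exp_ne_zero _

@[fun_prop]
lemma continuous_cpt : Continuous cpt := by unfold cpt; fun_prop

lemma cpt_mem_closedBall (θ : ℝ) : cpt θ ∈ closedBall (0 : ℂ) 1 := by
  simp [norm_cpt]

/-- The circle average over the unit circle as an integral over `(-π, π)`. -/
lemma circleAverage_eq_integral_symm (F : ℂ → ℂ) :
    Real.circleAverage F 0 1 =
      (1 / (2 * Real.pi) : ℂ) *
        ∫ θ in (-Real.pi)..Real.pi, F (Complex.exp (Complex.I * θ)) := by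
  have hper : Function.Periodic (fun θ : ℝ => F (circleMap 0 1 θ)) (2 * Real.pi) :=
    fun θ => by simp only [periodic_circleMap 0 1 θ]
  have h := hper.intervalIntegral_add_eq 0 (-Real.pi)
  rw [Real.circleAverage_def]
  have e1 : (0 : ℝ) + 2 * Real.pi = 2 * Real.pi := by ring
  have e2 : -Real.pi + 2 * Real.pi = Real.pi := by ring
  rw [e1, e2] at h
  rw [h, Complex.real_smul]
  congr 1
  · push_cast; ring
  · refine intervalIntegral.integral_congr fun θ _ => ?_
    simp [circleMap, mul_comm]

/-- Mean value property on the unit circle, parametrized by `e^{-iθ}`. -/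
lemma integral_cpt_eq {F : ℂ → ℂ} (hF : DiffContOnCl ℂ F (ball 0 1)) :
    ∫ θ in (-Real.pi)..Real.pi, F (cpt θ) = 2 * Real.pi * F 0 := by
  have h1 : Real.circleAverage F 0 1 = F 0 := by
    apply DiffContOnCl.circleAverage; simpa using hF
  rw [circleAverage_eq_integral_symm] at h1
  have h2 : ∫ θ in (-Real.pi)..Real.pi, F (cpt θ) =
      ∫ θ in (-Real.pi)..Real.pi, F (Complex.exp (Complex.I * θ)) := by
    have := intervalIntegral.integral_comp_neg (a := -Real.pi) (b := Real.pi)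
      (fun θ : ℝ => F (Complex.exp (Complex.I * θ)))
    simp only [neg_neg] at this
    rw [← this]
    refine intervalIntegral.integral_congr fun θ _ => ?_
    simp [cpt]
  rw [h2, ← h1]
  have := Real.pi_ne_zero
  have : (Real.pi : ℂ) ≠ 0 := by exact_mod_cast this
  field_simp

/-- Schwarz integral formula on the unit disk. -/
lemma schwarz_integral {g : ℂ → ℂ} (hg : DiffContOnCl ℂ g (ball 0 1)) (h0 : (g 0).im = 0)
    {z : ℂ} (hz : ‖z‖ < 1) :
    Real.circleAverage (fun ζ => (ζ + z) / (ζ - z) * ((g ζ).re : ℂ)) 0 1 = g z := by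
  have hzb : z ∈ ball (0 : ℂ) |1| := by simpa using hz
  have hg' : DiffContOnCl ℂ g (ball 0 |1|) := by simpa using hg
  have hcont : ContinuousOn g (sphere 0 |1|) :=
    hg'.2.mono (by rw [closure_ball _ (by norm_num)]; exact sphere_subset_closedBall)
  have hne : ∀ ζ ∈ sphere (0 : ℂ) |1|, ζ - z ≠ 0 := by
    intro ζ hζ h
    have : ‖ζ‖ = 1 := by simpa using hζ
    rw [sub_eq_zero.mp h] at this; linarith
  -- analytic part
  have h1 : Real.circleAverage (fun ζ => (ζ + z) / (ζ - z) * g ζ) 0 1 = 2 * g z - g 0 := by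
    have a1 := hg'.circleAverage_smul_div hzb
    have a2 := hg'.circleAverage
    -- Since (ζ + z)/(ζ - z) = 2ζ/(ζ - z) - 1, Cauchy's formula and the mean value property apply.
    have : Real.circleAverage (fun ζ => (ζ + z) / (ζ - z) * g ζ) 0 1 =
        Real.circleAverage (fun ζ => (2 : ℂ) • (((ζ - 0) / (ζ - z)) • g ζ) - g ζ) 0 1 := by
      apply Real.circleAverage_congr_sphere
      intro ζ hζ
      have := hne ζ hζ
      simp only [smul_eq_mul, sub_zero]
      field_simp
      ring
    rw [this, Real.circleAverage_fun_sub, Real.circleAverage_fun_smul, a1, a2]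
    · simp
    · apply ContinuousOn.circleIntegrable'
      have hq : ContinuousOn (fun ζ : ℂ => (ζ - 0) / (ζ - z)) (sphere 0 |1|) :=
        ContinuousOn.div (by fun_prop) (by fun_prop) hne
      exact (hq.smul hcont).const_smul (2 : ℂ)
    · exact hcont.circleIntegrable'
  -- conjugate part
  have h2 : Real.circleAverage (fun ζ => (ζ + z) / (ζ - z) * (starRingEnd ℂ) (g ζ)) 0 1 =
      (starRingEnd ℂ) (g 0) := by
    -- On the circle the conjugate of ζ is 1/ζ, so the integrand is the conjugate of this analytic
    -- function, whose mean is its value g(0) at the origin.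
    have hk : DiffContOnCl ℂ (fun ζ => (1 + (starRingEnd ℂ) z * ζ) /
        (1 - (starRingEnd ℂ) z * ζ) * g ζ) (ball 0 |1|) := by
      suffices h : DiffContOnCl ℂ (fun ζ => (1 + (starRingEnd ℂ) z * ζ) /
        (1 - (starRingEnd ℂ) z * ζ)) (ball 0 |1|) from h.smul hg'
      refine DifferentiableOn.diffContOnCl ?_
      rw [closure_ball _ (by norm_num)]
      refine DifferentiableOn.div (by fun_prop) (by fun_prop) ?_
      intro ζ hζ h
      have hζ' : ‖ζ‖ ≤ 1 := by simpa using hζ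
      have : ‖(starRingEnd ℂ) z * ζ‖ = 1 := by
        rw [← sub_eq_zero.mp h]; simp
      rw [norm_mul, RCLike.norm_conj] at this
      nlinarith [norm_nonneg z, norm_nonneg ζ]
    have a1 := hk.circleAverage
    have : Real.circleAverage (fun ζ => (ζ + z) / (ζ - z) * (starRingEnd ℂ) (g ζ)) 0 1 =
        Real.circleAverage ((Complex.conjCLE : ℂ →L[ℝ] ℂ) ∘
          (fun ζ => (1 + (starRingEnd ℂ) z * ζ) / (1 - (starRingEnd ℂ) z * ζ) * g ζ)) 0 1 := by
      apply Real.circleAverage_congr_sphere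
      intro ζ hζ
      have h3 := hne ζ hζ
      have h4 : ‖ζ‖ = 1 := by simpa using hζ
      have h5 : ζ * (starRingEnd ℂ) ζ = 1 := by rw [Complex.mul_conj']; simp [h4]
      have hζ0 : ζ ≠ 0 := by intro h; simp [h] at h4
      have h6 : (starRingEnd ℂ) ζ = ζ⁻¹ := eq_inv_of_mul_eq_one_right h5
      simp only [Function.comp, ContinuousLinearEquiv.coe_coe, Complex.conjCLE_apply, map_mul, map_div₀, map_add, map_sub,
        map_one, Complex.conj_conj, h6]
      congr 1
      have : 1 - z * ζ⁻¹ ≠ 0 := by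
        intro h
        apply h3
        field_simp at h
        simpa using h
      field_simp
    rw [this, ContinuousLinearMap.circleAverage_comp_comm, a1]
    · simp
    · exact (hk.2.mono (by rw [closure_ball _ (by norm_num)]; exact sphere_subset_closedBall)).circleIntegrable'
  have h3 : Real.circleAverage (fun ζ => (ζ + z) / (ζ - z) * ((g ζ).re : ℂ)) 0 1 =
      Real.circleAverage (fun ζ => (1 / 2 : ℂ) • ((ζ + z) / (ζ - z) * g ζ +
        (ζ + z) / (ζ - z) * (starRingEnd ℂ) (g ζ))) 0 1 := by
    apply Real.circleAverage_congr_sphere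
    intro ζ _
    simp only [smul_eq_mul, ← mul_add, Complex.add_conj]
    push_cast; ring
  have hS : ContinuousOn (fun ζ : ℂ => (ζ + z) / (ζ - z)) (sphere 0 |1|) :=
    ContinuousOn.div (by fun_prop) (by fun_prop) hne
  rw [h3, Real.circleAverage_fun_smul, Real.circleAverage_fun_add, h1, h2]
  · have : (starRingEnd ℂ) (g 0) = g 0 := Complex.conj_eq_iff_im.mpr h0
    rw [this]; simp
  · exact (hS.mul hcont).circleIntegrable'
  · exact (hS.mul (Complex.continuous_conj.comp_continuousOn hcont)).circleIntegrable'

lemma schwarz_integral' {g : ℂ → ℂ} (hg : DiffContOnCl ℂ g (ball 0 1)) (h0 : (g 0).im = 0)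
    {z : ℂ} (hz : ‖z‖ < 1) :
    ∫ θ in (-Real.pi)..Real.pi, (Complex.exp (Complex.I * θ) + z) /
      (Complex.exp (Complex.I * θ) - z) * ((g (Complex.exp (Complex.I * θ))).re : ℂ) =
      2 * Real.pi * g z := by
  have h := schwarz_integral hg h0 hz
  rw [circleAverage_eq_integral_symm] at h
  have : (Real.pi : ℂ) ≠ 0 := by exact_mod_cast Real.pi_ne_zero
  rw [← h]
  field_simp

/-! ## Analytic functions with a prescribed real part on the unit circle -/

/-- Integration by parts has no boundary term, so for k ≠ 0 the coefficient of f is that of f'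
divided by k, up to a constant. The coefficients of f' are square summable by Parseval, and c/|k| ≤
c² + 1/k². -/
lemma summable_fourierCoeffOn {f f' : ℝ → ℂ} {a b : ℝ} (hab : a < b) (hfab : f a = f b)
    (hd : ∀ x ∈ Set.Icc a b, HasDerivAt f (f' x) x) (hc : ContinuousOn f' (Set.Icc a b)) :
    Summable (fun k : ℤ => fourierCoeffOn hab f k) := by
  have hint : IntervalIntegrable f' volume a b := by
    apply ContinuousOn.intervalIntegrable
    rwa [Set.uIcc_of_le hab.le]
  have hL2 : MemLp f' 2 (volume.restrict (Set.Ioc a b)) := by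
    obtain ⟨C, hC⟩ := isCompact_Icc.exists_bound_of_continuousOn hc
    refine MemLp.of_bound (C := C) ?_ ?_
    · exact hint.1.aestronglyMeasurable
    · filter_upwards [ae_restrict_mem measurableSet_Ioc] with x hx
      exact hC x (Set.Ioc_subset_Icc_self hx)
  have h1 := (hasSum_sq_fourierCoeffOn hab hL2).summable
  have h2 : Summable (fun k : ℤ => 1 / (k : ℝ) ^ 2) :=
    Real.summable_one_div_int_pow.mpr (by norm_num)
  have h3 := (h1.add h2).mul_left ((b - a) / (2 * Real.pi))
  refine Summable.of_norm_bounded_eventually h3 ?_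
  have : {k : ℤ | k ≠ 0} ∈ cofinite := by
    rw [mem_cofinite]
    convert Set.finite_singleton (0 : ℤ) using 1
    ext k
    simp
  filter_upwards [this] with k hk
  have hk' : (k : ℝ) ≠ 0 := by exact_mod_cast hk
  rw [fourierCoeffOn_of_hasDerivAt hab hk (fun x hx => hd x (by rwa [Set.uIcc_of_le hab.le] at hx))
    hint, hfab, sub_self, mul_zero, zero_sub]
  have hba : 0 < b - a := sub_pos.mpr hab
  have hnb : ‖(b : ℂ) - a‖ = b - a := by
    rw [← Complex.ofReal_sub, Complex.norm_real, Real.norm_of_nonneg hba.le]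
  have hkn : ‖(k : ℂ)‖ = |(k : ℝ)| := by
    rw [← Complex.ofReal_intCast, Complex.norm_real, Real.norm_eq_abs]
  set c := ‖fourierCoeffOn hab f' k‖
  have hnorm : ‖1 / (-2 * (Real.pi : ℂ) * I * k) * -(((b : ℂ) - a) * fourierCoeffOn hab f' k)‖ =
      (b - a) / (2 * Real.pi) * (c * (1 / |(k : ℝ)|)) := by
    simp only [norm_mul, norm_neg, norm_div, norm_one, Complex.norm_I, hnb, hkn]
    simp only [Complex.norm_real, Real.norm_of_nonneg Real.pi_pos.le, Complex.norm_ofNat]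
    have := Real.pi_ne_zero
    field_simp
    rfl
  rw [hnorm]
  have : 1 / (k : ℝ) ^ 2 = (1 / |(k : ℝ)|) ^ 2 := by rw [div_pow, sq_abs, one_pow]
  rw [this]
  have hpp := Real.pi_pos
  gcongr
  nlinarith [sq_nonneg (c - 1 / |(k : ℝ)|), sq_nonneg (c + 1 / |(k : ℝ)|), norm_nonneg (fourierCoeffOn hab f' k)]

/-- A continuously differentiable function on `[-π, π]` with equal end values is, up to the factor
`2`, the boundary real part of a function of the disk algebra. -/
lemma exists_analytic_re_eq {L L' : ℝ → ℝ} (hL : L (-Real.pi) = L Real.pi)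
    (hd : ∀ x ∈ Set.Icc (-Real.pi) Real.pi, HasDerivAt L (L' x) x)
    (hc : ContinuousOn L' (Set.Icc (-Real.pi) Real.pi)) :
    ∃ g : ℂ → ℂ, DiffContOnCl ℂ g (ball 0 1) ∧ (g 0).im = 0 ∧
      ∀ θ ∈ Set.Icc (-Real.pi) Real.pi, (g (Complex.exp (Complex.I * θ))).re = L θ / 2 := by
  have hab : -Real.pi < Real.pi := by linarith [Real.pi_pos]
  set f : ℝ → ℂ := fun θ => (L θ : ℂ) with hf
  have hsum0 : Summable (fun k : ℤ => fourierCoeffOn hab f k) := by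
    refine summable_fourierCoeffOn (f' := fun θ => (L' θ : ℂ)) hab (by simp [hf, hL])
      (fun x hx => (hd x hx).ofReal_comp) ?_
    exact Complex.continuous_ofReal.comp_continuousOn hc
  set T : ℝ := 2 * Real.pi with hT
  have : Fact (0 < T) := ⟨by positivity⟩
  have hT2 : -Real.pi + T = Real.pi := by rw [hT]; ring
  have hcont : Continuous (AddCircle.liftIco T (-Real.pi) f) := by
    apply AddCircle.liftIco_continuous
    · simp [hf, hL, hT2]
    · rw [hT2]
      exact Complex.continuous_ofReal.comp_continuousOn
        (fun x hx => (hd x hx).continuousAt.continuousWithinAt)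
  set F : C(AddCircle T, ℂ) := ⟨_, hcont⟩ with hF
  set c : ℤ → ℂ := fourierCoeff F with hcdef
  have hcc : ∀ k, c k = fourierCoeffOn hab f k := by
    intro k
    have := fourierCoeff_liftIco_eq (T := T) (a := -Real.pi) f k
    rw [hcdef]
    simp only [hF, ContinuousMap.coe_mk]
    rw [this]
    congr 1
  have hsum : Summable c := by
    rw [show c = fun k => fourierCoeffOn hab f k from funext hcc]; exact hsum0
  have hF_apply : ∀ θ ∈ Set.Icc (-Real.pi) Real.pi, F (θ : AddCircle T) = f θ := by
    intro θ hθ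
    rcases hθ.2.lt_or_eq with h | h
    · exact AddCircle.liftIco_coe_apply (f := f) (by rw [hT2]; exact ⟨hθ.1, h⟩)
    · have h1 : ((θ : ℝ) : AddCircle T) = ((-Real.pi : ℝ) : AddCircle T) := by
        rw [← AddCircle.coe_add_period T (-Real.pi), hT2, h]
      have h2 := AddCircle.liftIco_coe_apply (p := T) (a := -Real.pi) (f := f) (x := -Real.pi)
        ⟨le_rfl, by rw [hT2]; exact hab⟩
      have h3 : f (-Real.pi) = f θ := by simp only [hf, h, hL]
      rw [h1, ← h3]
      exact h2
  have hfour : ∀ (k : ℤ) (θ : ℝ), fourier k (θ : AddCircle T) = Complex.exp (I * θ) ^ k := by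
    intro k θ
    rw [fourier_coe_apply, ← Complex.exp_int_mul]
    congr 1
    rw [hT]
    have : (Real.pi : ℂ) ≠ 0 := by exact_mod_cast Real.pi_ne_zero
    push_cast
    field_simp
  have hconj : ∀ k : ℤ, c (-k) = (starRingEnd ℂ) (c k) := by
    intro k
    rw [hcc, hcc, fourierCoeffOn_eq_integral, fourierCoeffOn_eq_integral]
    rw [Complex.real_smul, Complex.real_smul, map_mul, Complex.conj_ofReal]
    congr 1
    rw [intervalIntegral.integral_of_le hab.le, intervalIntegral.integral_of_le hab.le,
      ← integral_conj]
    refine integral_congr_ae (Eventually.of_forall fun x => ?_)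
    simp only [smul_eq_mul, map_mul, hf, Complex.conj_ofReal, neg_neg]
    rw [fourier_neg, Complex.conj_conj]
  have hsumN : Summable (fun k : ℕ => ‖c k‖) :=
    (hsum.comp_injective (i := fun k : ℕ => (k : ℤ)) Nat.cast_injective).norm
  have hbd : ∀ (k : ℕ) (z : ℂ), z ∈ closedBall (0 : ℂ) 1 → ‖c k * z ^ k‖ ≤ ‖c k‖ := by
    intro k z hz
    rw [norm_mul, norm_pow]
    have : ‖z‖ ≤ 1 := by simpa using hz
    exact mul_le_of_le_one_right (norm_nonneg _) (pow_le_one₀ (norm_nonneg _) this)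
  have hc0 : (c 0).im = 0 := by
    have := hconj 0
    rw [neg_zero] at this
    exact Complex.conj_eq_iff_im.mp this.symm
  -- As L is real, c(-k) is the conjugate of c(k), so L = c(0) + 2 Re ∑_{k ≥ 1} c(k) z^k; pairing k
  -- with -k counts the index 0 twice, whence the correction c(0)/2.
  refine ⟨fun z => ∑' k : ℕ, c k * z ^ k - c 0 / 2, ⟨?_, ?_⟩, ?_, ?_⟩
  · refine DifferentiableOn.sub_const ?_ _
    exact Complex.differentiableOn_tsum_of_summable_norm hsumN (fun k => by fun_prop) isOpen_ball
      (fun k z hz => hbd k z (ball_subset_closedBall hz))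
  · rw [closure_ball _ one_ne_zero]
    refine ContinuousOn.sub ?_ continuousOn_const
    exact continuousOn_tsum (fun k => by fun_prop) hsumN (fun k z hz => hbd k z hz)
  · have : ∑' k : ℕ, c k * (0 : ℂ) ^ k = c 0 := by
      rw [tsum_eq_single 0]
      · simp
      · intro k hk; simp [hk]
    simp only [this]
    rw [Complex.sub_im, hc0]
    simp [hc0]
  · intro θ hθ
    have hs := has_pointwise_sum_fourier_series_of_summable hsum (θ : AddCircle T)
    have hs2 := hs.nat_add_neg
    rw [hF_apply θ hθ] at hs2
    have hterm : ∀ k : ℕ, c (k : ℤ) • fourier (k : ℤ) (θ : AddCircle T) +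
        c (-(k : ℤ)) • fourier (-(k : ℤ)) (θ : AddCircle T) =
        ((2 * (c k * Complex.exp (I * θ) ^ k).re : ℝ) : ℂ) := by
      intro k
      rw [hconj, fourier_neg, hfour, smul_eq_mul, smul_eq_mul, ← map_mul, Complex.add_conj,
        zpow_natCast]
    simp only [← hcdef] at hs2
    simp only [hterm] at hs2
    have hsC : Summable (fun k : ℕ => c k * Complex.exp (I * θ) ^ k) :=
      Summable.of_norm_bounded hsumN (fun k => hbd k _ (by simp [Complex.norm_exp]))
    have h4 := hsC.hasSum
    have h5 : HasSum (fun k : ℕ => 2 * (c k * Complex.exp (I * θ) ^ k).re)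
        (2 * (∑' k : ℕ, c k * Complex.exp (I * θ) ^ k).re) :=
      (Complex.hasSum_re h4).mul_left 2
    have h6 := (Complex.hasSum_ofReal (L := .unconditional ℕ)).mpr h5
    have h7 := hs2.unique h6
    have h8 := congrArg Complex.re h7
    simp only [hf, Complex.add_re, Complex.ofReal_re, fourier_zero, smul_eq_mul, mul_one] at h8
    simp only [Complex.sub_re]
    have h9 : (c 0 / 2).re = (c 0).re / 2 := by simp
    rw [h9]
    linarith

/-! ### The zero-free factor sin(θ/2)/(θ/2) of the kernel. -/

lemma analyticOnNhd_sinc : AnalyticOnNhd ℝ Real.sinc Set.univ := by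
  intro x _
  by_cases hx : x = 0
  · subst hx
    rw [Real.sinc_eq_dslope]
    obtain ⟨p, hp⟩ := (Real.analyticAt_sin (x := 0))
    exact ⟨_, hp.has_fpower_series_dslope_fslope⟩
  · have : AnalyticAt ℝ (fun y => Real.sin y / y) x :=
      Real.analyticAt_sin.div analyticAt_id hx
    refine this.congr ?_
    filter_upwards [isOpen_ne.mem_nhds hx] with y hy
    rw [Real.sinc_of_ne_zero hy]

/-- `ln (4 sin²(θ/2) / θ²)`, continued by `0` at `θ = 0`. -/
noncomputable def logSinc (θ : ℝ) : ℝ := Real.log (Real.sinc (θ / 2) ^ 2)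

lemma sinc_half_pos {θ : ℝ} (hθ : θ ∈ Set.Icc (-Real.pi) Real.pi) : 0 < Real.sinc (θ / 2) := by
  by_cases h : θ = 0
  · simp [h]
  wlog hpos : 0 < θ generalizing θ with H
  · have := H (θ := -θ) ⟨by linarith [hθ.2], by linarith [hθ.1]⟩ (by simpa using h)
      (by rcases lt_or_gt_of_ne h with h' | h' <;> [linarith; exact absurd h' hpos])
    rwa [neg_div, Real.sinc_neg] at this
  rw [Real.sinc_of_ne_zero (by positivity)]
  have : 0 < Real.sin (θ / 2) :=
    Real.sin_pos_of_pos_of_lt_pi (by positivity) (by linarith [hθ.2, Real.pi_pos])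
  positivity

/-- On [-π, π] the argument θ/2 stays where sinc is positive, so the logarithm is continuously
differentiable; evenness makes the end values agree. The derivatives at the two ends need not match.
-/
lemma exists_analytic_logSinc : ∃ g : ℂ → ℂ, DiffContOnCl ℂ g (ball 0 1) ∧ (g 0).im = 0 ∧
      ∀ θ ∈ Set.Icc (-Real.pi) Real.pi, (g (Complex.exp (Complex.I * θ))).re = logSinc θ / 2 := by
  have hC : ContDiff ℝ 1 Real.sinc := analyticOnNhd_sinc.contDiff
  have hd : ∀ x ∈ Set.Icc (-Real.pi) Real.pi, HasDerivAt logSinc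
      ((2 * Real.sinc (x / 2) ^ (2 - 1) * (deriv Real.sinc (x / 2) * (1 / 2))) /
        (Real.sinc (x / 2) ^ 2)) x := by
    intro x hx
    have h1 : HasDerivAt (fun x : ℝ => x / 2) (1 / 2) x := (hasDerivAt_id x).div_const 2
    have h2 : HasDerivAt Real.sinc (deriv Real.sinc (x / 2)) (x / 2) :=
      (hC.differentiable one_ne_zero _).hasDerivAt
    have h3 := (h2.comp x h1).pow 2
    exact h3.log (by have := sinc_half_pos hx; exact (by positivity : Real.sinc (x / 2) ^ 2 ≠ 0))
  refine exists_analytic_re_eq ?_ hd ?_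
  · simp [logSinc, neg_div, Real.sinc_neg]
  · have hdc : Continuous (deriv Real.sinc) := hC.continuous_deriv le_rfl
    refine ContinuousOn.div ?_ ?_ ?_
    · have := Real.continuous_sinc
      fun_prop
    · have := Real.continuous_sinc
      fun_prop
    · intro x hx
      have := sinc_half_pos hx
      positivity

lemma norm_one_sub_cpt_sq (θ : ℝ) :
    ‖1 - Complex.exp (Complex.I * θ)‖ ^ 2 = θ ^ 2 * Real.sinc (θ / 2) ^ 2 := by
  have h1 : ‖1 - Complex.exp (Complex.I * θ)‖ ^ 2 = 4 * Real.sin (θ / 2) ^ 2 := by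
    rw [mul_comm Complex.I, ← Complex.normSq_eq_norm_sq, Complex.normSq_apply]
    simp only [Complex.sub_re, Complex.sub_im, Complex.one_re, Complex.one_im,
      Complex.exp_ofReal_mul_I_re, Complex.exp_ofReal_mul_I_im]
    have h2 : Real.cos θ = 1 - 2 * Real.sin (θ / 2) ^ 2 := by
      have := Real.cos_two_mul (θ / 2)
      rw [show 2 * (θ / 2) = θ by ring] at this
      rw [this]
      nlinarith [Real.sin_sq_add_cos_sq (θ / 2)]
    nlinarith [Real.sin_sq_add_cos_sq θ]
  rw [h1]
  by_cases h : θ = 0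
  · simp [h]
  · rw [Real.sinc_of_ne_zero (by simpa using h)]
    field_simp
    ring

/-! ## The outer function `w_μ` on the closed disk -/

lemma ae_exp_ne (a : ℂ) : ∀ᵐ θ : ℝ, Complex.exp (Complex.I * θ) ≠ a := by
  suffices h : {θ : ℝ | Complex.exp (Complex.I * θ) = a}.Countable by
    have := h.measure_zero volume
    rw [ae_iff]
    simpa using this
  by_cases h0 : ∃ θ₀ : ℝ, Complex.exp (Complex.I * θ₀) = a
  · obtain ⟨θ₀, hθ₀⟩ := h0
    refine (Set.countable_range (fun k : ℤ => θ₀ + k * (2 * Real.pi))).mono ?_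
    intro θ hθ
    have h1 : Complex.exp (Complex.I * θ) = Complex.exp (Complex.I * θ₀) := by
      rw [hθ₀]; exact hθ
    obtain ⟨k, hk⟩ := Complex.exp_eq_exp_iff_exists_int.mp h1
    refine ⟨k, ?_⟩
    have h2 : (θ : ℂ) = θ₀ + k * (2 * Real.pi) := by
      apply mul_left_cancel₀ Complex.I_ne_zero
      rw [hk]; ring
    exact_mod_cast h2.symm
  · convert Set.countable_empty
    ext θ
    simp only [Set.mem_ofPred_eq, Set.mem_empty_iff_false, iff_false]
    exact fun h => h0 ⟨θ, h⟩

lemma ae_cpt_ne (a : ℂ) : ∀ᵐ θ : ℝ, cpt θ ≠ a := by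
  filter_upwards [ae_exp_ne a⁻¹] with θ hθ h
  apply hθ
  rw [← h, cpt, ← Complex.exp_neg, neg_neg]

/-- Moving from x to rx costs at most 1 - r, and 1 - r is also at most the distance from rx to 1.
This provides majorants for radial limits at boundary zeros. -/
lemma norm_one_sub_le {x : ℂ} (hx : ‖x‖ ≤ 1) {r : ℝ} (hr : r < 1) (hr0 : 0 ≤ r) :
    ‖1 - x‖ ≤ 2 * ‖1 - r * x‖ := by
  have h1 : ‖(r : ℂ) * x‖ ≤ r := by
    rw [norm_mul, Complex.norm_real, Real.norm_of_nonneg hr0]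
    exact mul_le_of_le_one_right hr0 hx
  have h2 : 1 - r ≤ ‖1 - r * x‖ := by
    have := norm_sub_norm_le (1 : ℂ) (r * x)
    rw [norm_one] at this
    linarith
  have h3 : ‖(r : ℂ) * x - x‖ ≤ 1 - r := by
    have : (r : ℂ) * x - x = -(((1 - r : ℝ) : ℂ) * x) := by push_cast; ring
    rw [this, norm_neg, norm_mul, Complex.norm_real, Real.norm_of_nonneg (by linarith)]
    exact mul_le_of_le_one_right (by linarith) hx
  calc ‖1 - x‖ = ‖(1 - r * x) + (r * x - x)‖ := by congr 1; ring
    _ ≤ ‖1 - r * x‖ + ‖(r : ℂ) * x - x‖ := norm_add_le _ _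
    _ ≤ 2 * ‖1 - r * x‖ := by linarith

lemma norm_exp_I (θ : ℝ) : ‖Complex.exp (Complex.I * θ)‖ = 1 := by simp [Complex.norm_exp]

lemma intervalIntegrable_log_norm_one_sub (ζ : ℂ) :
    IntervalIntegrable (fun θ : ℝ => Real.log ‖1 - ζ * Complex.exp (Complex.I * θ)‖) volume
      (-Real.pi) Real.pi := by
  apply MeromorphicOn.intervalIntegrable_log_norm
  intro θ _
  apply AnalyticAt.meromorphicAt
  have h1 : AnalyticAt ℝ (fun θ : ℝ => (θ : ℂ)) θ := Complex.ofRealCLM.analyticAt θ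
  have h2 : AnalyticAt ℝ (fun θ : ℝ => Complex.exp (Complex.I * θ)) θ :=
    (Complex.differentiable_exp.analyticAt _).restrictScalars.comp (analyticAt_const.mul h1)
  exact analyticAt_const.sub (analyticAt_const.mul h2)

lemma norm_schwarz_kernel_le {z ζ : ℂ} (hz : ‖z‖ < 1) (hζ : ‖ζ‖ = 1) :
    ‖(ζ + z) / (ζ - z)‖ ≤ 2 / (1 - ‖z‖) := by
  rw [norm_div]
  have h1 : ‖ζ + z‖ ≤ 2 := (norm_add_le _ _).trans (by linarith)
  have h2 : 1 - ‖z‖ ≤ ‖ζ - z‖ := by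
    have := norm_sub_norm_le ζ z
    linarith
  have : 0 < 1 - ‖z‖ := by linarith
  gcongr

lemma continuous_schwarz_kernel {z : ℂ} (hz : ‖z‖ < 1) :
    Continuous (fun θ : ℝ => (Complex.exp (Complex.I * θ) + z) / (Complex.exp (Complex.I * θ) - z)) := by
  refine Continuous.div (by fun_prop) (by fun_prop) fun θ h => ?_
  have := norm_exp_I θ
  rw [sub_eq_zero.mp h] at this
  linarith

/-- The Schwarz integral of `ln |1 - ζ e^{iθ}|`, `|ζ| = 1`. -/
lemma schwarz_integral_log {ζ z : ℂ} (hζ : ‖ζ‖ = 1) (hz : ‖z‖ < 1) :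
    ∫ θ in (-Real.pi)..Real.pi, (Complex.exp (Complex.I * θ) + z) /
      (Complex.exp (Complex.I * θ) - z) *
        (Real.log ‖1 - ζ * Complex.exp (Complex.I * θ)‖ : ℂ) =
      2 * Real.pi * Complex.log (1 - ζ * z) := by
  have hslit : ∀ {x : ℂ}, ‖x‖ < 1 → 1 - x ∈ Complex.slitPlane := by
    intro x hx
    left
    have := (Complex.abs_re_le_norm x).trans_lt hx
    rw [Complex.sub_re, Complex.one_re]
    linarith [(abs_lt.mp this).2]
  have hlt : ∀ {x : ℂ} {r : ℝ}, ‖x‖ ≤ 1 → r < 1 → 0 ≤ r → ‖ζ * (r * x)‖ < 1 := by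
    intro x r hx hr hr0
    rw [norm_mul, norm_mul, hζ, one_mul, Complex.norm_real, Real.norm_of_nonneg hr0]
    nlinarith [norm_nonneg x]
  have hlt' : ‖ζ * z‖ < 1 := by rwa [norm_mul, hζ, one_mul]
  -- For r < 1 the logarithm is analytic on the closed disk and the Schwarz formula applies; the
  -- logarithmic singularity on the circle is reached as r → 1.
  have hr : ∀ r : ℝ, 0 ≤ r → r < 1 →
      ∫ θ in (-Real.pi)..Real.pi, (Complex.exp (Complex.I * θ) + z) /
      (Complex.exp (Complex.I * θ) - z) *
        (Real.log ‖1 - ζ * (r * Complex.exp (Complex.I * θ))‖ : ℂ) =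
      2 * Real.pi * Complex.log (1 - ζ * (r * z)) := by
    intro r hr0 hr1
    have hg : DiffContOnCl ℂ (fun x => Complex.log (1 - ζ * (r * x))) (ball 0 1) := by
      refine DifferentiableOn.diffContOnCl ?_
      rw [closure_ball _ one_ne_zero]
      intro x hx
      have : 1 - ζ * (r * x) ∈ Complex.slitPlane := hslit (hlt (by simpa using hx) hr1 hr0)
      have hd : DifferentiableAt ℂ (fun x : ℂ => 1 - ζ * (r * x)) x := by fun_prop
      exact (hd.clog this).differentiableWithinAt
    have := schwarz_integral' hg (by simp) hz
    simpa only [Complex.log_re] using this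
  have hU : Set.Ioo (0 : ℝ) 1 ∈ 𝓝[<] (1 : ℝ) := Ioo_mem_nhdsLT zero_lt_one
  have hlim1 : Tendsto (fun r : ℝ => ∫ θ in (-Real.pi)..Real.pi, (Complex.exp (Complex.I * θ) + z) /
      (Complex.exp (Complex.I * θ) - z) *
        (Real.log ‖1 - ζ * (r * Complex.exp (Complex.I * θ))‖ : ℂ)) (𝓝[<] 1)
      (𝓝 (∫ θ in (-Real.pi)..Real.pi, (Complex.exp (Complex.I * θ) + z) /
      (Complex.exp (Complex.I * θ) - z) *
        (Real.log ‖1 - ζ * Complex.exp (Complex.I * θ)‖ : ℂ))) := by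
    -- The majorant combines |1 - x| ≤ 2|1 - rx| from below with |1 - rx| ≤ 2 from above.
    refine intervalIntegral.tendsto_integral_filter_of_dominated_convergence
      (fun θ => 2 / (1 - ‖z‖) *
        (|Real.log ‖1 - ζ * Complex.exp (Complex.I * θ)‖| + Real.log 2)) ?_ ?_ ?_ ?_
    · refine Eventually.of_forall fun r => ?_
      refine ((continuous_schwarz_kernel hz).measurable.mul ?_).aestronglyMeasurable
      refine Complex.measurable_ofReal.comp (Real.measurable_log.comp ?_)
      exact (by fun_prop : Continuous fun θ : ℝ =>
        ‖1 - ζ * ((r : ℂ) * Complex.exp (Complex.I * θ))‖).measurable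
    · filter_upwards [hU] with r hr
      filter_upwards [ae_exp_ne ζ⁻¹] with θ hθ _
      have hζ0 : ζ ≠ 0 := by intro h; simp [h] at hζ
      have hne : 1 - ζ * Complex.exp (Complex.I * θ) ≠ 0 := by
        intro h
        exact hθ (eq_inv_of_mul_eq_one_right (sub_eq_zero.mp h).symm)
      have hpos : 0 < ‖1 - ζ * Complex.exp (Complex.I * θ)‖ := norm_pos_iff.mpr hne
      have h1 : ‖ζ * Complex.exp (Complex.I * θ)‖ = 1 := by rw [norm_mul, hζ, norm_exp_I, one_mul]
      have h2 := norm_one_sub_le h1.le hr.2 hr.1.le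
      have e : (r : ℂ) * (ζ * Complex.exp (Complex.I * θ)) =
          ζ * (r * Complex.exp (Complex.I * θ)) := by ring
      rw [e] at h2
      have h3 : ‖1 - ζ * (r * Complex.exp (Complex.I * θ))‖ ≤ 2 := by
        have := norm_sub_le (1 : ℂ) (ζ * (r * Complex.exp (Complex.I * θ)))
        have h4 := hlt (x := Complex.exp (Complex.I * θ)) (norm_exp_I θ).le hr.2 hr.1.le
        rw [norm_one] at this
        linarith
      rw [norm_mul]
      have hK := norm_schwarz_kernel_le hz (norm_exp_I θ)
      have hpos2 : 0 < ‖1 - ζ * (r * Complex.exp (Complex.I * θ))‖ := by linarith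
      have h5 : Real.log ‖1 - ζ * (r * Complex.exp (Complex.I * θ))‖ ≤ Real.log 2 :=
        Real.log_le_log hpos2 h3
      have h6 : Real.log ‖1 - ζ * Complex.exp (Complex.I * θ)‖ ≤
          Real.log 2 + Real.log ‖1 - ζ * (r * Complex.exp (Complex.I * θ))‖ := by
        rw [← Real.log_mul (by norm_num) hpos2.ne']
        exact Real.log_le_log hpos h2
      have h7 : ‖((Real.log ‖1 - ζ * (r * Complex.exp (Complex.I * θ))‖ : ℝ) : ℂ)‖ ≤
          |Real.log ‖1 - ζ * Complex.exp (Complex.I * θ)‖| + Real.log 2 := by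
        rw [Complex.norm_real, Real.norm_eq_abs, abs_le]
        constructor
        · linarith [neg_abs_le (Real.log ‖1 - ζ * Complex.exp (Complex.I * θ)‖)]
        · linarith [abs_nonneg (Real.log ‖1 - ζ * Complex.exp (Complex.I * θ)‖)]
      have : 0 < 1 - ‖z‖ := by linarith
      gcongr
    · exact ((intervalIntegrable_log_norm_one_sub ζ).abs.add
        intervalIntegrable_const).const_mul _
    · filter_upwards [ae_exp_ne ζ⁻¹] with θ hθ _
      have hne : 1 - ζ * Complex.exp (Complex.I * θ) ≠ 0 := by
        intro h
        exact hθ (eq_inv_of_mul_eq_one_right (sub_eq_zero.mp h).symm)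
      have hc : Tendsto (fun r : ℝ => ‖1 - ζ * ((r : ℂ) * Complex.exp (Complex.I * θ))‖) (𝓝[<] 1)
          (𝓝 ‖1 - ζ * Complex.exp (Complex.I * θ)‖) := by
        have h0 : Continuous (fun r : ℝ => ‖1 - ζ * ((r : ℂ) * Complex.exp (Complex.I * θ))‖) := by
          fun_prop
        have := (h0.tendsto 1).mono_left (nhdsWithin_le_nhds (s := Set.Iio 1))
        simpa using this
      have h1 := (Real.continuousAt_log (norm_ne_zero_iff.mpr hne)).tendsto.comp hc
      exact ((Complex.continuous_ofReal.tendsto _).comp h1).const_mul _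
  have hlim2 : Tendsto (fun r : ℝ => 2 * Real.pi * Complex.log (1 - ζ * (r * z))) (𝓝[<] 1)
      (𝓝 (2 * Real.pi * Complex.log (1 - ζ * z))) := by
    have h0 : Tendsto (fun r : ℝ => 1 - ζ * ((r : ℂ) * z)) (𝓝[<] 1) (𝓝 (1 - ζ * z)) := by
      have h0 : Continuous (fun r : ℝ => 1 - ζ * ((r : ℂ) * z)) := by fun_prop
      have := (h0.tendsto 1).mono_left (nhdsWithin_le_nhds (s := Set.Iio 1))
      simpa using this
    exact ((continuousAt_clog (hslit hlt')).tendsto.comp h0).const_mul _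
  refine tendsto_nhds_unique hlim1 (hlim2.congr' ?_)
  filter_upwards [hU] with r h
  exact (hr r h.1.le h.2).symm

/-- `w` is the extension of `w_μ` to the closed unit disk. -/
structure IsOuterWeight (n μ : ℕ) (w : ℂ → ℂ) : Prop where
  diffContOnCl : DiffContOnCl ℂ w (ball 0 1)
  eq_wFun : ∀ z : ℂ, ‖z‖ < 1 → w z = wFun n μ z
  norm_eq : ∀ θ : ℝ, θ ∈ Set.Icc (-Real.pi) Real.pi → θ ≠ 0 → ‖w (cpt θ)‖ = ‖kernel n μ θ‖
  exists_bound : ∃ M : ℝ, ∀ z : ℂ, ‖z‖ ≤ 1 → ∀ r : ℝ, 0 ≤ r → r < 1 → ‖w z‖ ≤ M * ‖w (r * z)‖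
  ae_ne_zero : ∀ᵐ θ : ℝ, w (cpt θ) ≠ 0

-- The root 1 is split off because its factor has to be paired with the zero of θ at the origin.
open Polynomial in
lemma one_sub_pow_eq_prod {μ : ℕ} (hμ : 1 ≤ μ) (z : ℂ) :
    1 - z ^ μ = (∏ ζ ∈ (nthRootsFinset μ (1 : ℂ)).erase 1, (1 - ζ * z)) * (1 - z) := by
  have hprim := Complex.isPrimitiveRoot_exp μ (by omega)
  have h := hprim.pow_sub_pow_eq_prod_sub_mul 1 z (by omega)
  rw [one_pow] at h
  rw [h, ← Finset.prod_erase_mul (nthRootsFinset μ (1 : ℂ)) _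
    (one_mem_nthRootsFinset (by omega)), one_mul]

open Polynomial in
lemma norm_of_mem_nthRoots {μ : ℕ} (hμ : 1 ≤ μ) {ζ : ℂ}
    (h : ζ ∈ (nthRootsFinset μ (1 : ℂ)).erase 1) : ‖ζ‖ = 1 := by
  have h1 := (mem_nthRootsFinset (by omega) _).mp (Finset.mem_of_mem_erase h)
  exact Complex.norm_eq_one_of_pow_eq_one h1 (by omega)

-- The quotient |1 - e^{iθμ}|/|θ| is sinc(θ/2) times the product of |1 - ζe^{iθ}| over the μ-th
-- roots of unity ζ ≠ 1. The linear factors carry all boundary zeros, and log sinc(θ/2) is the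
-- boundary real part of some g in the disk algebra. Each piece is reproduced by the Schwarz
-- integral, so w = (∏ (1 - ζz) · e^{g})^n.
open Polynomial in
theorem exists_isOuterWeight (n μ : ℕ) (hμ : 1 ≤ μ) : ∃ w, IsOuterWeight n μ w := by
  obtain ⟨g, hg, hg0, hgre⟩ := exists_analytic_logSinc
  set S := (nthRootsFinset μ (1 : ℂ)).erase 1 with hS
  have hSn : ∀ ζ ∈ S, ‖ζ‖ = 1 := fun ζ hζ => norm_of_mem_nthRoots hμ hζ
  have hexp : ∀ θ ∈ Set.Icc (-Real.pi) Real.pi,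
      Real.exp (g (Complex.exp (Complex.I * θ))).re = Real.sinc (θ / 2) := by
    intro θ hθ
    rw [hgre θ hθ, logSinc, Real.log_pow]
    rw [show ((2 : ℕ) : ℝ) * Real.log (Real.sinc (θ / 2)) / 2 = Real.log (Real.sinc (θ / 2)) by
      push_cast; ring, Real.exp_log (sinc_half_pos hθ)]
  have hone : ∀ θ ∈ Set.Icc (-Real.pi) Real.pi,
      ‖1 - Complex.exp (Complex.I * θ)‖ = |θ| * Real.sinc (θ / 2) := by
    intro θ hθ
    have h1 := norm_one_sub_cpt_sq θ
    have h2 := sinc_half_pos hθ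
    rw [← abs_of_nonneg (norm_nonneg (1 - Complex.exp (Complex.I * θ))),
      ← abs_of_pos h2, ← abs_mul]
    exact (sq_eq_sq_iff_abs_eq_abs _ _).mp (by rw [h1]; ring)
  have hquot : ∀ θ ∈ Set.Icc (-Real.pi) Real.pi, θ ≠ 0 →
      ‖1 - Complex.exp (Complex.I * θ) ^ μ‖ / |θ| =
      (∏ ζ ∈ S, ‖1 - ζ * Complex.exp (Complex.I * θ)‖) * Real.sinc (θ / 2) := by
    intro θ hθ h0
    rw [one_sub_pow_eq_prod hμ, norm_mul, norm_prod, hone θ hθ]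
    have : |θ| ≠ 0 := abs_ne_zero.mpr h0
    rw [← hS, mul_comm |θ|, ← mul_assoc, mul_div_assoc, div_self this, mul_one]
  have hcpt : ∀ θ : ℝ, cpt θ = Complex.exp (Complex.I * (-θ : ℝ)) := by
    intro θ; simp [cpt]
  refine ⟨fun z => ((∏ ζ ∈ S, (1 - ζ * z)) * Complex.exp (g z)) ^ n, ?_, ?_, ?_, ?_, ?_⟩
  · have h1 : DiffContOnCl ℂ (fun z : ℂ => ∏ ζ ∈ S, (1 - ζ * z)) (ball 0 1) :=
      Differentiable.diffContOnCl (by fun_prop)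
    have h2 : DiffContOnCl ℂ (fun z => Complex.exp (g z)) (ball 0 1) :=
      ⟨hg.1.cexp, hg.2.cexp⟩
    have h3 := h1.smul h2
    exact ⟨h3.1.pow n, h3.2.pow n⟩
  · intro z hz
    have hslit : ∀ {x : ℂ}, ‖x‖ < 1 → 1 - x ≠ 0 := by
      intro x hx h
      rw [← sub_eq_zero.mp h] at hx
      simp at hx
    have hae : ∀ᵐ θ : ℝ, θ ∈ Set.uIoc (-Real.pi) Real.pi →
        (Complex.exp (Complex.I * θ) + z) / (Complex.exp (Complex.I * θ) - z) *
        (Real.log (‖1 - Complex.exp (-(Complex.I * θ * μ))‖ ^ (2 * n) / θ ^ (2 * n)) : ℂ) =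
        (2 * n : ℂ) * (∑ ζ ∈ S, (Complex.exp (Complex.I * θ) + z) /
          (Complex.exp (Complex.I * θ) - z) *
          (Real.log ‖1 - ζ * Complex.exp (Complex.I * θ)‖ : ℂ)) +
        (2 * n : ℂ) * ((Complex.exp (Complex.I * θ) + z) / (Complex.exp (Complex.I * θ) - z) *
          ((g (Complex.exp (Complex.I * θ))).re : ℂ)) := by
      have h1 : ∀ᵐ θ : ℝ, ∀ ζ ∈ S, Complex.exp (Complex.I * θ) ≠ ζ⁻¹ :=
        (Finset.eventually_all S).mpr fun ζ _ => ae_exp_ne ζ⁻¹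
      have h2 : ∀ᵐ θ : ℝ, θ ≠ 0 := by simp [ae_iff]
      filter_upwards [h1, h2] with θ h1 h2 hθ
      have hθ' : θ ∈ Set.Icc (-Real.pi) Real.pi := by
        rw [Set.uIoc_of_le (by linarith [Real.pi_pos])] at hθ
        exact Set.Ioc_subset_Icc_self hθ
      have hne : ∀ ζ ∈ S, ‖1 - ζ * Complex.exp (Complex.I * θ)‖ ≠ 0 := by
        intro ζ hζ h
        exact h1 ζ hζ (eq_inv_of_mul_eq_one_right (sub_eq_zero.mp (norm_eq_zero.mp h)).symm)
      have hsp := sinc_half_pos hθ'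
      have hconj : ‖1 - Complex.exp (-(Complex.I * θ * μ))‖ =
          ‖1 - Complex.exp (Complex.I * θ) ^ μ‖ := by
        rw [← RCLike.norm_conj (1 - Complex.exp (Complex.I * θ) ^ μ)]
        congr 1
        rw [map_sub, map_one, map_pow, ← Complex.exp_conj, ← Complex.exp_nat_mul]
        congr 2
        simp
        ring
      have habs : θ ^ (2 * n) = |θ| ^ (2 * n) := by
        rw [pow_mul, pow_mul, sq_abs]
      have hlog : Real.log (‖1 - Complex.exp (-(Complex.I * θ * μ))‖ ^ (2 * n) / θ ^ (2 * n)) =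
          2 * n * (∑ ζ ∈ S, Real.log ‖1 - ζ * Complex.exp (Complex.I * θ)‖ +
            (g (Complex.exp (Complex.I * θ))).re) := by
        rw [hconj, habs, ← div_pow, hquot θ hθ' h2, Real.log_pow,
          Real.log_mul (Finset.prod_ne_zero_iff.mpr hne) hsp.ne', Real.log_prod hne,
          ← hexp θ hθ', Real.log_exp]
        push_cast; ring
      rw [hlog]
      push_cast
      rw [← Finset.mul_sum]
      ring
    have hIntS : ∀ ζ ∈ S, IntervalIntegrable (fun θ : ℝ => (Complex.exp (Complex.I * θ) + z) /
          (Complex.exp (Complex.I * θ) - z) *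
          (Real.log ‖1 - ζ * Complex.exp (Complex.I * θ)‖ : ℂ)) volume (-Real.pi) Real.pi := by
      intro ζ _
      have h1 : IntervalIntegrable (fun θ : ℝ =>
          (Real.log ‖1 - ζ * Complex.exp (Complex.I * θ)‖ : ℂ)) volume (-Real.pi) Real.pi :=
        ⟨(intervalIntegrable_log_norm_one_sub ζ).1.ofReal,
          (intervalIntegrable_log_norm_one_sub ζ).2.ofReal⟩
      exact h1.continuousOn_mul (continuous_schwarz_kernel hz).continuousOn
    have hIntg : IntervalIntegrable (fun θ : ℝ => (Complex.exp (Complex.I * θ) + z) /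
          (Complex.exp (Complex.I * θ) - z) * ((g (Complex.exp (Complex.I * θ))).re : ℂ))
          volume (-Real.pi) Real.pi := by
      apply Continuous.intervalIntegrable
      refine (continuous_schwarz_kernel hz).mul (Complex.continuous_ofReal.comp
        (Complex.continuous_re.comp ?_))
      have hgc := hg.2
      rw [closure_ball _ one_ne_zero] at hgc
      exact hgc.comp_continuous (by fun_prop) (fun θ => by simp)
    rw [wFun, intervalIntegral.integral_congr_ae hae, intervalIntegral.integral_add,
      intervalIntegral.integral_const_mul, intervalIntegral.integral_const_mul,
      intervalIntegral.integral_finsetSum hIntS, schwarz_integral' hg hg0 hz,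
      Finset.sum_congr rfl fun ζ hζ => schwarz_integral_log (hSn ζ hζ) hz, ← Finset.mul_sum]
    · have hpi : (Real.pi : ℂ) ≠ 0 := by exact_mod_cast Real.pi_ne_zero
      -- The factor 1/(4π) against the 2π of the Schwarz formula halves the exponent 2n.
      have : (1 / (4 * Real.pi) : ℂ) * (2 * n * (2 * Real.pi * ∑ ζ ∈ S, Complex.log (1 - ζ * z)) +
          2 * n * (2 * Real.pi * g z)) =
          n * (∑ ζ ∈ S, Complex.log (1 - ζ * z) + g z) := by
        generalize ∑ ζ ∈ S, Complex.log (1 - ζ * z) = X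
        field_simp; ring
      rw [this, Complex.exp_nat_mul, Complex.exp_add, Complex.exp_sum]
      congr 2
      refine Finset.prod_congr rfl fun ζ hζ => ?_
      rw [Complex.exp_log]
      apply hslit
      rw [norm_mul, hSn ζ hζ, one_mul]; exact hz
    · have := IntervalIntegrable.sum S hIntS
      simp only [Finset.sum_fn] at this
      exact this.const_mul _
    · exact hIntg.const_mul _
  · intro θ hθ h0
    -- The boundary identities are stated at e^{iθ}, whereas `cpt θ` is e^{-iθ}.
    have hθ' : -θ ∈ Set.Icc (-Real.pi) Real.pi := ⟨by linarith [hθ.2], by linarith [hθ.1]⟩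
    have h1 := hquot (-θ) hθ' (neg_ne_zero.mpr h0)
    rw [← hexp (-θ) hθ', ← hcpt] at h1
    rw [norm_pow, norm_mul, norm_prod, Complex.norm_exp, ← h1, kernel, norm_div, norm_pow, norm_pow,
      norm_mul, Complex.norm_I, one_mul, Complex.norm_real, Real.norm_eq_abs, div_pow, abs_neg]
    congr 4
    rw [cpt, ← Complex.exp_nat_mul]
    congr 1; ring
  · have hgc := hg.2
    rw [closure_ball _ one_ne_zero] at hgc
    obtain ⟨C, hC⟩ := (isCompact_closedBall (0 : ℂ) 1).exists_bound_of_continuousOn hgc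
    -- Each linear factor costs 2 under dilation, and the quotient of the two exponentials is at
    -- most e^{2C}.
    refine ⟨((∏ ζ ∈ S, 2) * Real.exp (2 * C)) ^ n, fun z hz r hr0 hr1 => ?_⟩
    rw [norm_pow, norm_pow, ← mul_pow]
    refine pow_le_pow_left₀ (norm_nonneg _) ?_ n
    rw [norm_mul, norm_mul, norm_prod, norm_prod, mul_mul_mul_comm, ← Finset.prod_mul_distrib]
    refine mul_le_mul ?_ ?_ (norm_nonneg _) (by positivity)
    · refine Finset.prod_le_prod (fun _ _ => norm_nonneg _) fun ζ hζ => ?_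
      have h1 := norm_one_sub_le (x := ζ * z) (by rw [norm_mul, hSn ζ hζ, one_mul]; exact hz) hr1 hr0
      rw [show (r : ℂ) * (ζ * z) = ζ * (r * z) by ring] at h1
      exact h1
    · rw [Complex.norm_exp, Complex.norm_exp, ← Real.exp_add]
      apply Real.exp_le_exp.mpr
      have h1 := hC z (by simpa using hz)
      have h2 := hC (r * z) (by
        simp only [mem_closedBall, dist_zero_right, norm_mul, Complex.norm_real,
          Real.norm_of_nonneg hr0]
        nlinarith [norm_nonneg z])
      have h3 := (abs_le.mp (Complex.abs_re_le_norm (g z))).2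
      have h4 := (abs_le.mp (Complex.abs_re_le_norm (g (r * z)))).1
      linarith
  · have h1 : ∀ᵐ θ : ℝ, ∀ ζ ∈ S, cpt θ ≠ ζ⁻¹ :=
      (Finset.eventually_all S).mpr fun ζ _ => ae_cpt_ne ζ⁻¹
    filter_upwards [h1] with θ h1
    refine pow_ne_zero _ (mul_ne_zero (Finset.prod_ne_zero_iff.mpr fun ζ hζ h => ?_)
      (Complex.exp_ne_zero _))
    exact h1 ζ hζ (eq_inv_of_mul_eq_one_right (sub_eq_zero.mp h).symm)

/-! ## Polynomial approximation -/

/-- The dilation is analytic beyond the closed unit disk, so its Taylor polynomials converge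
uniformly there. -/
lemma exists_polynomial_near_dilation {V : ℂ → ℂ} (hV : DifferentiableOn ℂ V (ball 0 1)) {r : ℝ}
    (hr0 : 0 ≤ r) (hr1 : r < 1) {ε : ℝ} (hε : 0 < ε) :
    ∃ p : Polynomial ℂ, ∀ z : ℂ, ‖z‖ ≤ 1 → ‖p.eval z - V (r * z)‖ < ε := by
  obtain ⟨r', hr', hr'1⟩ := exists_between hr1
  obtain ⟨R, hR, hR1⟩ := exists_between hr'1
  have hR0 : 0 < R := by linarith
  lift R to NNReal using hR0.le
  lift r' to NNReal using (by linarith)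
  have hs : HasFPowerSeriesOnBall V (cauchyPowerSeries V 0 R) 0 R :=
    DifferentiableOn.hasFPowerSeriesOnBall
      (hV.mono (closedBall_subset_ball hR1)) (by exact_mod_cast hR0)
  have hu := hs.tendstoUniformlyOn (r' := r') (by exact_mod_cast hR)
  obtain ⟨m, hm⟩ := (Metric.tendstoUniformlyOn_iff.mp hu ε hε).exists
  refine ⟨∑ k ∈ Finset.range m, Polynomial.C ((cauchyPowerSeries V 0 R).coeff k * (r : ℂ) ^ k) *
    Polynomial.X ^ k, fun z hz => ?_⟩
  have hz' : (r : ℂ) * z ∈ ball (0 : ℂ) r' := by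
    simp only [mem_ball, dist_zero_right, norm_mul, Complex.norm_real, Real.norm_of_nonneg hr0]
    nlinarith [norm_nonneg z]
  have := hm _ hz'
  rw [zero_add, dist_comm, dist_eq_norm] at this
  refine lt_of_eq_of_lt (congrArg (fun x => ‖x - V (r * z)‖) ?_) this
  rw [Polynomial.eval_finsetSum, FormalMultilinearSeries.partialSum]
  refine Finset.sum_congr rfl fun k _ => ?_
  rw [FormalMultilinearSeries.apply_eq_pow_smul_coeff]
  simp only [Polynomial.eval_mul, Polynomial.eval_C, Polynomial.eval_pow, Polynomial.eval_X,
    smul_eq_mul]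
  ring

lemma DiffContOnCl.exists_bound {G : ℂ → ℂ} (hG : DiffContOnCl ℂ G (ball 0 1)) :
    ∃ C : ℝ, 0 ≤ C ∧ ∀ z : ℂ, ‖z‖ ≤ 1 → ‖G z‖ ≤ C := by
  have h := hG.2
  rw [closure_ball _ one_ne_zero] at h
  obtain ⟨C, hC⟩ := (isCompact_closedBall (0 : ℂ) 1).exists_bound_of_continuousOn h
  refine ⟨C, (norm_nonneg _).trans (hC 0 (by simp)), fun z hz => hC z (by simpa using hz)⟩

lemma DiffContOnCl.tendsto_dilation {G : ℂ → ℂ} (hG : DiffContOnCl ℂ G (ball 0 1)) {z : ℂ}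
    (hz : ‖z‖ ≤ 1) {r : ℕ → ℝ} (hr0 : ∀ k, 0 ≤ r k) (hr1 : ∀ k, r k < 1)
    (hr : Tendsto r atTop (𝓝 1)) : Tendsto (fun k => G (r k * z)) atTop (𝓝 (G z)) := by
  have h := hG.2
  rw [closure_ball _ one_ne_zero] at h
  have hmem : z ∈ closedBall (0 : ℂ) 1 := by simpa using hz
  refine (h z hmem).tendsto.comp (tendsto_nhdsWithin_iff.mpr ⟨?_, Eventually.of_forall fun k => ?_⟩)
  · have : Tendsto (fun k => (r k : ℂ)) atTop (𝓝 1) := by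
      exact_mod_cast (Complex.continuous_ofReal.tendsto 1).comp hr
    simpa using this.mul_const z
  · simp only [mem_closedBall, dist_zero_right, norm_mul, Complex.norm_real,
      Real.norm_of_nonneg (hr0 k)]
    nlinarith [norm_nonneg z, hr1 k, hr0 k]

/-- Polynomials `p` for which `p w` converges boundedly on the unit circle to a given function of
the disk algebra. -/
lemma exists_polynomial_mul_tendsto {w G : ℂ → ℂ} (hw : DiffContOnCl ℂ w (ball 0 1))
    (hw0 : ∀ z : ℂ, ‖z‖ < 1 → w z ≠ 0)
    (hwM : ∃ M : ℝ, ∀ z : ℂ, ‖z‖ ≤ 1 → ∀ r : ℝ, 0 ≤ r → r < 1 → ‖w z‖ ≤ M * ‖w (r * z)‖)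
    (hG : DiffContOnCl ℂ G (ball 0 1)) :
    ∃ (p : ℕ → Polynomial ℂ) (M : ℝ), (∀ k, ∀ z : ℂ, ‖z‖ = 1 → ‖(p k).eval z * w z‖ ≤ M) ∧
      ∀ z : ℂ, ‖z‖ = 1 → w z ≠ 0 →
        Tendsto (fun k => (p k).eval z * w z) atTop (𝓝 (G z)) := by
  obtain ⟨M, hM⟩ := hwM
  obtain ⟨Cw, hCw0, hCw⟩ := DiffContOnCl.exists_bound hw
  obtain ⟨CG, hCG0, hCG⟩ := DiffContOnCl.exists_bound hG
  have hV : DifferentiableOn ℂ (fun z => G z / w z) (ball 0 1) :=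
    hG.1.div hw.1 (fun z hz => hw0 z (by simpa using hz))
  set r : ℕ → ℝ := fun k => 1 - 1 / ((k : ℝ) + 1) with hr
  have hk : ∀ k : ℕ, 0 < 1 / ((k : ℝ) + 1) := fun k => by positivity
  have hr0 : ∀ k, 0 ≤ r k := by
    intro k
    have : 1 / ((k : ℝ) + 1) ≤ 1 := by
      rw [div_le_one (by positivity)]; linarith [(Nat.cast_nonneg k : (0 : ℝ) ≤ k)]
    simp only [hr]; linarith
  have hr1 : ∀ k, r k < 1 := fun k => by simp only [hr]; linarith [hk k]
  have hlim0 : Tendsto (fun k : ℕ => 1 / ((k : ℝ) + 1)) atTop (𝓝 0) :=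
    tendsto_one_div_add_atTop_nhds_zero_nat
  have hrlim : Tendsto r atTop (𝓝 1) := by
    have := hlim0.const_sub 1
    rwa [sub_zero] at this
  -- The polynomials approximate dilations of G/w; this quotient itself may be unbounded near
  -- boundary zeros of w.
  choose p hp using fun k => exists_polynomial_near_dilation hV (hr0 k) (hr1 k) (hk k)
  have hrz : ∀ k, ∀ z : ℂ, ‖z‖ = 1 → ‖(r k : ℂ) * z‖ < 1 := by
    intro k z hz
    rw [norm_mul, hz, mul_one, Complex.norm_real, Real.norm_of_nonneg (hr0 k)]
    exact hr1 k
  refine ⟨p, CG * M + Cw, fun k z hz => ?_, fun z hz hwz => ?_⟩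
  · have h1 := hp k z hz.le
    -- The bound of w(z) by a multiple of w(rz) absorbs the small denominators uniformly in r.
    have h2 : ‖G (r k * z) / w (r k * z) * w z‖ ≤ CG * M := by
      rw [norm_mul, norm_div, div_mul_eq_mul_div]
      have h3 := hM z hz.le (r k) (hr0 k) (hr1 k)
      have h4 := norm_pos_iff.mpr (hw0 _ (hrz k z hz))
      have h5 := hCG _ (hrz k z hz).le
      rw [div_le_iff₀ h4, mul_assoc]
      exact mul_le_mul h5 h3 (norm_nonneg _) hCG0
    have h3 : (1 : ℝ) / (k + 1) ≤ 1 := by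
      have := hr0 k
      simp only [hr] at this
      linarith
    calc ‖(p k).eval z * w z‖
        = ‖G (r k * z) / w (r k * z) * w z + ((p k).eval z - G (r k * z) / w (r k * z)) * w z‖ := by
          congr 1; ring
      _ ≤ CG * M + 1 * Cw := by
          refine (norm_add_le _ _).trans (add_le_add h2 ?_)
          rw [norm_mul]
          exact mul_le_mul (h1.le.trans h3) (hCw z hz.le) (norm_nonneg _) zero_le_one
      _ = _ := by rw [one_mul]
  · have h1 : Tendsto (fun k => (p k).eval z - G (r k * z) / w (r k * z)) atTop (𝓝 0) :=
      squeeze_zero_norm (fun k => (hp k z hz.le).le) hlim0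
    have h2 := (DiffContOnCl.tendsto_dilation hG hz.le hr0 hr1 hrlim).div
      (DiffContOnCl.tendsto_dilation hw hz.le hr0 hr1 hrlim) hwz
    have h3 := (h1.add h2).mul_const (w z)
    simp only [Pi.div_apply, sub_add_cancel, zero_add] at h3
    rwa [div_mul_cancel₀ _ hwz] at h3

/-! ### Taylor remainders at the origin. -/

/-- The remainder `(w(z) - ∑_{j<m} c_j z^j) / z^m` of the Taylor expansion at `0`. -/
noncomputable def taylorTail (w : ℂ → ℂ) (m : ℕ) : ℂ → ℂ := (fun f => dslope f 0)^[m] w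

lemma DiffContOnCl.dslope_zero {w : ℂ → ℂ} (hw : DiffContOnCl ℂ w (ball 0 1)) :
    DiffContOnCl ℂ (dslope w 0) (ball 0 1) := by
  have hb : ball (0 : ℂ) 1 ∈ 𝓝 (0 : ℂ) := ball_mem_nhds _ one_pos
  refine ⟨(Complex.differentiableOn_dslope hb).mpr hw.1, ?_⟩
  rw [continuousOn_dslope (mem_of_superset hb subset_closure)]
  exact ⟨hw.2, hw.1.differentiableAt hb⟩

lemma diffContOnCl_taylorTail {w : ℂ → ℂ} (hw : DiffContOnCl ℂ w (ball 0 1)) (m : ℕ) :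
    DiffContOnCl ℂ (taylorTail w m) (ball 0 1) := by
  induction m with
  | zero => exact hw
  | succ m ih =>
    rw [taylorTail, Function.iterate_succ_apply']
    exact DiffContOnCl.dslope_zero ih

lemma eq_sum_add_taylorTail (w : ℂ → ℂ) (m : ℕ) (z : ℂ) :
    w z = ∑ j ∈ Finset.range m, taylorTail w j 0 * z ^ j + z ^ m * taylorTail w m z := by
  induction m with
  | zero => simp [taylorTail]
  | succ m ih =>
    have h := sub_smul_dslope (taylorTail w m) 0 z
    rw [sub_zero, smul_eq_mul] at h
    have h2 : taylorTail w (m + 1) z = dslope (taylorTail w m) 0 z := by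
      rw [taylorTail, Function.iterate_succ_apply']; rfl
    rw [Finset.sum_range_succ, h2, pow_succ, mul_assoc, h]
    conv_lhs => rw [ih]
    ring

/-- Each `dslope` at 0 shifts the power series by one place, so the value at 0 is the m-th Taylor
coefficient. -/
lemma taylorTail_zero_eq {w : ℂ → ℂ} (hw : DiffContOnCl ℂ w (ball 0 1)) (m : ℕ) :
    taylorTail w m 0 = iteratedDeriv m w 0 / (m.factorial : ℂ) := by
  have ha : AnalyticAt ℂ w 0 := hw.1.analyticAt (ball_mem_nhds _ one_pos)
  obtain ⟨p, hp⟩ := ha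
  have h1 := hp.has_fpower_series_iterate_dslope_fslope m
  have h2 := h1.coeff_zero (fun _ => 0)
  have h3 : ((Function.swap dslope (0 : ℂ))^[m] w) 0 = p.coeff m := by
    rw [← h2]
    have := FormalMultilinearSeries.coeff_iterate_fslope (p := p) m 0
    rw [zero_add] at this
    rw [← this, FormalMultilinearSeries.coeff]
    congr 1
    ext i; exact i.elim0
  have h4 : taylorTail w m 0 = p.coeff m := h3
  rw [h4]
  have h5 := hp.analyticAt.hasFPowerSeriesAt
  have h6 := hp.eq_formalMultilinearSeries h5
  rw [h6, FormalMultilinearSeries.coeff_ofScalars]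

lemma IsOuterWeight.ne_zero {n μ : ℕ} {w : ℂ → ℂ} (hw : IsOuterWeight n μ w) {z : ℂ}
    (hz : ‖z‖ < 1) : w z ≠ 0 := by
  rw [hw.eq_wFun z hz, wFun]; exact Complex.exp_ne_zero _

lemma IsOuterWeight.taylorTail_zero {n μ : ℕ} {w : ℂ → ℂ} (hw : IsOuterWeight n μ w) (m : ℕ) :
    taylorTail w m 0 = wCoef n μ m := by
  rw [taylorTail_zero_eq hw.diffContOnCl, wCoef]
  congr 1
  apply Filter.EventuallyEq.iteratedDeriv_eq
  filter_upwards [ball_mem_nhds (0 : ℂ) one_pos] with z hz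
  exact hw.eq_wFun z (by simpa using hz)

/-! ## Parseval identities on the unit circle -/

lemma DiffContOnCl.continuousOn_closedBall {F : ℂ → ℂ} (hF : DiffContOnCl ℂ F (ball 0 1)) :
    ContinuousOn F (closedBall 0 1) := by
  have h := hF.2
  rwa [closure_ball _ one_ne_zero] at h

lemma DiffContOnCl.continuous_cpt {F : ℂ → ℂ} (hF : DiffContOnCl ℂ F (ball 0 1)) :
    Continuous fun θ => F (cpt θ) :=
  (DiffContOnCl.continuousOn_closedBall hF).comp_continuous IncrementExtrapolation.continuous_cpt
    cpt_mem_closedBall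

lemma conj_cpt (θ : ℝ) : (starRingEnd ℂ) (cpt θ) = (cpt θ)⁻¹ := by
  rw [cpt, ← Complex.exp_conj, ← Complex.exp_neg]
  simp

/-- The cross term is the real part of an analytic function vanishing at 0, so its mean is 0. -/
lemma integral_norm_sq_add_mul {F : ℂ → ℂ} (hF : DiffContOnCl ℂ F (ball 0 1)) (c : ℂ) :
    ∫ θ in (-Real.pi)..Real.pi, ‖c + cpt θ * F (cpt θ)‖ ^ 2 =
      2 * Real.pi * ‖c‖ ^ 2 + ∫ θ in (-Real.pi)..Real.pi, ‖F (cpt θ)‖ ^ 2 := by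
  have hFc := DiffContOnCl.continuous_cpt hF
  have hc : Continuous fun θ => (starRingEnd ℂ) c * (cpt θ * F (cpt θ)) :=
    continuous_const.mul (continuous_cpt.mul hFc)
  have hG : DiffContOnCl ℂ (fun z => (starRingEnd ℂ) c * (z * F z)) (ball 0 1) :=
    ((Differentiable.diffContOnCl differentiable_id).smul hF).const_smul ((starRingEnd ℂ) c)
  have h0 := integral_cpt_eq hG
  simp only [zero_mul, mul_zero] at h0
  have h0r : ∫ θ in (-Real.pi)..Real.pi, ((starRingEnd ℂ) c * (cpt θ * F (cpt θ))).re = 0 := by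
    have hi : IntervalIntegrable (fun θ => (starRingEnd ℂ) c * (cpt θ * F (cpt θ))) volume
        (-Real.pi) Real.pi := hc.intervalIntegrable _ _
    have h1 := Complex.reCLM.intervalIntegral_comp_comm hi
    simp only [Complex.reCLM_apply] at h1
    rw [h1, h0]; simp
  have hpt : ∀ θ : ℝ, ‖c + cpt θ * F (cpt θ)‖ ^ 2 =
      ‖c‖ ^ 2 + ‖F (cpt θ)‖ ^ 2 + 2 * ((starRingEnd ℂ) c * (cpt θ * F (cpt θ))).re := by
    intro θ
    rw [← Complex.normSq_eq_norm_sq, Complex.normSq_add, Complex.normSq_eq_norm_sq,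
      Complex.normSq_eq_norm_sq, norm_mul, norm_cpt, one_mul]
    congr 2
    rw [← Complex.conj_re]
    congr 1
    simp [mul_comm]
  simp only [hpt]
  rw [intervalIntegral.integral_add, intervalIntegral.integral_add,
    intervalIntegral.integral_const_mul, h0r, intervalIntegral.integral_const]
  · rw [smul_eq_mul]; ring
  · exact continuous_const.intervalIntegrable _ _
  · exact (hFc.norm.pow 2).intervalIntegrable _ _
  · exact (continuous_const.add (hFc.norm.pow 2)).intervalIntegrable _ _
  · exact (continuous_const.mul (Complex.continuous_re.comp hc)).intervalIntegrable _ _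

lemma integral_norm_sq_sum_add (m : ℕ) (c : ℕ → ℂ) {F : ℂ → ℂ}
    (hF : DiffContOnCl ℂ F (ball 0 1)) :
    ∫ θ in (-Real.pi)..Real.pi,
        ‖∑ k ∈ Finset.range m, c k * cpt θ ^ k + cpt θ ^ m * F (cpt θ)‖ ^ 2 =
      2 * Real.pi * ∑ k ∈ Finset.range m, ‖c k‖ ^ 2 +
        ∫ θ in (-Real.pi)..Real.pi, ‖F (cpt θ)‖ ^ 2 := by
  induction m generalizing F with
  | zero => simp
  | succ m ih =>
    have hF' : DiffContOnCl ℂ (fun z => c m + z * F z) (ball 0 1) :=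
      ((Differentiable.diffContOnCl differentiable_id).smul hF).const_add (c m)
    have h := ih hF'
    rw [integral_norm_sq_add_mul hF] at h
    rw [Finset.sum_range_succ, mul_add, add_assoc, ← h]
    refine intervalIntegral.integral_congr fun θ _ => ?_
    simp only [Finset.sum_range_succ]
    congr 2
    ring

/-- Multiplication by z^N preserves the modulus on the circle and reverses the order of the
coefficients, which reduces this to the analytic case. -/
lemma integral_norm_sq_antianalytic_add (N : ℕ) (c : ℕ → ℂ) {F : ℂ → ℂ}
    (hF : DiffContOnCl ℂ F (ball 0 1)) :
    ∫ θ in (-Real.pi)..Real.pi,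
        ‖∑ k ∈ Finset.range (N + 1), c k * (cpt θ)⁻¹ ^ k + cpt θ * F (cpt θ)‖ ^ 2 =
      2 * Real.pi * ∑ k ∈ Finset.range (N + 1), ‖c k‖ ^ 2 +
        ∫ θ in (-Real.pi)..Real.pi, ‖F (cpt θ)‖ ^ 2 := by
  have h := integral_norm_sq_sum_add (N + 1) (fun k => c (N - k)) hF
  rw [← Finset.sum_range_reflect (fun k => ‖c k‖ ^ 2)]
  simp only [add_tsub_cancel_right]
  rw [← h]
  refine intervalIntegral.integral_congr fun θ _ => ?_
  have h0 := cpt_ne_zero θ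
  have key : ∑ k ∈ Finset.range (N + 1), c (N - k) * cpt θ ^ k + cpt θ ^ (N + 1) * F (cpt θ) =
      cpt θ ^ N * (∑ k ∈ Finset.range (N + 1), c k * (cpt θ)⁻¹ ^ k + cpt θ * F (cpt θ)) := by
    rw [mul_add, ← Finset.sum_range_reflect (fun k => c k * (cpt θ)⁻¹ ^ k), Finset.mul_sum]
    congr 1
    · refine Finset.sum_congr rfl fun k hk => ?_
      have hk' : k ≤ N := by simpa [Nat.lt_succ_iff] using hk
      simp only [add_tsub_cancel_right]
      have : cpt θ ^ N = cpt θ ^ k * cpt θ ^ (N - k) := by rw [← pow_add]; congr 1; omega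
      rw [this, inv_pow]
      have : cpt θ ^ (N - k) ≠ 0 := pow_ne_zero _ h0
      field_simp
    · ring
  simp only [key, norm_mul, norm_pow, norm_cpt, one_pow, one_mul]

/-! ## The matrices as truncated convolutions -/

/-- `∑ φ(k) z^k`. -/
noncomputable def phiFun {N : ℕ} (φ : Fin (N + 1) → ℂ) (z : ℂ) : ℂ := ∑ k, φ k * z ^ k.val

/-- `∑ b(k) z^{-k}`. -/
noncomputable def bFun (n μ N : ℕ) (a : ℕ → ℂ) (z : ℂ) : ℂ :=
  ∑ k ∈ Finset.range (N + 1), bCoef n μ N a k * z⁻¹ ^ k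

/-- `∑ (D A W φ)(k) z^{-k}`. -/
noncomputable def rFun (n μ : ℕ) {N : ℕ} (a : ℕ → ℂ) (φ : Fin (N + 1) → ℂ) (z : ℂ) : ℂ :=
  ∑ k, rVec n μ a φ k * z⁻¹ ^ k.val

lemma exp_neg_mul_nat (θ : ℝ) (k : ℕ) : Complex.exp (-(Complex.I * θ * k)) = cpt θ ^ k := by
  rw [cpt, ← Complex.exp_nat_mul]; congr 1; ring

lemma exp_mul_nat (θ : ℝ) (k : ℕ) : Complex.exp (Complex.I * θ * k) = (cpt θ)⁻¹ ^ k := by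
  rw [cpt, ← Complex.exp_neg, ← Complex.exp_nat_mul]; congr 1; ring

lemma maDensity_eq {N : ℕ} (φ : Fin (N + 1) → ℂ) (θ : ℝ) :
    maDensity φ θ = ‖phiFun φ (cpt θ)‖ ^ 2 := by
  simp only [maDensity, phiFun, exp_neg_mul_nat]

lemma rDensity_eq (n μ : ℕ) {N : ℕ} (a : ℕ → ℂ) (c : ℂ) (φ : Fin (N + 1) → ℂ) (θ : ℝ) :
    rDensity n μ a c φ θ = ‖c‖ ^ 2 * ‖rFun n μ a φ (cpt θ)‖ ^ 2 := by
  simp only [rDensity, rFun, exp_mul_nat, norm_mul, mul_pow]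

lemma bCoef_eq_zero {n μ N : ℕ} {a : ℕ → ℂ} {k : ℕ} (hk : N < k) : bCoef n μ N a k = 0 := by
  rw [bCoef, Finset.Icc_eq_empty (by omega), Finset.sum_empty]

/-- The substitution m = j + l in the matrix product shows that DA is the Hankel matrix with entries
b(k + l). -/
lemma rVec_apply (n μ : ℕ) {N : ℕ} (a : ℕ → ℂ) (φ : Fin (N + 1) → ℂ) (k : Fin (N + 1)) :
    rVec n μ a φ k = ∑ l : Fin (N + 1), bCoef n μ N a (k + l) * phiMu n μ φ l := by
  simp only [rVec, Matrix.mulVec_mulVec]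
  rw [Matrix.mulVec, dotProduct]
  refine Finset.sum_congr rfl fun l _ => ?_
  congr 1
  rw [Matrix.mul_apply]
  simp only [matD, matA, Matrix.of_apply, bCoef]
  have h1 : ∀ j : Fin (N + 1), (if k ≤ j then dCoef n μ (j.val - k.val) else 0) *
      (if j.val + l.val ≤ N then a (j.val + l.val) else 0) =
      (fun j : ℕ => if k.val ≤ j ∧ j + l.val ≤ N then a (j + l.val) * dCoef n μ (j - k.val) else 0)
        j.val := by
    intro j
    by_cases h : k ≤ j
    · by_cases h' : j.val + l.val ≤ N
      · have : k.val ≤ j.val := h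
        simp [h, h', mul_comm]
      · simp [h']
    · have : ¬ k.val ≤ j.val := h
      simp [h]
  rw [Finset.sum_congr rfl fun j _ => h1 j, ← Finset.sum_range (fun j : ℕ =>
    if k.val ≤ j ∧ j + l.val ≤ N then a (j + l.val) * dCoef n μ (j - k.val) else 0),
    ← Finset.sum_filter]
  refine Finset.sum_bij' (fun j _ => j + l.val) (fun m _ => m - l.val) ?_ ?_ ?_ ?_ ?_
  · intro j hj; simp at hj ⊢; omega
  · intro m hm; simp at hm ⊢; omega
  · intro j hj; simp
  · intro m hm; simp at hm; omega
  · intro j hj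
    congr 2
    omega

lemma phiMu_apply (n μ : ℕ) {N : ℕ} (φ : Fin (N + 1) → ℂ) (l : Fin (N + 1)) :
    phiMu n μ φ l = ∑ k : Fin (N + 1), (if k ≤ l then wCoef n μ (l.val - k.val) else 0) * φ k := by
  simp only [phiMu, Matrix.mulVec, dotProduct, matW, Matrix.of_apply]

/-- W is the lower triangular Toeplitz matrix of the Taylor coefficients of w, so Wφ lists the
coefficients of wΦ up to degree N. The term φ(i) z^i of Φ meets the Taylor tail of w of order N + 1
- i. -/
lemma exists_mul_phiFun_eq {n μ N : ℕ} {w : ℂ → ℂ} (hw : IsOuterWeight n μ w)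
    (φ : Fin (N + 1) → ℂ) :
    ∃ F, DiffContOnCl ℂ F (ball 0 1) ∧ ∀ z,
      w z * phiFun φ z = ∑ l : Fin (N + 1), phiMu n μ φ l * z ^ l.val + z ^ (N + 1) * F z := by
  refine ⟨fun z => ∑ i : Fin (N + 1), φ i * taylorTail w (N + 1 - i) z, ?_, fun z => ?_⟩
  · have hi := fun i : Fin (N + 1) =>
      ((diffContOnCl_taylorTail hw.diffContOnCl (N + 1 - i)).const_smul (φ i))
    exact ⟨DifferentiableOn.fun_sum fun i _ => (hi i).1, continuousOn_finsetSum _ fun i _ => (hi i).2⟩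
  · have hterm : ∀ i : Fin (N + 1), w z * (φ i * z ^ i.val) =
        ∑ l : Fin (N + 1), (if i ≤ l then wCoef n μ (l.val - i.val) else 0) * φ i * z ^ l.val +
          z ^ (N + 1) * (φ i * taylorTail w (N + 1 - i) z) := by
      intro i
      have hi : i.val ≤ N := Nat.lt_succ_iff.mp i.isLt
      have h1 := eq_sum_add_taylorTail w (N + 1 - i) z
      simp only [hw.taylorTail_zero] at h1
      have h2 : ∑ l : Fin (N + 1), (if i ≤ l then wCoef n μ (l.val - i.val) else 0) * φ i * z ^ l.val =
          φ i * z ^ i.val * ∑ j ∈ Finset.range (N + 1 - i), wCoef n μ j * z ^ j := by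
        have h3 : ∀ l : Fin (N + 1), (if i ≤ l then wCoef n μ (l.val - i.val) else 0) * φ i * z ^ l.val =
          (fun l : ℕ => if i.val ≤ l then wCoef n μ (l - i.val) * φ i * z ^ l else 0) l.val := by
          intro l
          by_cases h : i ≤ l
          · have : i.val ≤ l.val := h
            simp [h]
          · have : ¬ i.val ≤ l.val := h
            simp [h]
        rw [Finset.sum_congr rfl fun l _ => h3 l, ← Finset.sum_range (fun l : ℕ =>
          if i.val ≤ l then wCoef n μ (l - i.val) * φ i * z ^ l else 0), ← Finset.sum_filter,
          Finset.mul_sum]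
        refine Finset.sum_bij' (fun l _ => l - i.val) (fun j _ => j + i.val) ?_ ?_ ?_ ?_ ?_
        · intro l hl; simp at hl ⊢; omega
        · intro j hj; simp at hj ⊢; omega
        · intro l hl; simp at hl; omega
        · intro j hj; simp
        · intro l hl
          simp at hl
          have : z ^ l = z ^ i.val * z ^ (l - i.val) := by rw [← pow_add]; congr 1; omega
          rw [this]; ring
      rw [h2]
      have h4 : z ^ (N + 1) = z ^ i.val * z ^ (N + 1 - i.val) := by rw [← pow_add]; congr 1; omega
      rw [h4]
      conv_lhs => rw [h1]
      ring
    rw [phiFun, Finset.mul_sum, Finset.sum_congr rfl fun i _ => hterm i, Finset.sum_add_distrib,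
      ← Finset.mul_sum, Finset.sum_comm]
    congr 1
    refine Finset.sum_congr rfl fun l _ => ?_
    rw [phiMu_apply, Finset.sum_mul]

/-- `B(1/z) w(z) Φ(z)` is the sum of its antianalytic part `∑ (D A W φ)(k) z^{-k}` and of an
analytic function vanishing at `0`. -/
lemma exists_bFun_mul_eq {n μ N : ℕ} {w : ℂ → ℂ} (hw : IsOuterWeight n μ w) (a : ℕ → ℂ)
    (φ : Fin (N + 1) → ℂ) :
    ∃ F, DiffContOnCl ℂ F (ball 0 1) ∧ ∀ z, z ≠ 0 →
      bFun n μ N a z * (w z * phiFun φ z) = rFun n μ a φ z + z * F z := by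
  obtain ⟨F, hF, hFz⟩ := exists_mul_phiFun_eq hw φ
  set x := phiMu n μ φ with hx
  -- Both summands are divided by z. The first is B times the tail z^{N+1} F, analytic because B has
  -- degree at most N in 1/z; the second collects the powers z^{l-k} with k < l, which are the
  -- positive ones.
  refine ⟨fun z => (∑ k ∈ Finset.range (N + 1), bCoef n μ N a k * z ^ (N - k)) * F z +
    ∑ l : Fin (N + 1), ∑ k ∈ Finset.range l.val, bCoef n μ N a k * x l * z ^ (l.val - k - 1), ?_,
    fun z hz => ?_⟩
  · have h1 : DiffContOnCl ℂ (fun z : ℂ => ∑ k ∈ Finset.range (N + 1),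
        bCoef n μ N a k * z ^ (N - k)) (ball 0 1) := Differentiable.diffContOnCl (by fun_prop)
    have h2 : DiffContOnCl ℂ (fun z : ℂ => ∑ l : Fin (N + 1), ∑ k ∈ Finset.range l.val,
        bCoef n μ N a k * x l * z ^ (l.val - k - 1)) (ball 0 1) :=
      Differentiable.diffContOnCl (by fun_prop)
    exact (h1.smul hF).add h2
  · have hA : bFun n μ N a z * (z ^ (N + 1) * F z) =
        z * ((∑ k ∈ Finset.range (N + 1), bCoef n μ N a k * z ^ (N - k)) * F z) := by
      rw [bFun, ← mul_assoc, ← mul_assoc]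
      congr 1
      rw [Finset.sum_mul, Finset.mul_sum]
      refine Finset.sum_congr rfl fun k hk => ?_
      have hk' : k ≤ N := by simpa [Nat.lt_succ_iff] using hk
      have : z ^ (N + 1) = z ^ k * z ^ (N - k) * z := by
        rw [← pow_add, ← pow_succ]; congr 1; omega
      rw [this, inv_pow]
      have := pow_ne_zero k hz
      field_simp
    have hB : ∀ l : Fin (N + 1), bFun n μ N a z * (x l * z ^ l.val) =
        ∑ k : Fin (N + 1), bCoef n μ N a (k + l) * x l * z⁻¹ ^ k.val +
        z * ∑ k ∈ Finset.range l.val, bCoef n μ N a k * x l * z ^ (l.val - k - 1) := by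
      intro l
      have hl : l.val ≤ N := Nat.lt_succ_iff.mp l.isLt
      rw [bFun, Finset.sum_mul, Finset.range_eq_Ico,
        ← Finset.sum_Ico_consecutive _ (Nat.zero_le l.val) (show l.val ≤ N + 1 by omega), add_comm]
      congr 1
      · rw [Finset.sum_Ico_eq_sum_range]
        have h3 := Finset.sum_range (n := N + 1)
          (fun k => bCoef n μ N a (k + l) * x l * z⁻¹ ^ k)
        rw [← h3, ← Finset.sum_subset (s₁ := Finset.range (N + 1 - l.val))
          (s₂ := Finset.range (N + 1))]
        · refine Finset.sum_congr rfl fun k _ => ?_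
          rw [add_comm l.val k, inv_pow, inv_pow, pow_add]
          have := pow_ne_zero k hz
          have := pow_ne_zero l.val hz
          field_simp
        · intro k hk; simp at hk ⊢; omega
        · intro k _ hk
          rw [bCoef_eq_zero (by simp at hk; omega)]; simp
      · rw [← Finset.range_eq_Ico, Finset.mul_sum]
        refine Finset.sum_congr rfl fun k hk => ?_
        have hk' : k < l.val := by simpa using hk
        have : z ^ l.val = z ^ k * z ^ (l.val - k - 1) * z := by
          rw [← pow_add, ← pow_succ]; congr 1; omega
        rw [this, inv_pow]
        have := pow_ne_zero k hz
        field_simp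
    rw [hFz z, mul_add, hA, Finset.mul_sum, Finset.sum_congr rfl fun l _ => hB l,
      Finset.sum_add_distrib, ← Finset.mul_sum, Finset.sum_comm]
    have hC : ∑ k : Fin (N + 1), ∑ l : Fin (N + 1), bCoef n μ N a (k + l) * x l * z⁻¹ ^ k.val =
        rFun n μ a φ z := by
      rw [rFun]
      refine Finset.sum_congr rfl fun k _ => ?_
      rw [rVec_apply, Finset.sum_mul]
    rw [hC]
    ring

lemma sqNorm_eq_sum_range {N : ℕ} (x : Fin (N + 1) → ℂ) :
    sqNorm x = ∑ k ∈ Finset.range (N + 1), ‖extendZero x k‖ ^ 2 := by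
  rw [sqNorm, Finset.sum_range]
  refine Finset.sum_congr rfl fun k _ => ?_
  simp [extendZero, k.isLt, -Order.lt_add_one_iff]

lemma sum_fin_eq_sum_range {N : ℕ} (x : Fin (N + 1) → ℂ) (z : ℂ) :
    ∑ k, x k * z ^ k.val = ∑ k ∈ Finset.range (N + 1), extendZero x k * z ^ k := by
  rw [Finset.sum_range]
  refine Finset.sum_congr rfl fun k _ => ?_
  simp [extendZero, k.isLt, -Order.lt_add_one_iff]

lemma integral_norm_rFun_add {n μ N : ℕ} (a : ℕ → ℂ) (φ : Fin (N + 1) → ℂ) {F : ℂ → ℂ}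
    (hF : DiffContOnCl ℂ F (ball 0 1)) :
    ∫ θ in (-Real.pi)..Real.pi, ‖rFun n μ a φ (cpt θ) + cpt θ * F (cpt θ)‖ ^ 2 =
      2 * Real.pi * sqNorm (rVec n μ a φ) + ∫ θ in (-Real.pi)..Real.pi, ‖F (cpt θ)‖ ^ 2 := by
  rw [sqNorm_eq_sum_range, ← integral_norm_sq_antianalytic_add N _ hF]
  simp only [rFun, sum_fin_eq_sum_range]

lemma integral_norm_rFun {n μ N : ℕ} (a : ℕ → ℂ) (φ : Fin (N + 1) → ℂ) :
    ∫ θ in (-Real.pi)..Real.pi, ‖rFun n μ a φ (cpt θ)‖ ^ 2 =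
      2 * Real.pi * sqNorm (rVec n μ a φ) := by
  have := integral_norm_rFun_add (n := n) (μ := μ) a φ (F := fun _ => 0) diffContOnCl_const
  simpa using this

lemma integral_norm_phiFun {N : ℕ} (φ : Fin (N + 1) → ℂ) :
    ∫ θ in (-Real.pi)..Real.pi, ‖phiFun φ (cpt θ)‖ ^ 2 = 2 * Real.pi * sqNorm φ := by
  have := integral_norm_sq_sum_add (N + 1) (extendZero φ) (F := fun _ => 0) diffContOnCl_const
  rw [sqNorm_eq_sum_range]
  simp only [phiFun, sum_fin_eq_sum_range]
  simpa using this

lemma integral_maDensity {N : ℕ} (φ : Fin (N + 1) → ℂ) :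
    ∫ θ in (-Real.pi)..Real.pi, maDensity φ θ = 2 * Real.pi * sqNorm φ := by
  simp only [maDensity_eq, integral_norm_phiFun]

lemma differentiable_phiFun {N : ℕ} (φ : Fin (N + 1) → ℂ) : Differentiable ℂ (phiFun φ) := by
  unfold phiFun; fun_prop

lemma continuous_rFun_cpt {n μ N : ℕ} (a : ℕ → ℂ) (φ : Fin (N + 1) → ℂ) :
    Continuous fun θ => rFun n μ a φ (cpt θ) := by
  simp only [rFun, ← conj_cpt]
  have := Complex.continuous_conj
  fun_prop

lemma continuous_bFun_cpt {n μ N : ℕ} (a : ℕ → ℂ) :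
    Continuous fun θ => bFun n μ N a (cpt θ) := by
  simp only [bFun, ← conj_cpt]
  have := Complex.continuous_conj
  fun_prop

/-! ## Least squares over a closed linear span -/

section LeastSquares

variable {X : Type*} [MeasurableSpace X] {ν : Measure X}

lemma integral_norm_sq_eq_norm_toLp_sq {u : X → ℂ} (hu : MemLp u 2 ν) :
    ∫ x, ‖u x‖ ^ 2 ∂ν = ‖hu.toLp u‖ ^ 2 := by
  have h := L2.inner_def (𝕜 := ℂ) (hu.toLp u) (hu.toLp u)
  rw [inner_self_eq_norm_sq_to_K] at h
  have h2 : ∫ x, inner ℂ ((hu.toLp u : X → ℂ) x) ((hu.toLp u : X → ℂ) x) ∂ν =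
      ((∫ x, ‖u x‖ ^ 2 ∂ν : ℝ) : ℂ) := by
    rw [← integral_complex_ofReal]
    refine integral_congr_ae ?_
    filter_upwards [hu.coeFn_toLp] with x hx
    rw [hx, inner_self_eq_norm_sq_to_K]
    norm_cast
  rw [h2] at h
  apply Complex.ofReal_injective
  rw [← h]
  push_cast
  rfl

lemma memLp_combination {e : ℕ → X → ℂ} (he : ∀ j, MemLp (e j) 2 ν) (c : ℕ →₀ ℂ) :
    MemLp (fun x => ∑ j ∈ c.support, c j * e j x) 2 ν :=
  memLp_finsetSum _ fun j _ => (he j).const_mul (c j)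

lemma toLp_combination {e : ℕ → X → ℂ} (he : ∀ j, MemLp (e j) 2 ν) (c : ℕ →₀ ℂ) :
    (memLp_combination he c).toLp _ =
      Finsupp.linearCombination ℂ (fun j => (he j).toLp (e j)) c := by
  rw [Finsupp.linearCombination_apply, Finsupp.sum]
  have : ∀ s : Finset ℕ, (memLp_finsetSum s fun j _ => (he j).const_mul (c j)).toLp
      (fun x => ∑ j ∈ s, c j * e j x) = ∑ j ∈ s, c j • (he j).toLp (e j) := by
    intro s
    apply Lp.ext
    refine (MemLp.coeFn_toLp _).trans ?_
    refine EventuallyEq.trans ?_ (Lp.coeFn_finsetSum _ _).symm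
    have h1 : ∀ᵐ x ∂ν, ∀ j ∈ s, (c j • (he j).toLp (e j) : Lp ℂ 2 ν) x = c j * e j x := by
      refine (Finset.eventually_all s).mpr fun j _ => ?_
      filter_upwards [Lp.coeFn_smul (c j) ((he j).toLp (e j)), (he j).coeFn_toLp] with x h1 h2
      rw [h1, Pi.smul_apply, h2, smul_eq_mul]
    filter_upwards [h1] with x hx
    rw [Finset.sum_apply]
    exact (Finset.sum_congr rfl fun j hj => hx j hj).symm
  exact this c.support

lemma inClosedSpan_iff {e : ℕ → X → ℂ} (he : ∀ j, MemLp (e j) 2 ν) {L : X → ℂ}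
    (hL : MemLp L 2 ν) : InClosedSpan ν e L ↔
      hL.toLp L ∈ (Submodule.span ℂ
        (Set.range fun j => (he j).toLp (e j))).topologicalClosure := by
  rw [← SetLike.mem_coe, Submodule.topologicalClosure_coe, EMetric.mem_closure_iff]
  have hdist : ∀ c : ℕ →₀ ℂ, edist (hL.toLp L)
      (Finsupp.linearCombination ℂ (fun j => (he j).toLp (e j)) c) =
        eLpNorm (fun x => L x - ∑ j ∈ c.support, c j * e j x) 2 ν := by
    intro c
    rw [← toLp_combination he c, Lp.edist_toLp_toLp]
    rfl
  constructor
  · rintro ⟨-, h⟩ δ hδ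
    obtain ⟨c, hc⟩ := h δ hδ
    refine ⟨Finsupp.linearCombination ℂ (fun j => (he j).toLp (e j)) c, ?_, by rwa [hdist]⟩
    exact Finsupp.mem_span_range_iff_exists_finsupp.mpr ⟨c, rfl⟩
  · intro h
    refine ⟨hL, fun δ hδ => ?_⟩
    obtain ⟨b, hb, hbδ⟩ := h δ hδ
    obtain ⟨c, rfl⟩ := Finsupp.mem_span_range_iff_exists_finsupp.mp hb
    exact ⟨c, by rw [← hdist]; exact hbδ⟩

/-- The minimum is attained at the orthogonal projection onto the closed span, and by density it is
the infimum over finite combinations. In this form the value can be carried from random variables to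
the spectral domain by comparing finite sums only. -/
lemma isLeast_integral_norm_sub_sq {e : ℕ → X → ℂ} (he : ∀ j, MemLp (e j) 2 ν) {g : X → ℂ}
    (hg : MemLp g 2 ν) :
    IsLeast {r : ℝ | ∃ L : X → ℂ, InClosedSpan ν e L ∧ r = ∫ x, ‖g x - L x‖ ^ 2 ∂ν}
      (⨅ c : ℕ →₀ ℂ, ∫ x, ‖g x - ∑ j ∈ c.support, c j * e j x‖ ^ 2 ∂ν) := by
  set S := Submodule.span ℂ (Set.range fun j => (he j).toLp (e j)) with hS
  have hval : ∀ {L : X → ℂ} (hL : MemLp L 2 ν),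
      ∫ x, ‖g x - L x‖ ^ 2 ∂ν = ‖hg.toLp g - hL.toLp L‖ ^ 2 := by
    intro L hL
    rw [← MemLp.toLp_sub]
    exact integral_norm_sq_eq_norm_toLp_sq (hg.sub hL)
  have hcomb : ∀ c : ℕ →₀ ℂ, ∫ x, ‖g x - ∑ j ∈ c.support, c j * e j x‖ ^ 2 ∂ν =
      ‖hg.toLp g - Finsupp.linearCombination ℂ (fun j => (he j).toLp (e j)) c‖ ^ 2 := by
    intro c
    rw [← toLp_combination he c]
    exact hval (memLp_combination he c)
  simp only [hcomb]
  set I := ⨅ c : ℕ →₀ ℂ,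
    ‖hg.toLp g - Finsupp.linearCombination ℂ (fun j => (he j).toLp (e j)) c‖ ^ 2 with hI
  have hbdd : BddBelow (Set.range fun c : ℕ →₀ ℂ =>
    ‖hg.toLp g - Finsupp.linearCombination ℂ (fun j => (he j).toLp (e j)) c‖ ^ 2) :=
    ⟨0, by rintro _ ⟨c, rfl⟩; positivity⟩
  have hclosed : ∀ v ∈ S.topologicalClosure, I ≤ ‖hg.toLp g - v‖ ^ 2 := by
    have hc : IsClosed {v : Lp ℂ 2 ν | I ≤ ‖hg.toLp g - v‖ ^ 2} :=
      isClosed_le continuous_const (by fun_prop)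
    intro v hv
    rw [← SetLike.mem_coe, Submodule.topologicalClosure_coe] at hv
    refine closure_minimal (fun w hw => ?_) hc hv
    obtain ⟨c, rfl⟩ := Finsupp.mem_span_range_iff_exists_finsupp.mp hw
    exact ciInf_le hbdd c
  have hcomplete : IsComplete (S.topologicalClosure : Set (Lp ℂ 2 ν)) :=
    S.isClosed_topologicalClosure.isComplete
  obtain ⟨v, hv, hvmin⟩ := S.topologicalClosure.exists_norm_eq_iInf_of_complete_subspace
    hcomplete (hg.toLp g)
  have hvI : ‖hg.toLp g - v‖ ^ 2 = I := by
    refine le_antisymm (le_ciInf fun c => ?_) (hclosed v hv)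
    have hm : Finsupp.linearCombination ℂ (fun j => (he j).toLp (e j)) c ∈
        S.topologicalClosure :=
      S.le_topologicalClosure (Finsupp.mem_span_range_iff_exists_finsupp.mpr ⟨c, rfl⟩)
    rw [hvmin]
    refine pow_le_pow_left₀ (Real.iInf_nonneg fun _ => norm_nonneg _) ?_ 2
    exact ciInf_le (f := fun w : S.topologicalClosure => ‖hg.toLp g - w‖)
      ⟨0, by rintro _ ⟨c, rfl⟩; positivity⟩ ⟨_, hm⟩
  refine ⟨⟨(v : X → ℂ), ?_, ?_⟩, ?_⟩
  · rw [inClosedSpan_iff he (Lp.memLp v), Lp.toLp_coeFn]; exact hv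
  · rw [hval (Lp.memLp v), Lp.toLp_coeFn, hvI]
  · rintro r ⟨L, hL, rfl⟩
    rw [hval hL.1]
    exact hclosed _ ((inClosedSpan_iff he hL.1).mp hL)

end LeastSquares

/-! ## The functional in terms of the increments -/

/-- Compare coefficients in (1 - X^μ)^n E^n = 1 with E = ∑ X^{μj}. -/
lemma sum_choose_mul_dCoef (n : ℕ) {μ : ℕ} (hμ : 1 ≤ μ) (t : ℕ) :
    ∑ l ∈ Finset.range (n + 1), (-1 : ℂ) ^ l * (n.choose l : ℂ) *
      (if l * μ ≤ t then dCoef n μ (t - l * μ) else 0) = if t = 0 then 1 else 0 := by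
  set E : PowerSeries ℂ := PowerSeries.mk fun j : ℕ => if μ ∣ j then (1 : ℂ) else 0 with hE
  have h1 : (1 - PowerSeries.X ^ μ) * E = 1 := by
    ext t
    rw [sub_mul, one_mul, map_sub, PowerSeries.coeff_X_pow_mul', hE, PowerSeries.coeff_mk,
      PowerSeries.coeff_one]
    by_cases ht : μ ≤ t
    · have : t ≠ 0 := by omega
      rw [if_pos ht, PowerSeries.coeff_mk, if_neg this]
      have : μ ∣ t - μ ↔ μ ∣ t := (Nat.dvd_sub_iff_left ht dvd_rfl)
      simp [this]
    · rw [if_neg ht]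
      by_cases h0 : t = 0
      · simp [h0]
      · have : ¬ μ ∣ t := fun h => ht (Nat.le_of_dvd (Nat.pos_of_ne_zero h0) h)
        simp [h0, this]
  have h2 : (1 - PowerSeries.X ^ μ) ^ n * E ^ n = 1 := by rw [← mul_pow, h1, one_pow]
  have h3 : (1 - PowerSeries.X ^ μ : PowerSeries ℂ) ^ n =
      ∑ l ∈ Finset.range (n + 1), PowerSeries.C ((-1 : ℂ) ^ l * (n.choose l : ℂ)) *
        PowerSeries.X ^ (l * μ) := by
    rw [sub_eq_add_neg, add_comm, add_pow]
    refine Finset.sum_congr rfl fun l _ => ?_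
    rw [neg_pow, one_pow, mul_one, ← pow_mul, mul_comm μ l]
    simp only [map_mul, map_pow, map_neg, map_one, map_natCast]
    ring
  have h4 := congrArg (PowerSeries.coeff t) h2
  rw [h3, Finset.sum_mul, map_sum, PowerSeries.coeff_one] at h4
  rw [← h4]
  refine Finset.sum_congr rfl fun l _ => ?_
  rw [mul_assoc (PowerSeries.C _), PowerSeries.coeff_C_mul, PowerSeries.coeff_X_pow_mul']
  rfl

/-- The n-th difference with step μ inverts the passage from a to b: after exchanging sums only the
index j = m survives. -/
lemma sum_choose_mul_bCoef (n : ℕ) {μ : ℕ} (hμ : 1 ≤ μ) (N : ℕ) (a : ℕ → ℂ) {m : ℕ}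
    (hm : m ≤ N) :
    ∑ l ∈ Finset.range (n + 1), (-1 : ℂ) ^ l * (n.choose l : ℂ) * bCoef n μ N a (m + l * μ) =
      a m := by
  have h1 : ∀ l, bCoef n μ N a (m + l * μ) = ∑ j ∈ Finset.Icc m N, a j *
      (if l * μ ≤ j - m then dCoef n μ (j - m - l * μ) else 0) := by
    intro l
    rw [bCoef, ← Finset.sum_subset (s₁ := Finset.Icc (m + l * μ) N) (s₂ := Finset.Icc m N)]
    · refine Finset.sum_congr rfl fun j hj => ?_
      rw [Finset.mem_Icc] at hj
      rw [if_pos (by omega), Nat.sub_sub]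
    · exact Finset.Icc_subset_Icc_left (Nat.le_add_right _ _)
    · intro j hj hj'
      rw [Finset.mem_Icc] at hj hj'
      rw [if_neg (by omega), mul_zero]
  simp only [h1, Finset.mul_sum]
  rw [Finset.sum_comm]
  have h2 : ∀ j ∈ Finset.Icc m N, ∑ l ∈ Finset.range (n + 1), (-1 : ℂ) ^ l * (n.choose l : ℂ) *
      (a j * (if l * μ ≤ j - m then dCoef n μ (j - m - l * μ) else 0)) =
      if j = m then a j else 0 := by
    intro j hj
    rw [Finset.mem_Icc] at hj
    have h3 := sum_choose_mul_dCoef n hμ (j - m)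
    have h4 : (if j = m then a j else 0) = a j * (if j - m = 0 then 1 else 0) := by
      by_cases h : j = m
      · simp [h]
      · have : j - m ≠ 0 := by omega
        simp [h, this]
    rw [h4, ← h3, Finset.mul_sum]
    refine Finset.sum_congr rfl fun l _ => ?_
    ring
  rw [Finset.sum_congr rfl h2, Finset.sum_ite_eq', if_pos (Finset.mem_Icc.mpr ⟨le_rfl, hm⟩)]

/-- When the increments are expanded, ξ(m) with m ≥ 0 receives a(m) by the inversion formula, and
ξ(-j) receives the coefficient that defines the observed correction. The unobserved part is thereby
expressed through increments alone. -/
lemma functionalA_add_functionalV {Ω : Type*} (n : ℕ) {μ : ℕ} (hμ : 1 ≤ μ) (N : ℕ) (a : ℕ → ℂ)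
    (ξ : ℤ → Ω → ℂ) (x : Ω) :
    functionalA N a ξ x + functionalV n μ N a ξ x =
      ∑ k ∈ Finset.range (N + 1), bCoef n μ N a k * increment n ξ k μ x := by
  have hsplit : ∀ l ∈ Finset.range (n + 1),
      ∑ k ∈ Finset.range (N + 1), bCoef n μ N a k * ξ ((k : ℤ) - (l : ℤ) * μ) x =
      ∑ m ∈ Finset.range (N + 1), bCoef n μ N a (m + l * μ) * ξ (m : ℤ) x +
      ∑ j ∈ Finset.Icc 1 (μ * n), if j ≤ l * μ ∧ l * μ - j ≤ N then
        bCoef n μ N a (l * μ - j) * ξ (-(j : ℤ)) x else 0 := by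
    intro l hl
    have hl' : l * μ ≤ μ * n := by
      rw [mul_comm]; exact Nat.mul_le_mul_left μ (by simpa [Nat.lt_succ_iff] using hl)
    rw [← Finset.sum_filter_add_sum_filter_not _ (fun k => l * μ ≤ k)]
    congr 1
    · rw [← Finset.sum_filter_add_sum_filter_not (Finset.range (N + 1)) (fun m => m + l * μ ≤ N)
        (fun m => bCoef n μ N a (m + l * μ) * ξ (m : ℤ) x)]
      have h0 : ∑ m ∈ Finset.range (N + 1) with ¬ (m + l * μ ≤ N),
          bCoef n μ N a (m + l * μ) * ξ (m : ℤ) x = 0 := by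
        refine Finset.sum_eq_zero fun m hm => ?_
        rw [bCoef_eq_zero (by simp at hm; omega), zero_mul]
      rw [h0, add_zero]
      refine Finset.sum_bij' (fun k _ => k - l * μ) (fun m _ => m + l * μ) ?_ ?_ ?_ ?_ ?_
      · intro k hk; simp at hk ⊢; omega
      · intro m hm; simp at hm ⊢; omega
      · intro k hk; simp at hk; omega
      · intro m hm; simp
      · intro k hk
        simp at hk
        have h1 : k - l * μ + l * μ = k := by omega
        have h2 : ((k - l * μ : ℕ) : ℤ) = (k : ℤ) - (l : ℤ) * μ := by
          push_cast [Nat.cast_sub hk.2]; ring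
        rw [h1, h2]
    · rw [← Finset.sum_filter]
      refine Finset.sum_bij' (fun k _ => l * μ - k) (fun j _ => l * μ - j) ?_ ?_ ?_ ?_ ?_
      · intro k hk
        simp only [Finset.mem_filter, Finset.mem_range, Finset.mem_Icc] at hk ⊢
        omega
      · intro j hj
        simp only [Finset.mem_filter, Finset.mem_range, Finset.mem_Icc] at hj ⊢
        omega
      · intro k hk
        simp only [Finset.mem_filter, Finset.mem_range] at hk
        omega
      · intro j hj
        simp only [Finset.mem_filter, Finset.mem_Icc] at hj
        omega
      · intro k hk
        simp at hk
        have h1 : l * μ - (l * μ - k) = k := by omega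
        have h2 : -((l * μ - k : ℕ) : ℤ) = (k : ℤ) - (l : ℤ) * μ := by
          rw [Nat.cast_sub hk.2.le]; push_cast; ring
        rw [h1, h2]
  simp only [increment, Finset.mul_sum]
  rw [Finset.sum_comm]
  have hterm : ∀ l ∈ Finset.range (n + 1),
      ∑ k ∈ Finset.range (N + 1), bCoef n μ N a k *
        ((-1 : ℂ) ^ l * (n.choose l : ℂ) * ξ ((k : ℤ) - (l : ℤ) * μ) x) =
      ∑ m ∈ Finset.range (N + 1), (-1 : ℂ) ^ l * (n.choose l : ℂ) *
        bCoef n μ N a (m + l * μ) * ξ (m : ℤ) x +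
      ∑ j ∈ Finset.Icc 1 (μ * n), if j ≤ l * μ ∧ l * μ - j ≤ N then
        (-1 : ℂ) ^ l * (n.choose l : ℂ) * bCoef n μ N a (l * μ - j) * ξ (-(j : ℤ)) x else 0 := by
    intro l hl
    calc _ = (-1 : ℂ) ^ l * (n.choose l : ℂ) *
        ∑ k ∈ Finset.range (N + 1), bCoef n μ N a k * ξ ((k : ℤ) - (l : ℤ) * μ) x := by
          rw [Finset.mul_sum]; exact Finset.sum_congr rfl fun k _ => by ring
      _ = _ := by
          rw [hsplit l hl, mul_add, Finset.mul_sum, Finset.mul_sum]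
          congr 1
          · exact Finset.sum_congr rfl fun k _ => by ring
          · refine Finset.sum_congr rfl fun k _ => ?_
            rw [mul_ite, mul_zero]
            simp only [mul_assoc]
  rw [Finset.sum_congr rfl hterm, Finset.sum_add_distrib]
  congr 1
  · rw [functionalA, Finset.sum_comm]
    refine Finset.sum_congr rfl fun m hm => ?_
    rw [← Finset.sum_mul, sum_choose_mul_bCoef n hμ N a (by simpa [Nat.lt_succ_iff] using hm)]
  · rw [functionalV, Finset.sum_comm]
    refine Finset.sum_congr rfl fun j _ => ?_
    rw [vCoef, ← Finset.sum_filter, Finset.sum_mul]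

/-! ## The spectral domain -/

lemma neg_pi_le_pi : -Real.pi ≤ Real.pi := by linarith [Real.pi_pos]

lemma ae_mem_uIoc {p : ℝ → Prop} (h : ∀ θ ∈ Set.Icc (-Real.pi) Real.pi, θ ≠ 0 → p θ) :
    ∀ᵐ θ : ℝ, θ ∈ Set.uIoc (-Real.pi) Real.pi → p θ := by
  have h2 : ∀ᵐ θ : ℝ, θ ≠ 0 := by simp [ae_iff]
  filter_upwards [h2] with θ h2 hθ
  rw [Set.uIoc_of_le neg_pi_le_pi] at hθ
  exact h θ (Set.Ioc_subset_Icc_self hθ) h2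

lemma densityMeasure_absolutelyContinuous (f : ℝ → ℝ) : densityMeasure f ≪ volume :=
  (withDensity_absolutelyContinuous _ _).trans Measure.restrict_le_self.absolutelyContinuous

lemma isFiniteMeasure_densityMeasure {f : ℝ → ℝ}
    (hfi : IntervalIntegrable f volume (-Real.pi) Real.pi) :
    IsFiniteMeasure (densityMeasure f) :=
  isFiniteMeasure_withDensity_ofReal hfi.1.2

lemma integral_densityMeasure {f : ℝ → ℝ} (hf0 : ∀ θ ∈ Set.Icc (-Real.pi) Real.pi, 0 ≤ f θ)
    (hfi : IntervalIntegrable f volume (-Real.pi) Real.pi) (u : ℝ → ℝ) :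
    ∫ θ, u θ ∂(densityMeasure f) = ∫ θ in (-Real.pi)..Real.pi, u θ * f θ := by
  rw [densityMeasure, integral_withDensity_eq_integral_toReal_smul₀
    hfi.1.aestronglyMeasurable.aemeasurable.ennreal_ofReal
    (Eventually.of_forall fun _ => ENNReal.ofReal_lt_top),
    intervalIntegral.integral_of_le neg_pi_le_pi]
  refine setIntegral_congr_fun measurableSet_Ioc fun θ hθ => ?_
  simp only [smul_eq_mul, ENNReal.toReal_ofReal (hf0 θ (Set.Ioc_subset_Icc_self hθ))]
  ring

lemma norm_kernel_sq (n μ : ℕ) (θ : ℝ) :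
    ‖1 - Complex.exp (-(Complex.I * μ * θ))‖ ^ (2 * n) / θ ^ (2 * n) = ‖kernel n μ θ‖ ^ 2 := by
  rw [kernel, norm_div, norm_pow, norm_pow, norm_mul, Complex.norm_I, one_mul, Complex.norm_real,
    Real.norm_eq_abs, div_pow, ← pow_mul, ← pow_mul, mul_comm n 2]
  congr 1
  rw [pow_mul, pow_mul, sq_abs]

lemma bFun_cpt (n μ N : ℕ) (a : ℕ → ℂ) (θ : ℝ) :
    ∑ k ∈ Finset.range (N + 1), bCoef n μ N a k * Complex.exp (Complex.I * θ * k) =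
      bFun n μ N a (cpt θ) := by
  simp only [bFun, exp_mul_nat]

/-- Only the modulus of the kernel enters the error, so it can be traded for the outer function,
which is analytic inside the disk. -/
lemma mse_eq_integral {n μ N : ℕ} {w : ℂ → ℂ} (hw : IsOuterWeight n μ w) (a : ℕ → ℂ)
    (h : ℝ → ℂ) (f : ℝ → ℝ) :
    mse n μ N a h f = 1 / (2 * Real.pi) * ∫ θ in (-Real.pi)..Real.pi,
      ‖bFun n μ N a (cpt θ) - h θ‖ ^ 2 * (‖w (cpt θ)‖ ^ 2 * f θ) := by
  rw [mse]
  congr 1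
  refine intervalIntegral.integral_congr_ae (ae_mem_uIoc fun θ hθ h0 => ?_)
  rw [norm_kernel_sq, bFun_cpt, hw.norm_eq θ hθ h0]
  ring

lemma mse_eq_integral_densityMeasure {n μ N : ℕ} (a : ℕ → ℂ) (h : ℝ → ℂ) {f : ℝ → ℝ}
    (hf0 : ∀ θ ∈ Set.Icc (-Real.pi) Real.pi, 0 ≤ f θ)
    (hfi : IntervalIntegrable f volume (-Real.pi) Real.pi) :
    mse n μ N a h f = 1 / (2 * Real.pi) *
      ∫ θ, ‖bFun n μ N a (cpt θ) * kernel n μ θ - h θ * kernel n μ θ‖ ^ 2 ∂(densityMeasure f) := by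
  rw [integral_densityMeasure hf0 hfi, mse]
  congr 1
  refine intervalIntegral.integral_congr fun θ _ => ?_
  simp only [norm_kernel_sq, bFun_cpt, ← sub_mul, norm_mul, mul_pow]

lemma measurable_kernel (n μ : ℕ) : Measurable (kernel n μ) := by
  unfold kernel; fun_prop

lemma exists_kernel_bound {n μ : ℕ} {w : ℂ → ℂ} (hw : IsOuterWeight n μ w) (f : ℝ → ℝ) :
    ∃ C, ∀ᵐ θ ∂(densityMeasure f), ‖kernel n μ θ‖ ≤ C := by
  obtain ⟨C, -, hC⟩ := DiffContOnCl.exists_bound hw.diffContOnCl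
  refine ⟨C, ?_⟩
  have h1 : ∀ᵐ θ ∂(densityMeasure f), θ ∈ Set.Ioc (-Real.pi) Real.pi :=
    (withDensity_absolutelyContinuous _ _).ae_le (ae_restrict_mem measurableSet_Ioc)
  have h2 : ∀ᵐ θ : ℝ, θ ≠ 0 := by simp [ae_iff]
  filter_upwards [h1, (densityMeasure_absolutelyContinuous f).ae_le h2] with θ h1 h2
  rw [← hw.norm_eq θ (Set.Ioc_subset_Icc_self h1) h2]
  exact hC _ (norm_cpt θ).le

lemma memLp_mul_kernel {n μ : ℕ} {w : ℂ → ℂ} (hw : IsOuterWeight n μ w) {f : ℝ → ℝ}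
    (hfi : IntervalIntegrable f volume (-Real.pi) Real.pi) {u : ℝ → ℂ} (hu : Continuous u)
    {C : ℝ} (hC : ∀ θ, ‖u θ‖ ≤ C) :
    MemLp (fun θ => u θ * kernel n μ θ) 2 (densityMeasure f) := by
  have := isFiniteMeasure_densityMeasure hfi
  obtain ⟨K, hK⟩ := exists_kernel_bound hw f
  refine MemLp.of_bound (C := C * K) ?_ ?_
  · exact (hu.measurable.mul (measurable_kernel n μ)).aestronglyMeasurable
  · filter_upwards [hK] with θ hθ
    rw [norm_mul]
    exact mul_le_mul (hC θ) hθ (norm_nonneg _) ((norm_nonneg _).trans (hC θ))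

/-- The trigonometric polynomial `∑ c_j e^{-iθ(j+1)}`. -/
noncomputable def pastPolynomial (c : ℕ →₀ ℂ) (θ : ℝ) : ℂ :=
  ∑ j ∈ c.support, c j * cpt θ ^ (j + 1)

lemma exp_eq_cpt_pow (θ : ℝ) (j : ℕ) :
    Complex.exp (-(Complex.I * θ * ((j : ℂ) + 1))) = cpt θ ^ (j + 1) := by
  have := exp_neg_mul_nat θ (j + 1)
  push_cast at this
  exact this

lemma memLp_exp_mul_kernel {n μ : ℕ} {w : ℂ → ℂ} (hw : IsOuterWeight n μ w) {f : ℝ → ℝ}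
    (hfi : IntervalIntegrable f volume (-Real.pi) Real.pi) (j : ℕ) :
    MemLp (fun θ : ℝ => Complex.exp (-(Complex.I * θ * ((j : ℂ) + 1))) * kernel n μ θ) 2
      (densityMeasure f) := by
  simp only [exp_eq_cpt_pow]
  exact memLp_mul_kernel hw hfi (C := 1) (by fun_prop) fun θ => by simp [norm_cpt]

lemma exists_norm_bFun_le (n μ N : ℕ) (a : ℕ → ℂ) :
    ∃ C, ∀ θ, ‖bFun n μ N a (cpt θ)‖ ≤ C := by
  refine ⟨∑ k ∈ Finset.range (N + 1), ‖bCoef n μ N a k‖, fun θ => ?_⟩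
  refine (norm_sum_le _ _).trans (Finset.sum_le_sum fun k _ => ?_)
  simp [norm_cpt]

lemma memLp_bFun_mul_kernel {n μ N : ℕ} {w : ℂ → ℂ} (hw : IsOuterWeight n μ w) (a : ℕ → ℂ)
    {f : ℝ → ℝ} (hfi : IntervalIntegrable f volume (-Real.pi) Real.pi) :
    MemLp (fun θ : ℝ => bFun n μ N a (cpt θ) * kernel n μ θ) 2 (densityMeasure f) := by
  obtain ⟨C, hC⟩ := exists_norm_bFun_le n μ N a
  exact memLp_mul_kernel hw hfi (continuous_bFun_cpt a) hC

lemma isSpectralCharacteristic_pastPolynomial {n μ : ℕ} {w : ℂ → ℂ} (hw : IsOuterWeight n μ w)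
    {f : ℝ → ℝ} (hfi : IntervalIntegrable f volume (-Real.pi) Real.pi) (c : ℕ →₀ ℂ) :
    IsSpectralCharacteristic n μ f (pastPolynomial c) := by
  have hm := memLp_combination (fun j => memLp_exp_mul_kernel hw hfi j) c
  have heq : (fun θ : ℝ => ∑ j ∈ c.support, c j *
      (Complex.exp (-(Complex.I * θ * ((j : ℂ) + 1))) * kernel n μ θ)) =
      fun θ => pastPolynomial c θ * kernel n μ θ := by
    funext θ
    rw [pastPolynomial, Finset.sum_mul]
    refine Finset.sum_congr rfl fun j _ => ?_
    rw [exp_eq_cpt_pow]; ring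
  rw [heq] at hm
  refine ⟨hm, fun δ hδ => ⟨c, ?_⟩⟩
  have h0 : (fun θ : ℝ => pastPolynomial c θ * kernel n μ θ - ∑ j ∈ c.support, c j *
      (Complex.exp (-(Complex.I * θ * ((j : ℂ) + 1))) * kernel n μ θ)) = fun _ => 0 := by
    funext θ
    rw [← congrFun heq θ, sub_self]
  rw [h0]
  simpa using hδ

lemma mse_nonneg {n μ N : ℕ} (a : ℕ → ℂ) (h : ℝ → ℂ) {f : ℝ → ℝ}
    (hf0 : ∀ θ ∈ Set.Icc (-Real.pi) Real.pi, 0 ≤ f θ)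
    (hfi : IntervalIntegrable f volume (-Real.pi) Real.pi) : 0 ≤ mse n μ N a h f := by
  rw [mse_eq_integral_densityMeasure a h hf0 hfi]
  have := Real.pi_pos
  exact mul_nonneg (by positivity) (integral_nonneg fun θ => by positivity)

lemma optimalError_le {n μ N : ℕ} {w : ℂ → ℂ} (hw : IsOuterWeight n μ w) (a : ℕ → ℂ)
    {f : ℝ → ℝ} (hf0 : ∀ θ ∈ Set.Icc (-Real.pi) Real.pi, 0 ≤ f θ)
    (hfi : IntervalIntegrable f volume (-Real.pi) Real.pi) (c : ℕ →₀ ℂ) :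
    optimalError n μ N a f ≤ mse n μ N a (pastPolynomial c) f :=
  ciInf_le (f := fun h : {h : ℝ → ℂ // IsSpectralCharacteristic n μ f h} => mse n μ N a h.1 f)
    ⟨0, by rintro _ ⟨h, rfl⟩; exact mse_nonneg a _ hf0 hfi⟩
    ⟨_, isSpectralCharacteristic_pastPolynomial hw hfi c⟩

/-- Every admissible h gives an element of the closed span, so its error is at least the infimum
over the polynomials in e^{-iθ} without constant term. -/
lemma optimalError_eq_iInf {n μ N : ℕ} {w : ℂ → ℂ} (hw : IsOuterWeight n μ w) (a : ℕ → ℂ)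
    {f : ℝ → ℝ} (hf0 : ∀ θ ∈ Set.Icc (-Real.pi) Real.pi, 0 ≤ f θ)
    (hfi : IntervalIntegrable f volume (-Real.pi) Real.pi) :
    optimalError n μ N a f = ⨅ c : ℕ →₀ ℂ, mse n μ N a (pastPolynomial c) f := by
  refine le_antisymm (le_ciInf fun c => optimalError_le hw a hf0 hfi c) ?_
  have hne : Nonempty {h : ℝ → ℂ // IsSpectralCharacteristic n μ f h} :=
    ⟨⟨_, isSpectralCharacteristic_pastPolynomial hw hfi 0⟩⟩
  refine le_ciInf fun h => ?_
  have hL := isLeast_integral_norm_sub_sq (fun j => memLp_exp_mul_kernel hw hfi j)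
    (memLp_bFun_mul_kernel (N := N) hw a hfi)
  have h1 := hL.2 ⟨_, h.2, rfl⟩
  have hpi : 0 ≤ 1 / (2 * Real.pi) := by have := Real.pi_pos; positivity
  rw [mse_eq_integral_densityMeasure a _ hf0 hfi]
  refine le_trans (le_of_eq ?_) (mul_le_mul_of_nonneg_left h1 hpi)
  rw [Real.mul_iInf_of_nonneg hpi]
  refine iInf_congr fun c => ?_
  rw [mse_eq_integral_densityMeasure a _ hf0 hfi]
  congr 2
  funext θ
  congr 3
  rw [pastPolynomial, Finset.sum_mul]
  refine Finset.sum_congr rfl fun j _ => ?_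
  rw [exp_eq_cpt_pow]; ring

/-! ## The isometry between the increments and the spectral domain -/

lemma intervalIntegrable_weight {n μ : ℕ} {w : ℂ → ℂ} (hw : IsOuterWeight n μ w) {f : ℝ → ℝ}
    (hfi : IntervalIntegrable f volume (-Real.pi) Real.pi) :
    IntervalIntegrable (fun θ => ‖w (cpt θ)‖ ^ 2 * f θ) volume (-Real.pi) Real.pi :=
  hfi.continuousOn_mul ((DiffContOnCl.continuous_cpt hw.diffContOnCl).norm.pow 2).continuousOn

section Gram

variable {Ω : Type*} [MeasurableSpace Ω] {P : Measure Ω} {n μ : ℕ} {w : ℂ → ℂ} {ξ : ℤ → Ω → ℂ}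
  {f : ℝ → ℝ}

/-- With both steps equal to μ the two difference factors are conjugate to each other, and together
with θ^{-2n} they form |w|². -/
lemma integral_increment_mul_star (hw : IsOuterWeight n μ w) (hξ : HasSpectralDensity P n ξ f)
    (m k : ℤ) :
    ∫ x, increment n ξ m μ x * star (increment n ξ k μ x) ∂P =
      (1 / (2 * Real.pi) : ℂ) * ∫ θ in (-Real.pi)..Real.pi,
        cpt θ ^ (-m) * star (cpt θ ^ (-k)) * ((‖w (cpt θ)‖ ^ 2 * f θ : ℝ) : ℂ) := by
  have h := hξ.structural k (m - k) μ μ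
  rw [show k + (m - k) = m by ring] at h
  rw [h]
  congr 1
  refine intervalIntegral.integral_congr_ae (ae_mem_uIoc fun θ hθ h0 => ?_)
  have h1 : Complex.exp (Complex.I * θ * ((m - k : ℤ) : ℂ)) = cpt θ ^ (-m) * star (cpt θ ^ (-k)) := by
    rw [Complex.star_def, map_zpow₀, conj_cpt, _root_.inv_zpow, ← _root_.zpow_neg (cpt θ) (-k), neg_neg, ← zpow_add₀ (cpt_ne_zero θ), cpt, ← Complex.exp_int_mul]
    congr 1
    push_cast; ring
  have h2 : (1 - Complex.exp (-(Complex.I * ((μ : ℤ) : ℂ) * θ))) ^ n *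
      (1 - Complex.exp (Complex.I * ((μ : ℤ) : ℂ) * θ)) ^ n =
      ((‖1 - Complex.exp (-(Complex.I * μ * θ))‖ ^ (2 * n) : ℝ) : ℂ) := by
    have h3 : 1 - Complex.exp (Complex.I * ((μ : ℤ) : ℂ) * θ) =
        (starRingEnd ℂ) (1 - Complex.exp (-(Complex.I * ((μ : ℤ) : ℂ) * θ))) := by
      rw [map_sub, map_one, ← Complex.exp_conj]
      simp
    rw [h3, ← mul_pow, Complex.mul_conj', ← pow_mul]
    push_cast
    rfl
  rw [h1, mul_assoc (cpt θ ^ (-m) * star (cpt θ ^ (-k))), h2, hw.norm_eq θ hθ h0, ← norm_kernel_sq]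
  push_cast
  ring

/-- Finite combinations of increments correspond isometrically to trigonometric polynomials. -/
lemma integral_sum_increment_mul_star (hw : IsOuterWeight n μ w)
    (hfi : IntervalIntegrable f volume (-Real.pi) Real.pi) (hξ : HasSpectralDensity P n ξ f)
    {ι κ : Type*} (s : Finset ι) (t : Finset κ) (u : ι → ℂ) (v : κ → ℂ) (m : ι → ℤ) (k : κ → ℤ) :
    ∫ x, (∑ i ∈ s, u i * increment n ξ (m i) μ x) *
        star (∑ j ∈ t, v j * increment n ξ (k j) μ x) ∂P =
      (1 / (2 * Real.pi) : ℂ) * ∫ θ in (-Real.pi)..Real.pi,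
        (∑ i ∈ s, u i * cpt θ ^ (-m i)) * star (∑ j ∈ t, v j * cpt θ ^ (-k j)) *
          ((‖w (cpt θ)‖ ^ 2 * f θ : ℝ) : ℂ) := by
  have hint : ∀ a b : ℤ, Integrable (fun x => increment n ξ a μ x * star (increment n ξ b μ x)) P :=
    fun a b => (hξ.memLp a μ).integrable_mul (hξ.memLp b μ).star
  have hint2 : ∀ a b : ℤ, IntervalIntegrable (fun θ => cpt θ ^ (-a) * star (cpt θ ^ (-b)) *
      ((‖w (cpt θ)‖ ^ 2 * f θ : ℝ) : ℂ)) volume (-Real.pi) Real.pi := by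
    intro a b
    have h1 : IntervalIntegrable (fun θ => ((‖w (cpt θ)‖ ^ 2 * f θ : ℝ) : ℂ)) volume
        (-Real.pi) Real.pi :=
      ⟨(intervalIntegrable_weight hw hfi).1.ofReal, (intervalIntegrable_weight hw hfi).2.ofReal⟩
    refine h1.continuousOn_mul (Continuous.continuousOn ?_)
    have hz : ∀ a : ℤ, Continuous fun θ => cpt θ ^ a := fun a =>
      continuous_cpt.zpow₀ a fun θ => Or.inl (cpt_ne_zero θ)
    exact (hz _).mul (continuous_star.comp (hz _))
  have e1 : ∀ x, (∑ i ∈ s, u i * increment n ξ (m i) μ x) *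
        star (∑ j ∈ t, v j * increment n ξ (k j) μ x) =
      ∑ i ∈ s, ∑ j ∈ t, (u i * star (v j)) *
        (increment n ξ (m i) μ x * star (increment n ξ (k j) μ x)) := by
    intro x
    rw [star_sum, Finset.sum_mul_sum]
    refine Finset.sum_congr rfl fun i _ => Finset.sum_congr rfl fun j _ => ?_
    rw [star_mul']; ring
  have e2 : ∀ θ, (∑ i ∈ s, u i * cpt θ ^ (-m i)) * star (∑ j ∈ t, v j * cpt θ ^ (-k j)) *
          ((‖w (cpt θ)‖ ^ 2 * f θ : ℝ) : ℂ) =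
      ∑ i ∈ s, ∑ j ∈ t, (u i * star (v j)) *
        (cpt θ ^ (-m i) * star (cpt θ ^ (-k j)) * ((‖w (cpt θ)‖ ^ 2 * f θ : ℝ) : ℂ)) := by
    intro θ
    rw [star_sum, Finset.sum_mul_sum, Finset.sum_mul]
    refine Finset.sum_congr rfl fun i _ => ?_
    rw [Finset.sum_mul]
    refine Finset.sum_congr rfl fun j _ => ?_
    rw [star_mul']; ring
  simp only [e1, e2]
  rw [integral_finsetSum _ fun i _ => integrable_finsetSum _ fun j _ => (hint _ _).const_mul _,
    intervalIntegral.integral_finsetSum fun i _ => by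
      have := IntervalIntegrable.sum t fun j (_ : j ∈ t) =>
        (hint2 (m i) (k j)).const_mul (u i * star (v j))
      simpa only [Finset.sum_fn] using this, Finset.mul_sum]
  refine Finset.sum_congr rfl fun i _ => ?_
  rw [integral_finsetSum _ fun j _ => (hint _ _).const_mul _,
    intervalIntegral.integral_finsetSum fun j _ => (hint2 (m i) (k j)).const_mul _, Finset.mul_sum]
  refine Finset.sum_congr rfl fun j _ => ?_
  rw [integral_const_mul, intervalIntegral.integral_const_mul, integral_increment_mul_star hw hξ]
  ring

lemma integral_norm_sq_sum_increment (hw : IsOuterWeight n μ w)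
    (hfi : IntervalIntegrable f volume (-Real.pi) Real.pi) (hξ : HasSpectralDensity P n ξ f)
    {ι : Type*} (s : Finset ι) (u : ι → ℂ) (m : ι → ℤ) :
    ∫ x, ‖∑ i ∈ s, u i * increment n ξ (m i) μ x‖ ^ 2 ∂P =
      1 / (2 * Real.pi) * ∫ θ in (-Real.pi)..Real.pi,
        ‖∑ i ∈ s, u i * cpt θ ^ (-m i)‖ ^ 2 * (‖w (cpt θ)‖ ^ 2 * f θ) := by
  have h := integral_sum_increment_mul_star hw hfi hξ s s u u m m
  apply Complex.ofReal_injective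
  rw [← integral_complex_ofReal]
  push_cast
  rw [← intervalIntegral.integral_ofReal]
  convert h using 1
  · refine integral_congr_ae (Eventually.of_forall fun x => ?_)
    simp only [Complex.star_def, Complex.mul_conj']
  · congr 1
    refine intervalIntegral.integral_congr fun θ _ => ?_
    simp only [Complex.star_def, Complex.mul_conj']
    push_cast; rfl

/-- Both problems are least squares problems over a closed span, and the isometry matches their
errors on finite combinations; hence the minima agree. -/
lemma isLeast_linearEstimateErrors (hμ : 1 ≤ μ) (N : ℕ) (a : ℕ → ℂ) (hw : IsOuterWeight n μ w)
    (hf0 : ∀ θ ∈ Set.Icc (-Real.pi) Real.pi, 0 ≤ f θ)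
    (hfi : IntervalIntegrable f volume (-Real.pi) Real.pi) (hξ : HasSpectralDensity P n ξ f) :
    IsLeast (linearEstimateErrors P n μ N a ξ) (optimalError n μ N a f) := by
  have hg : MemLp (fun x => ∑ k ∈ Finset.range (N + 1),
      bCoef n μ N a k * increment n ξ k μ x) 2 P :=
    memLp_finsetSum _ fun k _ => (hξ.memLp k μ).const_mul _
  have h := isLeast_integral_norm_sub_sq
    (e := fun j x => increment n ξ (-1 - (j : ℤ)) (μ : ℤ) x) (fun j => hξ.memLp _ _) hg
  have hset : linearEstimateErrors P n μ N a ξ = {r : ℝ | ∃ L : Ω → ℂ,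
      InClosedSpan P (fun j x => increment n ξ (-1 - (j : ℤ)) (μ : ℤ) x) L ∧
      r = ∫ x, ‖∑ k ∈ Finset.range (N + 1), bCoef n μ N a k * increment n ξ k μ x - L x‖ ^ 2 ∂P} := by
    simp only [linearEstimateErrors, ← functionalA_add_functionalV n hμ N a ξ]
    have : ∀ L : Ω → ℂ, ∀ x, functionalA N a ξ x - (-functionalV n μ N a ξ x + L x) =
        functionalA N a ξ x + functionalV n μ N a ξ x - L x := fun L x => by ring
    simp only [this]
  rw [hset, optimalError_eq_iInf hw a hf0 hfi]
  convert h using 1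
  refine iInf_congr fun c => ?_
  -- A disjoint union of index sets treats target and estimate as a single combination of
  -- increments, with the estimate entering negatively.
  have h1 := integral_norm_sq_sum_increment hw hfi hξ ((Finset.range (N + 1)).disjSum c.support)
    (Sum.elim (bCoef n μ N a) (fun j => - c j)) (Sum.elim (fun k => (k : ℤ)) (fun j => -1 - (j : ℤ)))
  simp only [Finset.sum_disjSum, Sum.elim_inl, Sum.elim_inr, neg_mul, Finset.sum_neg_distrib,
    ← sub_eq_add_neg] at h1
  rw [h1, mse_eq_integral hw]
  congr 2
  funext θ
  congr 3
  congr 1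
  · rw [bFun]
    refine Finset.sum_congr rfl fun k _ => ?_
    rw [_root_.zpow_neg, zpow_natCast, inv_pow]
  · rw [pastPolynomial]
    refine Finset.sum_congr rfl fun j _ => ?_
    congr 1
    rw [neg_sub, sub_neg_eq_add]
    exact_mod_cast (zpow_natCast (cpt θ) (j + 1)).symm

end Gram

/-! ## Bounds for the optimal error -/

lemma exists_pastPolynomial_eq (p : Polynomial ℂ) :
    ∃ c : ℕ →₀ ℂ, ∀ θ, pastPolynomial c θ = cpt θ * p.eval (cpt θ) := by
  refine ⟨Finsupp.onFinset p.support p.coeff fun j hj => Polynomial.mem_support_iff.mpr hj,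
    fun θ => ?_⟩
  have hs : (Finsupp.onFinset p.support p.coeff
      fun j hj => Polynomial.mem_support_iff.mpr hj).support = p.support := by
    ext j; simp
  rw [pastPolynomial, hs, Polynomial.eval_eq_sum, Polynomial.sum, Finset.mul_sum]
  refine Finset.sum_congr rfl fun j _ => ?_
  rw [Finsupp.onFinset_apply, pow_succ]; ring

lemma exists_differentiable_pastPolynomial (c : ℕ →₀ ℂ) :
    ∃ q : ℂ → ℂ, Differentiable ℂ q ∧ ∀ θ, pastPolynomial c θ = cpt θ * q (cpt θ) := by
  refine ⟨fun z => ∑ j ∈ c.support, c j * z ^ j, by fun_prop, fun θ => ?_⟩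
  rw [pastPolynomial, Finset.mul_sum]
  refine Finset.sum_congr rfl fun j _ => ?_
  rw [pow_succ]; ring

section

variable {n μ N : ℕ} {w : ℂ → ℂ} {a : ℕ → ℂ}

lemma maDensity_nonneg (φ : Fin (N + 1) → ℂ) (θ : ℝ) : 0 ≤ maDensity φ θ := by
  rw [maDensity_eq]; positivity

lemma intervalIntegrable_maDensity (φ : Fin (N + 1) → ℂ) :
    IntervalIntegrable (maDensity φ) volume (-Real.pi) Real.pi := by
  have h : Continuous (maDensity φ) := by
    rw [funext (maDensity_eq φ)]
    exact ((differentiable_phiFun φ).continuous.comp continuous_cpt).norm.pow 2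
  exact h.intervalIntegrable _ _

/-- An estimate zq(z) subtracts zqwΦ from R + zF. This changes only the analytic part vanishing at
0, which is orthogonal to R. -/
lemma sqNorm_rVec_le_optimalError (hw : IsOuterWeight n μ w) (φ : Fin (N + 1) → ℂ) :
    sqNorm (rVec n μ a φ) ≤ optimalError n μ N a (maDensity φ) := by
  rw [optimalError_eq_iInf hw a (fun θ _ => maDensity_nonneg φ θ) (intervalIntegrable_maDensity φ)]
  refine le_ciInf fun c => ?_
  obtain ⟨q, hq, hqc⟩ := exists_differentiable_pastPolynomial c
  obtain ⟨F, hF, hFz⟩ := exists_bFun_mul_eq hw a φ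
  have hpi := Real.pi_pos
  have hG : DiffContOnCl ℂ (fun z => F z - q z * (w z * phiFun φ z)) (ball 0 1) :=
    hF.sub (hq.diffContOnCl.smul (hw.diffContOnCl.smul (differentiable_phiFun φ).diffContOnCl))
  have h1 := integral_norm_rFun_add (n := n) (μ := μ) a φ hG
  have h2 : 0 ≤ ∫ θ in (-Real.pi)..Real.pi,
      ‖F (cpt θ) - q (cpt θ) * (w (cpt θ) * phiFun φ (cpt θ))‖ ^ 2 :=
    intervalIntegral.integral_nonneg neg_pi_le_pi fun θ _ => by positivity
  have h3 : mse n μ N a (pastPolynomial c) (maDensity φ) = 1 / (2 * Real.pi) *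
      ∫ θ in (-Real.pi)..Real.pi, ‖rFun n μ a φ (cpt θ) +
        cpt θ * (F (cpt θ) - q (cpt θ) * (w (cpt θ) * phiFun φ (cpt θ)))‖ ^ 2 := by
    rw [mse_eq_integral hw]
    congr 1
    refine intervalIntegral.integral_congr fun θ _ => ?_
    simp only [maDensity_eq, hqc, ← mul_pow, ← norm_mul]
    congr 2
    rw [sub_mul, hFz _ (cpt_ne_zero θ)]
    ring
  rw [h3, h1]
  have : 1 / (2 * Real.pi) * (2 * Real.pi * sqNorm (rVec n μ a φ)) = sqNorm (rVec n μ a φ) := by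
    field_simp
  rw [mul_add, this]
  have : 0 ≤ 1 / (2 * Real.pi) := by positivity
  nlinarith [mul_nonneg this h2]

/-! ### Maximal vectors of the Hankel operator and the upper bound. -/

/-- `|∑ (D A W φ)(k) e^{iθk}|² = s |∑ φ(k) e^{-iθk}|²`, where `∑ φ(k) z^k` has no zeros in the
closed unit disk. Such a `φ` is a maximal vector of `D A W`, with `s` the squared operator norm. -/
structure IsExtremal (n μ : ℕ) (a : ℕ → ℂ) (s : ℝ) (φ : Fin (N + 1) → ℂ) : Prop where
  ne_zero : ∀ z : ℂ, ‖z‖ ≤ 1 → phiFun φ z ≠ 0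
  norm_rFun_sq : ∀ θ, ‖rFun n μ a φ (cpt θ)‖ ^ 2 = s * ‖phiFun φ (cpt θ)‖ ^ 2

lemma IsExtremal.norm_div_sq {s : ℝ} {φ : Fin (N + 1) → ℂ} (hφ : IsExtremal n μ a s φ) (θ : ℝ) :
    ‖rFun n μ a φ (cpt θ) / phiFun φ (cpt θ)‖ ^ 2 = s := by
  have := norm_ne_zero_iff.mpr (hφ.ne_zero _ (norm_cpt θ).le)
  rw [norm_div, div_pow, hφ.norm_rFun_sq]
  field_simp

lemma IsExtremal.diffContOnCl_div {s : ℝ} {φ : Fin (N + 1) → ℂ} (hφ : IsExtremal n μ a s φ)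
    {F : ℂ → ℂ} (hF : DiffContOnCl ℂ F (ball 0 1)) :
    DiffContOnCl ℂ (fun z => F z / phiFun φ z) (ball 0 1) := by
  have h1 := (differentiable_phiFun φ).diffContOnCl.inv (s := ball (0 : ℂ) 1) fun z hz => by
    rw [closure_ball _ one_ne_zero] at hz
    exact hφ.ne_zero z (by simpa using hz)
  simp only [div_eq_mul_inv]
  exact hF.smul h1

/-- Division by Φ gives Bw = R/Φ + zF/Φ with |R/Φ|² = s. If p_k w → F/Φ boundedly, the estimates z
p_k cancel the second term in the limit, and the remaining error is s times the mean of f. Bounded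
convergence is what allows an arbitrary integrable f. -/
lemma IsExtremal.optimalError_le {s : ℝ} {φ : Fin (N + 1) → ℂ} (hφ : IsExtremal n μ a s φ)
    (hw : IsOuterWeight n μ w) {f : ℝ → ℝ} (hf0 : ∀ θ ∈ Set.Icc (-Real.pi) Real.pi, 0 ≤ f θ)
    (hfi : IntervalIntegrable f volume (-Real.pi) Real.pi) :
    optimalError n μ N a f ≤ s * (1 / (2 * Real.pi) * ∫ θ in (-Real.pi)..Real.pi, f θ) := by
  obtain ⟨F, hF, hFz⟩ := exists_bFun_mul_eq hw a φ
  have hG := hφ.diffContOnCl_div hF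
  obtain ⟨p, M, hM, hlim⟩ := exists_polynomial_mul_tendsto hw.diffContOnCl (fun z => hw.ne_zero)
    hw.exists_bound hG
  obtain ⟨C, -, hC⟩ := DiffContOnCl.exists_bound hG
  choose c hc using fun k => exists_pastPolynomial_eq (p k)
  set Q : ℝ → ℂ := fun θ => rFun n μ a φ (cpt θ) / phiFun φ (cpt θ) with hQ
  have hQn : ∀ θ, ‖Q θ‖ = Real.sqrt s := fun θ => by
    rw [← hφ.norm_div_sq θ, Real.sqrt_sq (norm_nonneg _)]
  have hmse : ∀ k, mse n μ N a (pastPolynomial (c k)) f = 1 / (2 * Real.pi) *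
      ∫ θ in (-Real.pi)..Real.pi, ‖Q θ + cpt θ * (F (cpt θ) / phiFun φ (cpt θ) -
        (p k).eval (cpt θ) * w (cpt θ))‖ ^ 2 * f θ := by
    intro k
    rw [mse_eq_integral hw]
    congr 1
    refine intervalIntegral.integral_congr fun θ _ => ?_
    simp only [hc, ← mul_assoc, ← mul_pow, ← norm_mul]
    congr 3
    have h0 := hφ.ne_zero _ (norm_cpt θ).le
    have h1 := hFz _ (cpt_ne_zero θ)
    have h2 : bFun n μ N a (cpt θ) * w (cpt θ) =
        Q θ + cpt θ * (F (cpt θ) / phiFun φ (cpt θ)) := by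
      rw [← mul_assoc] at h1
      rw [hQ]
      simp only
      rw [mul_div_assoc', ← add_div, ← h1, mul_div_cancel_right₀ _ h0]
    rw [sub_mul, h2]
    ring
  have hQc : Continuous Q := (continuous_rFun_cpt a φ).div
    ((differentiable_phiFun φ).continuous.comp continuous_cpt)
    fun θ => hφ.ne_zero _ (norm_cpt θ).le
  have hT : Tendsto (fun k => ∫ θ in (-Real.pi)..Real.pi,
      ‖Q θ + cpt θ * (F (cpt θ) / phiFun φ (cpt θ) - (p k).eval (cpt θ) * w (cpt θ))‖ ^ 2 * f θ)
      atTop (𝓝 (∫ θ in (-Real.pi)..Real.pi, s * f θ)) := by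
    refine intervalIntegral.tendsto_integral_filter_of_dominated_convergence
      (fun θ => (Real.sqrt s + (C + M)) ^ 2 * |f θ|) ?_ ?_ ?_ ?_
    · refine Eventually.of_forall fun k => ?_
      have hcont : Continuous fun θ => ‖Q θ + cpt θ * (F (cpt θ) / phiFun φ (cpt θ) -
          (p k).eval (cpt θ) * w (cpt θ))‖ ^ 2 :=
        (hQc.add (continuous_cpt.mul ((DiffContOnCl.continuous_cpt hG).sub
          (((p k).continuous.comp continuous_cpt).mul
            (DiffContOnCl.continuous_cpt hw.diffContOnCl))))).norm.pow 2
      rw [Set.uIoc_of_le neg_pi_le_pi]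
      exact hcont.aestronglyMeasurable.mul hfi.1.aestronglyMeasurable
    · refine Eventually.of_forall fun k => Eventually.of_forall fun θ _ => ?_
      rw [norm_mul, norm_pow, norm_norm, Real.norm_eq_abs]
      refine mul_le_mul_of_nonneg_right (pow_le_pow_left₀ (norm_nonneg _) ?_ 2) (abs_nonneg _)
      refine (norm_add_le _ _).trans (add_le_add (hQn θ).le ?_)
      rw [norm_mul, norm_cpt, one_mul]
      exact (norm_sub_le _ _).trans (add_le_add (hC _ (norm_cpt θ).le) (hM k _ (norm_cpt θ)))
    · exact hfi.abs.const_mul _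
    · filter_upwards [hw.ae_ne_zero] with θ hθ _
      have h1 := hlim _ (norm_cpt θ) hθ
      have h2 := ((h1.const_sub (F (cpt θ) / phiFun φ (cpt θ))).const_mul (cpt θ)).const_add (Q θ)
      rw [sub_self, mul_zero, add_zero] at h2
      have h3 := (h2.norm.pow 2).mul_const (f θ)
      rwa [hφ.norm_div_sq θ] at h3
  have hT2 := hT.const_mul (1 / (2 * Real.pi))
  simp only [← hmse] at hT2
  rw [intervalIntegral.integral_const_mul] at hT2
  have := ge_of_tendsto' hT2 fun k => IncrementExtrapolation.optimalError_le hw a hf0 hfi (c k)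
  linarith

lemma exists_cpt_eq (θ : ℝ) : ∃ θ' ∈ Set.Icc (-Real.pi) Real.pi, cpt θ' = cpt θ := by
  refine ⟨-(cpt θ).arg, ⟨neg_le_neg (Complex.arg_le_pi _), ?_⟩, ?_⟩
  · linarith [Complex.neg_pi_lt_arg (cpt θ)]
  · have h := Complex.norm_mul_exp_arg_mul_I (cpt θ)
    rw [norm_cpt, Complex.ofReal_one, one_mul] at h
    conv_rhs => rw [← h]
    rw [cpt]
    congr 1
    push_cast; ring

/-- A maximal vector `φ` bounds `‖D A W ψ‖²`, and in the case of equality `ψ` is maximal as well. -/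
lemma IsExtremal.sqNorm_rVec_le {s : ℝ} {φ : Fin (N + 1) → ℂ} (hφ : IsExtremal n μ a s φ)
    (hw : IsOuterWeight n μ w) (ψ : Fin (N + 1) → ℂ) :
    sqNorm (rVec n μ a ψ) ≤ s * sqNorm ψ ∧ (sqNorm (rVec n μ a ψ) = s * sqNorm ψ →
      ∀ θ, ‖rFun n μ a ψ (cpt θ)‖ ^ 2 = s * ‖phiFun ψ (cpt θ)‖ ^ 2) := by
  obtain ⟨F, hF, hFz⟩ := exists_bFun_mul_eq hw a φ
  obtain ⟨G, hG, hGz⟩ := exists_bFun_mul_eq hw a ψ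
  have hpi := Real.pi_pos
  set H : ℂ → ℂ := fun z => G z - F z / phiFun φ z * phiFun ψ z with hH
  have hHd : DiffContOnCl ℂ H (ball 0 1) :=
    hG.sub ((hφ.diffContOnCl_div hF).smul (differentiable_phiFun ψ).diffContOnCl)
  -- Multiplying BwΦ = R_φ + zF by Ψ/Φ and comparing with BwΨ = R_ψ + zG leaves only a multiple of z
  -- times an analytic function.
  have key : ∀ θ, rFun n μ a φ (cpt θ) / phiFun φ (cpt θ) * phiFun ψ (cpt θ) =
      rFun n μ a ψ (cpt θ) + cpt θ * H (cpt θ) := by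
    intro θ
    have h0 := hφ.ne_zero _ (norm_cpt θ).le
    have h1 := hFz _ (cpt_ne_zero θ)
    have h2 := hGz _ (cpt_ne_zero θ)
    have h3 : rFun n μ a φ (cpt θ) =
        bFun n μ N a (cpt θ) * (w (cpt θ) * phiFun φ (cpt θ)) - cpt θ * F (cpt θ) := by
      rw [h1]; ring
    have h4 : rFun n μ a ψ (cpt θ) =
        bFun n μ N a (cpt θ) * (w (cpt θ) * phiFun ψ (cpt θ)) - cpt θ * G (cpt θ) := by
      rw [h2]; ring
    rw [h3, h4, hH]
    field_simp
    ring
  have hnorm : ∀ θ, ‖rFun n μ a ψ (cpt θ) + cpt θ * H (cpt θ)‖ ^ 2 =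
      s * ‖phiFun ψ (cpt θ)‖ ^ 2 := by
    intro θ
    rw [← key, norm_mul, mul_pow, hφ.norm_div_sq]
  -- Orthogonality of R_ψ and zH gives s‖ψ‖² = ‖DAWψ‖² + (1/2π)∫|H|². Equality therefore forces H to
  -- vanish on the circle, by continuity.
  have h1 := integral_norm_rFun_add (n := n) (μ := μ) a ψ hHd
  simp only [hnorm] at h1
  rw [intervalIntegral.integral_const_mul, integral_norm_phiFun] at h1
  have h2 : 0 ≤ ∫ θ in (-Real.pi)..Real.pi, ‖H (cpt θ)‖ ^ 2 :=
    intervalIntegral.integral_nonneg neg_pi_le_pi fun θ _ => by positivity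
  refine ⟨?_, fun heq θ => ?_⟩
  · by_contra hlt
    push Not at hlt
    nlinarith
  · have h3 : ∫ θ in (-Real.pi)..Real.pi, ‖H (cpt θ)‖ ^ 2 = 0 := by rw [heq] at h1; linarith
    obtain ⟨θ', hθ', he⟩ := exists_cpt_eq θ
    have h4 : H (cpt θ') = 0 := by
      by_contra hne
      have hpos := intervalIntegral.integral_pos (a := -Real.pi) (b := Real.pi)
        (f := fun θ => ‖H (cpt θ)‖ ^ 2) (by linarith)
        ((DiffContOnCl.continuous_cpt hHd).norm.pow 2).continuousOn
        (fun θ _ => by positivity) ⟨θ', hθ', by have := norm_pos_iff.mpr hne; positivity⟩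
      linarith
    have h5 := hnorm θ
    rw [← he, h4, mul_zero, add_zero] at h5
    rw [← he]; exact h5

/-! ## Canonical factorizations -/

lemma tsum_extendZero (φ : Fin (N + 1) → ℂ) (z : ℂ) :
    ∑' k, extendZero φ k * z ^ k = phiFun φ z := by
  rw [phiFun, sum_fin_eq_sum_range]
  refine tsum_eq_sum fun k hk => ?_
  rw [extendZero, dif_neg (by simpa using hk), zero_mul]

lemma IsCanonicalFactorization.phiFun_ne_zero {f : ℝ → ℝ} {φ : Fin (N + 1) → ℂ}
    (h : IsCanonicalFactorization f (extendZero φ)) {z : ℂ} (hz : ‖z‖ ≤ 1) : phiFun φ z ≠ 0 := by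
  rw [← tsum_extendZero]; exact h.2.1 z hz

lemma IsCanonicalFactorization.eq_norm_phiFun {f : ℝ → ℝ} {φ : Fin (N + 1) → ℂ}
    (h : IsCanonicalFactorization f (extendZero φ)) (θ : ℝ) :
    f θ = ‖phiFun φ (cpt θ)‖ ^ 2 := by
  rw [h.2.2 θ, tsum_extendZero]; rfl

/-- Here |cR|² = |Φ|² on the circle, where Φ has no zeros; this excludes c = 0 and gives s =
|c|^{-2}. -/
lemma IsCanonicalFactorization.isExtremal {c : ℂ} {φ : Fin (N + 1) → ℂ}
    (h : IsCanonicalFactorization (rDensity n μ a c φ) (extendZero φ)) :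
    c ≠ 0 ∧ IsExtremal n μ a (‖c‖ ^ 2)⁻¹ φ := by
  have h1 : ∀ θ, ‖c‖ ^ 2 * ‖rFun n μ a φ (cpt θ)‖ ^ 2 = ‖phiFun φ (cpt θ)‖ ^ 2 := fun θ => by
    rw [← rDensity_eq, IsCanonicalFactorization.eq_norm_phiFun h]
  have hc : c ≠ 0 := by
    rintro rfl
    have h2 := h1 0
    have h3 := norm_pos_iff.mpr
      (IsCanonicalFactorization.phiFun_ne_zero h (norm_cpt 0).le)
    rw [norm_zero, zero_pow two_ne_zero, zero_mul] at h2
    exact absurd h2.symm (by positivity)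
  refine ⟨hc, fun z hz => IsCanonicalFactorization.phiFun_ne_zero h hz, fun θ => ?_⟩
  rw [← h1]
  have := norm_ne_zero_iff.mpr hc
  field_simp

lemma IsCanonicalFactorization.integral_rDensity {c : ℂ} {φ : Fin (N + 1) → ℂ}
    (h : IsCanonicalFactorization (rDensity n μ a c φ) (extendZero φ)) :
    ∫ θ in (-Real.pi)..Real.pi, rDensity n μ a c φ θ = 2 * Real.pi * sqNorm φ := by
  simp only [IsCanonicalFactorization.eq_norm_phiFun h, integral_norm_phiFun]

lemma IsExtremal.sqNorm_rVec_eq {s : ℝ} {φ : Fin (N + 1) → ℂ} (hφ : IsExtremal n μ a s φ) :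
    sqNorm (rVec n μ a φ) = s * sqNorm φ := by
  have h := integral_norm_rFun (n := n) (μ := μ) a φ
  simp only [hφ.norm_rFun_sq] at h
  rw [intervalIntegral.integral_const_mul, integral_norm_phiFun] at h
  have := Real.pi_pos
  have h2 : 2 * Real.pi * (s * sqNorm φ) = 2 * Real.pi * sqNorm (rVec n μ a φ) := by
    rw [← h]; ring
  exact (mul_left_cancel₀ (by positivity) h2).symm

lemma maDensity_mem_classD0 {P₀ : ℝ} (φ : Fin (N + 1) → ℂ) :
    maDensity φ ∈ classD0 P₀ ↔ sqNorm φ ≤ P₀ := by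
  have hpi := Real.pi_pos
  have h : 1 / (2 * Real.pi) * (2 * Real.pi * sqNorm φ) = sqNorm φ := by field_simp
  simp only [classD0, Set.mem_ofPred_eq, integral_maDensity, h]
  exact ⟨fun h => h.2.2, fun h => ⟨fun θ _ => maDensity_nonneg φ θ,
    intervalIntegrable_maDensity φ, h⟩⟩

/-- A supremum over no competitors is ⊥. Hypotheses on ν₀⁺ produce a maximal vector through this. -/
lemma exists_of_nuPlusP_ne_bot {P₀ : ℝ} (h : nuPlusP n μ N a P₀ ≠ ⊥) :
    ∃ (φ : Fin (N + 1) → ℂ) (c : ℂ), sqNorm φ = P₀ ∧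
      IsCanonicalFactorization (rDensity n μ a c φ) (extendZero φ) := by
  by_contra hne
  push Not at hne
  apply h
  rw [nuPlusP, eq_bot_iff]
  refine iSup₂_le fun φ hφ => ?_
  obtain ⟨h1, c, h2⟩ := hφ
  exact absurd h2 (hne φ c h1)

/-- The operator bound s‖ψ‖² limits all competitors, and φ itself attains it; one admissible φ
determines the value. -/
lemma IsExtremal.nuPlusP_eq {P₀ : ℝ} {c : ℂ} {φ : Fin (N + 1) → ℂ} (hw : IsOuterWeight n μ w)
    (h : IsCanonicalFactorization (rDensity n μ a c φ) (extendZero φ)) (hP : sqNorm φ = P₀) :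
    nuPlusP n μ N a P₀ = (((‖c‖ ^ 2)⁻¹ * P₀ : ℝ) : EReal) := by
  have hE := (IsCanonicalFactorization.isExtremal h).2
  refine le_antisymm (iSup₂_le fun ψ hψ => ?_) ?_
  · have := (hE.sqNorm_rVec_le hw ψ).1
    rw [hψ.1] at this
    exact_mod_cast this
  · rw [← hP, ← hE.sqNorm_rVec_eq]
    exact le_iSup₂_of_le φ ⟨rfl, c, h⟩ le_rfl

/-- A `φ` with `‖φ‖² = P₀` attaining the operator norm of `D A W` gives a least favorable
density. -/
lemma IsExtremal.isLeastFavorable {P₀ s : ℝ} (hs : 0 ≤ s) {φ φ₀ : Fin (N + 1) → ℂ}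
    (hE : IsExtremal n μ a s φ)
    (hw : IsOuterWeight n μ w) (hP : sqNorm φ₀ = P₀) (hmax : sqNorm (rVec n μ a φ₀) = s * P₀) :
    IsLeastFavorable n μ N a (classD0 P₀) (maDensity φ₀) := by
  refine ⟨(maDensity_mem_classD0 φ₀).mpr hP.le, fun f hf => ?_⟩
  calc optimalError n μ N a f ≤ s * (1 / (2 * Real.pi) * ∫ θ in (-Real.pi)..Real.pi, f θ) :=
        hE.optimalError_le hw hf.1 hf.2.1
    _ ≤ s * P₀ := mul_le_mul_of_nonneg_left hf.2.2 hs
    _ = sqNorm (rVec n μ a φ₀) := hmax.symm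
    _ ≤ _ := sqNorm_rVec_le_optimalError hw φ₀

end

/-! ## Convergence lemmas -/

lemma tendsto_integral_of_bounded {E : Type*} [NormedAddCommGroup E] [NormedSpace ℝ E]
    {u : ℕ → ℝ → E} {v : ℝ → E} (hu : ∀ k, Continuous (u k)) {M : ℝ} (hM : ∀ k θ, ‖u k θ‖ ≤ M)
    (hlim : ∀ᵐ θ : ℝ, Tendsto (fun k => u k θ) atTop (𝓝 (v θ))) :
    Tendsto (fun k => ∫ θ in (-Real.pi)..Real.pi, u k θ) atTop
      (𝓝 (∫ θ in (-Real.pi)..Real.pi, v θ)) := by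
  refine intervalIntegral.tendsto_integral_filter_of_dominated_convergence (fun _ => M)
    (Eventually.of_forall fun k => (hu k).aestronglyMeasurable)
    (Eventually.of_forall fun k => Eventually.of_forall fun θ _ => hM k θ)
    intervalIntegrable_const ?_
  filter_upwards [hlim] with θ h _ using h

lemma exists_tendsto_of_norm_sub_sq_le {V : Type*} [NormedAddCommGroup V] [CompleteSpace V]
    {u : ℕ → V} {d : ℕ → ℝ} (hd : Tendsto d atTop (𝓝 0))
    (h : ∀ k l, ‖u k - u l‖ ^ 2 ≤ d k + d l) : ∃ v, Tendsto u atTop (𝓝 v) := by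
  refine cauchySeq_tendsto_of_complete (Metric.cauchySeq_iff.mpr fun ε hε => ?_)
  obtain ⟨K, hK⟩ := eventually_atTop.mp (hd.eventually (gt_mem_nhds (by positivity : 0 < ε ^ 2 / 2)))
  refine ⟨K, fun k hk l hl => ?_⟩
  rw [dist_eq_norm]
  have h1 := hK k hk
  have h2 := hK l hl
  have h3 := h k l
  exact lt_of_pow_lt_pow_left₀ 2 hε.le (by linarith)

lemma norm_sub_sq_le (x y z : ℂ) : ‖x - y‖ ^ 2 ≤ 2 * ‖x - z‖ ^ 2 + 2 * ‖y - z‖ ^ 2 := by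
  have h1 : ‖x - y‖ ≤ ‖x - z‖ + ‖y - z‖ := by
    calc ‖x - y‖ = ‖(x - z) - (y - z)‖ := by congr 1; ring
      _ ≤ _ := norm_sub_le _ _
  nlinarith [sq_nonneg (‖x - z‖ - ‖y - z‖), norm_nonneg (x - y)]

lemma integral_norm_sub_sq_le {x y z : ℝ → ℂ} (hx : Continuous x) (hy : Continuous y)
    (hz : Continuous z) :
    ∫ θ in (-Real.pi)..Real.pi, ‖x θ - y θ‖ ^ 2 ≤
      2 * (∫ θ in (-Real.pi)..Real.pi, ‖x θ - z θ‖ ^ 2) +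
      2 * ∫ θ in (-Real.pi)..Real.pi, ‖y θ - z θ‖ ^ 2 := by
  have hi : ∀ {x y : ℝ → ℂ}, Continuous x → Continuous y →
      IntervalIntegrable (fun θ => ‖x θ - y θ‖ ^ 2) volume (-Real.pi) Real.pi := fun hx hy =>
    ((hx.sub hy).norm.pow 2).intervalIntegrable _ _
  rw [← intervalIntegral.integral_const_mul, ← intervalIntegral.integral_const_mul,
    ← intervalIntegral.integral_add ((hi hx hz).const_mul 2) ((hi hy hz).const_mul 2)]
  exact intervalIntegral.integral_mono_on neg_pi_le_pi (hi hx hy)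
    (((hi hx hz).const_mul 2).add ((hi hy hz).const_mul 2)) fun θ _ => norm_sub_sq_le _ _ _

/-! ### Mean square convergence of the Taylor polynomials of w_μ. -/

/-- The Taylor polynomial `∑_{j<J} w_μ(j) X^j`. -/
noncomputable def wPoly (n μ J : ℕ) : Polynomial ℂ :=
  ∑ j ∈ Finset.range J, Polynomial.monomial j (wCoef n μ j)

lemma eval_wPoly (n μ J : ℕ) (z : ℂ) :
    (wPoly n μ J).eval z = ∑ j ∈ Finset.range J, wCoef n μ j * z ^ j := by
  simp [wPoly, Polynomial.eval_finsetSum, Polynomial.eval_monomial]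

/-- By Parseval a Taylor section is the best mean square approximation of its degree. It is
therefore at least as close to w as the boundedly convergent polynomials t, once its length exceeds
their degree. -/
lemma tendsto_integral_sub_wPoly {n μ : ℕ} {w : ℂ → ℂ} (hw : IsOuterWeight n μ w) :
    Tendsto (fun J => ∫ θ in (-Real.pi)..Real.pi, ‖(wPoly n μ J).eval (cpt θ) - w (cpt θ)‖ ^ 2)
      atTop (𝓝 0) := by
  have hwc := DiffContOnCl.continuous_cpt hw.diffContOnCl
  obtain ⟨t, M, hM, hlim⟩ := exists_polynomial_mul_tendsto (w := fun _ => 1) diffContOnCl_const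
    (fun _ _ => one_ne_zero) ⟨1, fun _ _ _ _ _ => by simp⟩ hw.diffContOnCl
  obtain ⟨C, -, hC⟩ := DiffContOnCl.exists_bound hw.diffContOnCl
  simp only [mul_one] at hM hlim
  have ht : Tendsto (fun k => ∫ θ in (-Real.pi)..Real.pi, ‖w (cpt θ) - (t k).eval (cpt θ)‖ ^ 2)
      atTop (𝓝 0) := by
    have := tendsto_integral_of_bounded (u := fun k θ => ‖w (cpt θ) - (t k).eval (cpt θ)‖ ^ 2)
      (v := fun _ => 0) (M := (C + M) ^ 2)
      (fun k => (hwc.sub ((t k).continuous.comp continuous_cpt)).norm.pow 2)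
      (fun k θ => by
        rw [norm_pow, norm_norm]
        exact pow_le_pow_left₀ (norm_nonneg _) ((norm_sub_le _ _).trans
          (add_le_add (hC _ (norm_cpt θ).le) (hM k _ (norm_cpt θ)))) 2)
      (Eventually.of_forall fun θ => by
        have := ((hlim _ (norm_cpt θ) one_ne_zero).const_sub (w (cpt θ))).norm.pow 2
        simpa using this)
    simpa using this
  have htail : ∀ J, ∫ θ in (-Real.pi)..Real.pi, ‖(wPoly n μ J).eval (cpt θ) - w (cpt θ)‖ ^ 2 =
      ∫ θ in (-Real.pi)..Real.pi, ‖taylorTail w J (cpt θ)‖ ^ 2 := by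
    intro J
    refine intervalIntegral.integral_congr fun θ _ => ?_
    have h1 := eq_sum_add_taylorTail w J (cpt θ)
    simp only [hw.taylorTail_zero] at h1
    rw [eval_wPoly, h1, sub_add_cancel_left, norm_neg, norm_mul, norm_pow, norm_cpt, one_pow,
      one_mul]
  rw [Metric.tendsto_atTop]
  intro ε hε
  obtain ⟨k, hk⟩ := (ht.eventually (gt_mem_nhds hε)).exists
  refine ⟨(t k).natDegree + 1, fun J hJ => ?_⟩
  have h0 : 0 ≤ ∫ θ in (-Real.pi)..Real.pi, ‖taylorTail w J (cpt θ)‖ ^ 2 :=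
    intervalIntegral.integral_nonneg neg_pi_le_pi fun θ _ => by positivity
  rw [htail, Real.dist_eq, sub_zero, abs_of_nonneg h0]
  refine lt_of_le_of_lt ?_ hk
  have h1 := integral_norm_sq_sum_add J (fun j => wCoef n μ j - (t k).coeff j)
    (diffContOnCl_taylorTail hw.diffContOnCl J)
  have h2 : ∀ θ, ∑ j ∈ Finset.range J, (wCoef n μ j - (t k).coeff j) * cpt θ ^ j +
      cpt θ ^ J * taylorTail w J (cpt θ) = w (cpt θ) - (t k).eval (cpt θ) := by
    intro θ
    have h3 := eq_sum_add_taylorTail w J (cpt θ)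
    simp only [hw.taylorTail_zero] at h3
    rw [Polynomial.eval_eq_sum_range' (show (t k).natDegree < J by omega)]
    conv_rhs => rw [h3]
    simp only [sub_mul, Finset.sum_sub_distrib]
    ring
  simp only [h2] at h1
  rw [h1]
  have := Real.pi_pos
  have : 0 ≤ 2 * Real.pi * ∑ j ∈ Finset.range J, ‖wCoef n μ j - (t k).coeff j‖ ^ 2 := by positivity
  linarith

/-! ## Polynomials in the backward shift -/

section ShiftSum

variable {V : Type*} [AddCommGroup V] [Module ℂ V]

/-- `p ↦ ∑ p_j x(m - j)`. -/
noncomputable def shiftSum (x : ℤ → V) (m : ℤ) : Polynomial ℂ →ₗ[ℂ] V :=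
  Polynomial.lsum fun j => LinearMap.toSpanSingleton ℂ V (x (m - (j : ℤ)))

lemma shiftSum_apply (x : ℤ → V) (m : ℤ) (p : Polynomial ℂ) :
    shiftSum x m p = ∑ j ∈ p.support, p.coeff j • x (m - (j : ℤ)) := by
  rw [shiftSum, Polynomial.lsum_apply, Polynomial.sum]
  rfl

lemma shiftSum_monomial (x : ℤ → V) (m : ℤ) (j : ℕ) (c : ℂ) :
    shiftSum x m (Polynomial.monomial j c) = c • x (m - (j : ℤ)) := by
  rw [shiftSum, Polynomial.lsum_apply, Polynomial.sum_monomial_index _ _ (by simp)]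
  simp [LinearMap.toSpanSingleton_apply]

/-- Polynomials act on sequences through the backward shift, so products act by composition. -/
lemma shiftSum_mul (x : ℤ → V) (m : ℤ) (q p : Polynomial ℂ) :
    shiftSum x m (q * p) = shiftSum (fun k => shiftSum x k p) m q := by
  induction q using Polynomial.induction_on' with
  | add q₁ q₂ h₁ h₂ => rw [add_mul, map_add, map_add, h₁, h₂]
  | monomial j c =>
    rw [shiftSum_monomial]
    induction p using Polynomial.induction_on' with
    | add p₁ p₂ h₁ h₂ => rw [mul_add, map_add, map_add, smul_add, h₁, h₂]
    | monomial i d =>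
      rw [Polynomial.monomial_mul_monomial, shiftSum_monomial, shiftSum_monomial, smul_smul]
      congr 2
      push_cast; ring

lemma tendsto_shiftSum [TopologicalSpace V] [ContinuousAdd V] [ContinuousConstSMul ℂ V]
    {x : ℕ → ℤ → V} {y : ℤ → V} (h : ∀ m, Tendsto (fun k => x k m) atTop (𝓝 (y m))) (m : ℤ)
    (p : Polynomial ℂ) : Tendsto (fun k => shiftSum (x k) m p) atTop (𝓝 (shiftSum y m p)) := by
  simp only [shiftSum_apply]
  exact tendsto_finsetSum _ fun j _ => (h _).const_smul _

lemma shiftSum_wPoly (x : ℤ → V) (n μ J : ℕ) (m : ℤ) :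
    shiftSum x m (wPoly n μ J) = ∑ j ∈ Finset.range J, wCoef n μ j • x (m - (j : ℤ)) := by
  simp only [wPoly, map_sum, shiftSum_monomial]

/-- `∑ φ(k) X^k`. -/
noncomputable def phiPoly {N : ℕ} (φ : Fin (N + 1) → ℂ) : Polynomial ℂ :=
  ∑ k, Polynomial.monomial k.val (φ k)

lemma eval_phiPoly {N : ℕ} (φ : Fin (N + 1) → ℂ) (z : ℂ) :
    (phiPoly φ).eval z = phiFun φ z := by
  simp [phiPoly, phiFun, Polynomial.eval_finsetSum, Polynomial.eval_monomial]

lemma shiftSum_phiPoly {N : ℕ} (x : ℤ → V) (φ : Fin (N + 1) → ℂ) (m : ℤ) :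
    shiftSum x m (phiPoly φ) = ∑ k, φ k • x (m - (k.val : ℤ)) := by
  simp only [phiPoly, map_sum, shiftSum_monomial]

end ShiftSum

lemma integral_cpt_zpow (k : ℤ) :
    ∫ θ in (-Real.pi)..Real.pi, cpt θ ^ k = if k = 0 then (2 * Real.pi : ℂ) else 0 := by
  have hnat : ∀ j : ℕ, ∫ θ in (-Real.pi)..Real.pi, cpt θ ^ j =
      if j = 0 then (2 * Real.pi : ℂ) else 0 := by
    intro j
    rw [integral_cpt_eq (F := fun z => z ^ j) (Differentiable.diffContOnCl (by fun_prop))]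
    by_cases h : j = 0
    · simp [h]
    · simp [h]
  obtain ⟨j, rfl | rfl⟩ := k.eq_nat_or_neg
  · simp only [zpow_natCast, hnat]
    norm_cast
  · have h1 : ∀ θ, cpt θ ^ (-(j : ℤ)) = (starRingEnd ℂ) (cpt θ ^ j) := by
      intro θ
      rw [map_pow, conj_cpt, _root_.zpow_neg, zpow_natCast, inv_pow]
    simp only [h1]
    rw [intervalIntegral.integral_of_le neg_pi_le_pi, integral_conj,
      ← intervalIntegral.integral_of_le neg_pi_le_pi, hnat]
    by_cases h : j = 0
    · simp [h, map_ofNat]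
    · simp [h]

/-! ## The moving average representation -/

section Whitening

variable {V : Type*} [NormedAddCommGroup V] [InnerProductSpace ℂ V]

/-- The sequence `x` is stationary with spectral factor `ψ`. -/
def HasSpectralFactor (x : ℤ → V) (ψ : ℝ → ℂ) : Prop :=
  ∀ (k m : ℤ) (q p : Polynomial ℂ), inner ℂ (shiftSum x k q) (shiftSum x m p) =
    (1 / (2 * Real.pi) : ℂ) * ∫ θ in (-Real.pi)..Real.pi,
      (cpt θ ^ (-m) * (p.eval (cpt θ) * ψ θ)) * star (cpt θ ^ (-k) * (q.eval (cpt θ) * ψ θ))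

lemma HasSpectralFactor.norm_sq {x : ℤ → V} {ψ : ℝ → ℂ} (hx : HasSpectralFactor x ψ) (m : ℤ)
    (p : Polynomial ℂ) : ‖shiftSum x m p‖ ^ 2 =
      1 / (2 * Real.pi) * ∫ θ in (-Real.pi)..Real.pi, ‖p.eval (cpt θ) * ψ θ‖ ^ 2 := by
  have h := hx m m p p
  rw [inner_self_eq_norm_sq_to_K] at h
  apply Complex.ofReal_injective
  push_cast
  refine Eq.trans h ?_
  rw [← intervalIntegral.integral_ofReal]
  congr 1
  refine intervalIntegral.integral_congr fun θ _ => ?_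
  simp only [Complex.star_def, Complex.mul_conj', norm_mul, norm_zpow, norm_cpt, _root_.one_zpow, one_mul]
  push_cast
  ring

/-- The polynomials `t k` approximate `1 / ψ` on the circle, in the weight `ψ`. -/
structure IsApproxInverse (ψ : ℝ → ℂ) (t : ℕ → Polynomial ℂ) : Prop where
  continuous : Continuous ψ
  exists_bound : ∃ C : ℝ, ∀ θ, ‖ψ θ‖ ≤ C
  exists_bound_mul : ∃ M : ℝ, ∀ k θ, ‖(t k).eval (cpt θ) * ψ θ‖ ≤ M
  tendsto_one : ∀ᵐ θ, Tendsto (fun k => (t k).eval (cpt θ) * ψ θ) atTop (𝓝 1)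

lemma IsApproxInverse.continuous_mul {ψ : ℝ → ℂ} {t : ℕ → Polynomial ℂ}
    (ht : IsApproxInverse ψ t) (k : ℕ) : Continuous fun θ => (t k).eval (cpt θ) * ψ θ :=
  ((t k).continuous.comp continuous_cpt).mul ht.continuous

variable {x : ℤ → V} {ψ : ℝ → ℂ} {t : ℕ → Polynomial ℂ} {e : ℤ → V}

/-- Since t_k ψ → 1 boundedly, hence in mean square, the isometry makes t_k applied to x a Cauchy
sequence. Its limit is the white noise obtained by dividing the factor ψ out of x. -/
lemma HasSpectralFactor.exists_tendsto [CompleteSpace V] (hx : HasSpectralFactor x ψ)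
    (ht : IsApproxInverse ψ t) :
    ∃ e : ℤ → V, ∀ m, Tendsto (fun k => shiftSum x m (t k)) atTop (𝓝 (e m)) := by
  have hpi := Real.pi_pos
  have hc := ht.continuous_mul
  obtain ⟨M, hM⟩ := ht.exists_bound_mul
  have hd : Tendsto (fun k => 1 / (2 * Real.pi) *
      (2 * ∫ θ in (-Real.pi)..Real.pi, ‖(t k).eval (cpt θ) * ψ θ - 1‖ ^ 2)) atTop (𝓝 0) := by
    have := tendsto_integral_of_bounded (u := fun k θ => ‖(t k).eval (cpt θ) * ψ θ - 1‖ ^ 2)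
      (v := fun _ => 0) (M := (M + 1) ^ 2) (fun k => ((hc k).sub continuous_const).norm.pow 2)
      (fun k θ => by
        rw [norm_pow, norm_norm]
        refine pow_le_pow_left₀ (norm_nonneg _) ((norm_sub_le _ _).trans ?_) 2
        rw [norm_one]
        linarith [hM k θ])
      (by filter_upwards [ht.tendsto_one] with θ h; simpa using (h.sub_const 1).norm.pow 2)
    simpa using (this.const_mul 2).const_mul (1 / (2 * Real.pi))
  refine ⟨_, fun m => (exists_tendsto_of_norm_sub_sq_le hd fun k l => ?_).choose_spec⟩
  rw [← map_sub, hx.norm_sq, ← mul_add]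
  refine mul_le_mul_of_nonneg_left ?_ (by positivity)
  simp only [Polynomial.eval_sub, sub_mul]
  exact integral_norm_sub_sq_le (hc k) (hc l) continuous_const

lemma exists_bound_eval_cpt (p : Polynomial ℂ) : ∃ A : ℝ, 0 ≤ A ∧ ∀ θ, ‖p.eval (cpt θ)‖ ≤ A := by
  obtain ⟨A, hA, h⟩ := DiffContOnCl.exists_bound (p.differentiable (𝕜 := ℂ)).diffContOnCl
  exact ⟨A, hA, fun θ => h _ (norm_cpt θ).le⟩

/-- Under the isometry x corresponds to ψ and e to the constant 1. The identity holds with e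
replaced by t_k applied to x and passes to the limit. -/
lemma HasSpectralFactor.norm_sub_sq (hx : HasSpectralFactor x ψ) (ht : IsApproxInverse ψ t)
    (he : ∀ m, Tendsto (fun k => shiftSum x m (t k)) atTop (𝓝 (e m))) (m : ℤ)
    (p q : Polynomial ℂ) : ‖shiftSum x m p - shiftSum e m q‖ ^ 2 =
      1 / (2 * Real.pi) * ∫ θ in (-Real.pi)..Real.pi,
        ‖p.eval (cpt θ) * ψ θ - q.eval (cpt θ)‖ ^ 2 := by
  have h1 : Tendsto (fun k => ‖shiftSum x m (p - q * t k)‖ ^ 2) atTop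
      (𝓝 (‖shiftSum x m p - shiftSum e m q‖ ^ 2)) := by
    simp only [map_sub, shiftSum_mul]
    exact ((tendsto_shiftSum he m q).const_sub _).norm.pow 2
  refine tendsto_nhds_unique h1 ?_
  simp only [hx.norm_sq]
  refine Tendsto.const_mul _ ?_
  obtain ⟨A, hA0, hA⟩ := exists_bound_eval_cpt p
  obtain ⟨B, hB0, hB⟩ := exists_bound_eval_cpt q
  obtain ⟨C, hC⟩ := ht.exists_bound
  obtain ⟨M, hM⟩ := ht.exists_bound_mul
  have hev : ∀ k θ, (p - q * t k).eval (cpt θ) * ψ θ =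
      p.eval (cpt θ) * ψ θ - q.eval (cpt θ) * ((t k).eval (cpt θ) * ψ θ) := fun k θ => by
    rw [Polynomial.eval_sub, Polynomial.eval_mul]; ring
  simp only [hev]
  refine tendsto_integral_of_bounded (M := (A * C + B * M) ^ 2)
    (fun k => (((p.continuous.comp continuous_cpt).mul ht.continuous).sub
      ((q.continuous.comp continuous_cpt).mul (ht.continuous_mul k))).norm.pow 2)
    (fun k θ => ?_) ?_
  · rw [norm_pow, norm_norm]
    refine pow_le_pow_left₀ (norm_nonneg _) ((norm_sub_le _ _).trans (add_le_add ?_ ?_)) 2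
    · rw [norm_mul]
      exact mul_le_mul (hA θ) (hC θ) (norm_nonneg _) hA0
    · rw [norm_mul]
      exact mul_le_mul (hB θ) (hM k θ) (norm_nonneg _) hB0
  · filter_upwards [ht.tendsto_one] with θ h
    simpa using ((h.const_mul (q.eval (cpt θ))).const_sub (p.eval (cpt θ) * ψ θ)).norm.pow 2

/-- As t_k ψ → 1, the inner product tends to the mean of z^{k-m} over the circle. -/
lemma HasSpectralFactor.inner_eq (hx : HasSpectralFactor x ψ) (ht : IsApproxInverse ψ t)
    (he : ∀ m, Tendsto (fun k => shiftSum x m (t k)) atTop (𝓝 (e m))) (m k : ℤ) :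
    inner ℂ (e k) (e m) = if m = k then (1 : ℂ) else 0 := by
  refine tendsto_nhds_unique ((he k).inner (he m)) ?_
  simp only [hx k m]
  obtain ⟨M, hM⟩ := ht.exists_bound_mul
  have h := tendsto_integral_of_bounded (M := M * M)
    (u := fun l θ => (cpt θ ^ (-m) * ((t l).eval (cpt θ) * ψ θ)) *
      star (cpt θ ^ (-k) * ((t l).eval (cpt θ) * ψ θ)))
    (v := fun θ => cpt θ ^ (k - m)) (fun l => ?_) (fun l θ => ?_) ?_
  · rw [integral_cpt_zpow] at h
    convert h.const_mul (1 / (2 * Real.pi) : ℂ) using 2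
    have hpi : (Real.pi : ℂ) ≠ 0 := by exact_mod_cast Real.pi_ne_zero
    by_cases hmk : m = k
    · simp only [hmk, sub_self, if_true]
      field_simp
    · have : k - m ≠ 0 := fun h => hmk (by omega)
      simp [hmk, this]
  · have hz : ∀ j : ℤ, Continuous fun θ => cpt θ ^ j := fun j =>
      continuous_cpt.zpow₀ j fun θ => Or.inl (cpt_ne_zero θ)
    exact ((hz _).mul (ht.continuous_mul l)).mul ((hz _).mul (ht.continuous_mul l)).star
  · have hz : ∀ (j : ℤ) (z : ℂ), ‖cpt θ ^ j * z‖ = ‖z‖ := fun j z => by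
      rw [norm_mul, norm_zpow, norm_cpt, _root_.one_zpow, one_mul]
    rw [norm_mul, norm_star, hz, hz]
    exact mul_le_mul (hM l θ) (hM l θ) (norm_nonneg _) ((norm_nonneg _).trans (hM l θ))
  · filter_upwards [ht.tendsto_one] with θ h
    have h2 := (h.const_mul (cpt θ ^ (-m))).mul (h.const_mul (cpt θ ^ (-k))).star
    convert h2 using 2
    rw [mul_one, mul_one, Complex.star_def, map_zpow₀, conj_cpt, _root_.inv_zpow', neg_neg,
      ← zpow_add₀ (cpt_ne_zero θ)]
    congr 1
    ring

/-- The sequence y is w applied to e, defined as a mean square limit. Applying Φ to y gives the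
spectral function wΦ, which is that of x. -/
lemma HasSpectralFactor.exists_filtered [CompleteSpace V] {n μ N : ℕ} {w : ℂ → ℂ}
    {φ : Fin (N + 1) → ℂ}
    (hw : IsOuterWeight n μ w) (hx : HasSpectralFactor x fun θ => w (cpt θ) * phiFun φ (cpt θ))
    (ht : IsApproxInverse (fun θ => w (cpt θ) * phiFun φ (cpt θ)) t)
    (he : ∀ m, Tendsto (fun k => shiftSum x m (t k)) atTop (𝓝 (e m))) :
    ∃ y : ℤ → V,
      (∀ m, Tendsto (fun K => ∑ j ∈ Finset.range K, wCoef n μ j • e (m - (j : ℤ))) atTop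
        (𝓝 (y m))) ∧ ∀ m, x m = ∑ k, φ k • y (m - (k.val : ℤ)) := by
  have hpi := Real.pi_pos
  have hwc := DiffContOnCl.continuous_cpt hw.diffContOnCl
  have hW := tendsto_integral_sub_wPoly hw
  have hcont : ∀ p : Polynomial ℂ, Continuous fun θ => p.eval (cpt θ) := fun p =>
    p.continuous.comp continuous_cpt
  have hd : Tendsto (fun J => 1 / (2 * Real.pi) * (2 * ∫ θ in (-Real.pi)..Real.pi,
      ‖(wPoly n μ J).eval (cpt θ) - w (cpt θ)‖ ^ 2)) atTop (𝓝 0) := by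
    simpa using (hW.const_mul 2).const_mul (1 / (2 * Real.pi))
  have hex : ∀ m, ∃ y, Tendsto (fun J => shiftSum e m (wPoly n μ J)) atTop (𝓝 y) := by
    refine fun m => exists_tendsto_of_norm_sub_sq_le hd fun k l => ?_
    have h := hx.norm_sub_sq ht he m 0 (wPoly n μ k - wPoly n μ l)
    simp only [map_zero, zero_sub, norm_neg, Polynomial.eval_zero, zero_mul,
      Polynomial.eval_sub, map_sub] at h
    rw [h, ← mul_add]
    exact mul_le_mul_of_nonneg_left (integral_norm_sub_sq_le (hcont _) (hcont _) hwc)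
      (by positivity)
  choose y hy using hex
  refine ⟨y, fun m => by simpa only [shiftSum_wPoly] using hy m, fun m => ?_⟩
  have h1 : Tendsto (fun J => shiftSum e m (phiPoly φ * wPoly n μ J)) atTop
      (𝓝 (∑ k, φ k • y (m - (k.val : ℤ)))) := by
    simp only [shiftSum_mul, ← shiftSum_phiPoly]
    exact tendsto_shiftSum (x := fun J k => shiftSum e k (wPoly n μ J)) hy m _
  refine tendsto_nhds_unique ?_ h1
  obtain ⟨C, -, hC⟩ := DiffContOnCl.exists_bound (differentiable_phiFun φ).diffContOnCl
  have h2 : Tendsto (fun J => ‖x m - shiftSum e m (phiPoly φ * wPoly n μ J)‖ ^ 2) atTop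
      (𝓝 0) := by
    refine squeeze_zero (fun _ => by positivity) (fun J => ?_)
      (g := fun J => 1 / (2 * Real.pi) * (C ^ 2 * ∫ θ in (-Real.pi)..Real.pi,
        ‖(wPoly n μ J).eval (cpt θ) - w (cpt θ)‖ ^ 2)) ?_
    · have h := hx.norm_sub_sq ht he m (Polynomial.monomial 0 1) (phiPoly φ * wPoly n μ J)
      rw [shiftSum_monomial] at h
      simp only [Nat.cast_zero, sub_zero, one_smul, Polynomial.eval_mul, eval_phiPoly,
        Polynomial.eval_monomial, pow_zero, one_mul] at h
      rw [h, ← intervalIntegral.integral_const_mul (C ^ 2)]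
      have hΦ : Continuous fun θ => phiFun φ (cpt θ) :=
        (differentiable_phiFun φ).continuous.comp continuous_cpt
      have hi1 : Continuous fun θ => ‖w (cpt θ) * phiFun φ (cpt θ) -
          phiFun φ (cpt θ) * (wPoly n μ J).eval (cpt θ)‖ ^ 2 :=
        ((hwc.mul hΦ).sub (hΦ.mul (hcont _))).norm.pow 2
      have hi2 : Continuous fun θ => C ^ 2 * ‖(wPoly n μ J).eval (cpt θ) - w (cpt θ)‖ ^ 2 :=
        continuous_const.mul (((hcont _).sub hwc).norm.pow 2)
      refine mul_le_mul_of_nonneg_left (intervalIntegral.integral_mono_on (μ := volume) neg_pi_le_pi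
        (hi1.intervalIntegrable (-Real.pi) Real.pi)
        (hi2.intervalIntegrable (-Real.pi) Real.pi) fun θ _ => ?_) (by positivity)
      rw [← mul_pow]
      refine pow_le_pow_left₀ (norm_nonneg _) ?_ 2
      rw [mul_comm (w _), ← mul_sub, norm_mul, norm_sub_rev]
      exact mul_le_mul_of_nonneg_right (hC _ (norm_cpt θ).le) (norm_nonneg _)
    · simpa using (hW.const_mul (C ^ 2)).const_mul (1 / (2 * Real.pi))
  have h3 := h2.sqrt
  simp only [Real.sqrt_sq (norm_nonneg _), Real.sqrt_zero] at h3
  rw [tendsto_iff_norm_sub_tendsto_zero]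
  simpa only [norm_sub_rev] using h3

end Whitening

/-! ### From Hilbert space elements back to random variables. -/

lemma coeFn_sum_smul {X ι : Type*} [MeasurableSpace X] {ν : Measure X} (s : Finset ι) (u : ι → ℂ)
    (g : ι → Lp ℂ 2 ν) : (∑ i ∈ s, u i • g i : Lp ℂ 2 ν) =ᵐ[ν] fun x => ∑ i ∈ s, u i * g i x := by
  classical
  induction s using Finset.induction_on with
  | empty =>
    simp only [Finset.sum_empty]
    exact Lp.coeFn_zero ℂ 2 ν
  | insert i s hi ih =>
    rw [Finset.sum_insert hi]
    filter_upwards [Lp.coeFn_add (u i • g i) (∑ i ∈ s, u i • g i), Lp.coeFn_smul (u i) (g i), ih]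
      with x h1 h2 h3
    rw [h1, Pi.add_apply, h2, h3, Finset.sum_insert hi, Pi.smul_apply, smul_eq_mul]

/-- Because 1/Φ lies in the disk algebra, there are polynomials with t_k w → 1/Φ boundedly;
multiplying by Φ gives the limit 1. Boundary zeros of w matter only on a null set. -/
lemma exists_isApproxInverse {n μ N : ℕ} {w : ℂ → ℂ} {φ : Fin (N + 1) → ℂ}
    (hw : IsOuterWeight n μ w) (hφ : ∀ z : ℂ, ‖z‖ ≤ 1 → phiFun φ z ≠ 0) :
    ∃ t, IsApproxInverse (fun θ => w (cpt θ) * phiFun φ (cpt θ)) t := by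
  have hinv : DiffContOnCl ℂ (fun z => (phiFun φ z)⁻¹) (ball 0 1) :=
    (differentiable_phiFun φ).diffContOnCl.inv fun z hz => by
      rw [closure_ball _ one_ne_zero] at hz
      exact hφ z (by simpa using hz)
  obtain ⟨t, M, hM, hlim⟩ := exists_polynomial_mul_tendsto hw.diffContOnCl
    (fun z => hw.ne_zero) hw.exists_bound hinv
  obtain ⟨A, hA0, hA⟩ := DiffContOnCl.exists_bound hw.diffContOnCl
  obtain ⟨C, hC0, hC⟩ := DiffContOnCl.exists_bound (differentiable_phiFun φ).diffContOnCl
  refine ⟨t, (DiffContOnCl.continuous_cpt hw.diffContOnCl).mul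
    ((differentiable_phiFun φ).continuous.comp continuous_cpt), ⟨A * C, fun θ => ?_⟩,
    ⟨M * C, fun k θ => ?_⟩, ?_⟩
  · rw [norm_mul]
    exact mul_le_mul (hA _ (norm_cpt θ).le) (hC _ (norm_cpt θ).le) (norm_nonneg _) hA0
  · rw [← mul_assoc, norm_mul]
    exact mul_le_mul (hM k _ (norm_cpt θ)) (hC _ (norm_cpt θ).le) (norm_nonneg _)
      ((norm_nonneg _).trans (hM k _ (norm_cpt θ)))
  · filter_upwards [hw.ae_ne_zero] with θ h
    have h1 := (hlim _ (norm_cpt θ) h).mul_const (phiFun φ (cpt θ))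
    rw [inv_mul_cancel₀ (hφ _ (norm_cpt θ).le)] at h1
    simpa only [mul_assoc] using h1

section MovingAverage

variable {Ω : Type*} [MeasurableSpace Ω] {P : Measure Ω} {n μ N : ℕ} {ξ : ℤ → Ω → ℂ}
  {w : ℂ → ℂ}

/-- The step-`μ` increment as an element of `L²`. -/
noncomputable def incrementLp {f : ℝ → ℝ} (μ : ℕ) (hξ : HasSpectralDensity P n ξ f) (m : ℤ) :
    Lp ℂ 2 P :=
  (hξ.memLp m μ).toLp _

lemma coeFn_shiftSum_incrementLp {f : ℝ → ℝ} (hξ : HasSpectralDensity P n ξ f) (m : ℤ)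
    (p : Polynomial ℂ) : shiftSum (incrementLp μ hξ) m p =ᵐ[P]
      fun x => ∑ j ∈ p.support, p.coeff j * increment n ξ (m - (j : ℤ)) μ x := by
  rw [shiftSum_apply]
  have h : ∀ᵐ x ∂P, ∀ j : ℕ, incrementLp μ hξ (m - (j : ℤ)) x = increment n ξ (m - (j : ℤ)) μ x :=
    ae_all_iff.mpr fun j => (hξ.memLp _ _).coeFn_toLp
  filter_upwards [coeFn_sum_smul p.support p.coeff fun j => incrementLp μ hξ (m - (j : ℤ)), h]
    with x h1 h2
  rw [h1]
  simp only [h2]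

lemma sum_coeff_mul_zpow (p : Polynomial ℂ) (m : ℤ) (θ : ℝ) :
    ∑ j ∈ p.support, p.coeff j * cpt θ ^ (-(m - (j : ℤ))) =
      cpt θ ^ (-m) * p.eval (cpt θ) := by
  rw [Polynomial.eval_eq_sum, Polynomial.sum, Finset.mul_sum]
  refine Finset.sum_congr rfl fun j _ => ?_
  rw [show -(m - (j : ℤ)) = -m + j by ring, zpow_add₀ (cpt_ne_zero θ), zpow_natCast]
  ring

lemma hasSpectralFactor_incrementLp (hw : IsOuterWeight n μ w) {φ : Fin (N + 1) → ℂ}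
    (hξ : HasSpectralDensity P n ξ (maDensity φ)) :
    HasSpectralFactor (incrementLp μ hξ) fun θ => w (cpt θ) * phiFun φ (cpt θ) := by
  intro k m q p
  have h := integral_sum_increment_mul_star hw (intervalIntegrable_maDensity φ) hξ p.support
    q.support p.coeff q.coeff (fun j => m - (j : ℤ)) (fun j => k - (j : ℤ))
  rw [L2.inner_def]
  refine Eq.trans (integral_congr_ae ?_) (h.trans ?_)
  · filter_upwards [coeFn_shiftSum_incrementLp hξ m p, coeFn_shiftSum_incrementLp hξ k q]
      with x h1 h2
    rw [h1, h2, RCLike.inner_apply]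
    rfl
  · congr 1
    refine intervalIntegral.integral_congr fun θ _ => ?_
    simp only [sum_coeff_mul_zpow, maDensity_eq, star_mul']
    push_cast
    rw [← Complex.mul_conj', ← Complex.mul_conj']
    simp only [Complex.star_def]
    ring

lemma hasMovingAverage [IsProbabilityMeasure P] (hw : IsOuterWeight n μ w) {φ : Fin (N + 1) → ℂ}
    (hφ : ∀ z : ℂ, ‖z‖ ≤ 1 → phiFun φ z ≠ 0)
    (hξ : HasSpectralDensity P n ξ (maDensity φ)) : HasMovingAverage P n μ ξ φ := by
  obtain ⟨t, ht⟩ := exists_isApproxInverse hw hφ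
  have hx := hasSpectralFactor_incrementLp hw hξ
  obtain ⟨e, he⟩ := hx.exists_tendsto ht
  obtain ⟨y, hy, hxy⟩ := hx.exists_filtered hw ht he
  refine ⟨fun m => e m, fun m => y m, fun m => ?_, fun m => ?_, fun m k => ?_,
    fun m => Lp.memLp _, fun m => ?_, fun m => ?_⟩
  · rw [inClosedSpan_iff (fun j => hξ.memLp _ _) (Lp.memLp _), Lp.toLp_coeFn]
    refine mem_closure_of_tendsto (he m) (Eventually.of_forall fun k => ?_)
    rw [shiftSum_apply]
    exact Submodule.sum_mem _ fun j _ => Submodule.smul_mem _ _ (Submodule.subset_span ⟨j, rfl⟩)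
  · have h1 : ∀ g : Lp ℂ 2 P,
        inner ℂ ((memLp_const (1 : ℂ)).toLp (fun _ : Ω => (1 : ℂ))) g = ∫ x, g x ∂P := by
      intro g
      rw [L2.inner_def]
      refine integral_congr_ae ?_
      filter_upwards [(memLp_const (μ := P) (p := 2) (1 : ℂ)).coeFn_toLp] with x hx
      rw [hx, RCLike.inner_apply, map_one, mul_one]
    rw [← h1]
    refine tendsto_nhds_unique (tendsto_const_nhds.inner (he m)) ?_
    have h2 : ∀ k, inner ℂ ((memLp_const (1 : ℂ)).toLp (fun _ : Ω => (1 : ℂ)))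
        (shiftSum (incrementLp μ hξ) m (t k)) = 0 := by
      intro k
      rw [shiftSum_apply, inner_sum]
      refine Finset.sum_eq_zero fun j _ => ?_
      rw [inner_smul_right, h1, incrementLp, integral_congr_ae (hξ.memLp _ _).coeFn_toLp,
        hξ.mean_zero, mul_zero]
    simp only [h2]
    exact tendsto_const_nhds
  · rw [← hx.inner_eq ht he m k, L2.inner_def]
    simp only [RCLike.inner_apply]
    rfl
  · have h := (tendsto_iff_edist_tendsto_0.mp (hy m))
    refine h.congr fun K => ?_
    rw [edist_comm, Lp.edist_def]
    refine eLpNorm_congr_ae ?_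
    filter_upwards [coeFn_sum_smul (Finset.range K) (wCoef n μ) fun j => e (m - (j : ℤ))]
      with x hx
    rw [Pi.sub_apply, hx]
  · have h := coeFn_sum_smul Finset.univ φ fun k => y (m - (k.val : ℤ))
    rw [← hxy m] at h
    filter_upwards [h, (hξ.memLp m μ).coeFn_toLp] with x h1 h2
    rw [← h2, ← h1]
    rfl

end MovingAverage

/-! ## The extremum problem -/

section

variable {n μ N : ℕ} {a : ℕ → ℂ} {P₀ : ℝ} {c : ℂ} {φ : Fin (N + 1) → ℂ}

lemma IsCanonicalFactorization.rDensity_eq_maDensity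
    (h : IsCanonicalFactorization (rDensity n μ a c φ) (extendZero φ)) :
    rDensity n μ a c φ = maDensity φ := by
  funext θ
  rw [IsCanonicalFactorization.eq_norm_phiFun h, maDensity_eq]

lemma IsCanonicalFactorization.sqNorm_eq
    (h : IsCanonicalFactorization (rDensity n μ a c φ) (extendZero φ))
    (hP : ∫ θ in (-Real.pi)..Real.pi, rDensity n μ a c φ θ = 2 * Real.pi * P₀) :
    sqNorm φ = P₀ := by
  rw [IsCanonicalFactorization.integral_rDensity h] at hP
  exact mul_left_cancel₀ (mul_ne_zero two_ne_zero Real.pi_ne_zero) hP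

lemma IsExtremal.solvesExtremum {w : ℂ → ℂ} (hw : IsOuterWeight n μ w) {s : ℝ} (hs : 0 ≤ s)
    (hE : IsExtremal n μ a s φ) (hP : sqNorm φ = P₀) :
    SolvesExtremum n μ a (classD0 P₀) φ := by
  refine ⟨(maDensity_mem_classD0 φ).mpr hP.le, fun ψ hψ => ?_⟩
  rw [hE.sqNorm_rVec_eq, hP]
  exact (hE.sqNorm_rVec_le hw ψ).1.trans
    (mul_le_mul_of_nonneg_left ((maDensity_mem_classD0 ψ).mp hψ) hs)

/-- A solution of the extremum problem with full power does at least as well as the maximal vector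
φ'. It thus attains the operator bound, and the equality case gives |R|² = s|Φ|² pointwise. -/
lemma IsExtremal.rDensity_eq_maDensity {w : ℂ → ℂ} (hw : IsOuterWeight n μ w) {s : ℝ}
    {φ' : Fin (N + 1) → ℂ} (hE : IsExtremal n μ a s φ') (hP' : sqNorm φ' = P₀)
    (hφ : SolvesExtremum n μ a (classD0 P₀) φ) (hP : sqNorm φ = P₀) (hc : ‖c‖ ^ 2 * s = 1) :
    rDensity n μ a c φ = maDensity φ := by
  have h1 := hφ.2 φ' ((maDensity_mem_classD0 φ').mpr hP'.le)
  rw [hE.sqNorm_rVec_eq, hP', ← hP] at h1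
  obtain ⟨h2, h3⟩ := hE.sqNorm_rVec_le hw φ
  funext θ
  rw [rDensity_eq, h3 (le_antisymm h2 h1) θ, maDensity_eq, ← mul_assoc, hc, one_mul]

end

end IncrementExtrapolation

/-! ### Assembly of the theorem. -/

open IncrementExtrapolation in
theorem theorem5p2 (n μ N : ℕ) (hn : 1 ≤ n) (hμ : 1 ≤ μ) (a : ℕ → ℂ) (P₀ : ℝ) (hP₀ : 0 < P₀) :
    -- `Δ(f)` is the least mean square error for every sequence with spectral density `f`
    (∀ f ∈ classD0 P₀, ∀ (Ω : Type*) [MeasurableSpace Ω] (P : Measure Ω) [IsProbabilityMeasure P]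
        (ξ : ℤ → Ω → ℂ), HasSpectralDensity P n ξ f →
        IsLeast (linearEstimateErrors P n μ N a ξ) (optimalError n μ N a f)) ∧
    -- the case of a solution of one of the two equations that attains the maximum
    (∀ φ₀ : Fin (N + 1) → ℂ, SolvesEigenEquation n μ a φ₀ → sqNorm φ₀ = P₀ →
        nuP n μ N a P₀ = nuPlusP n μ N a P₀ →
        nuPlusP n μ N a P₀ = (sqNorm (rVec n μ a φ₀) : EReal) →
        IsLeastFavorable n μ N a (classD0 P₀) (maDensity φ₀) ∧
        (IsCanonicalFactorization (maDensity φ₀) (extendZero φ₀) →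
          ∀ (Ω : Type*) [MeasurableSpace Ω] (P : Measure Ω) [IsProbabilityMeasure P]
            (ξ : ℤ → Ω → ℂ), HasSpectralDensity P n ξ (maDensity φ₀) →
            HasMovingAverage P n μ ξ φ₀)) ∧
    -- the case `ν₀ < ν₀⁺`
    (nuP n μ N a P₀ < nuPlusP n μ N a P₀ →
        (∃ (φ : Fin (N + 1) → ℂ) (c : ℂ),
          IsCanonicalFactorization (rDensity n μ a c φ) (extendZero φ) ∧
          ∫ θ in (-Real.pi)..Real.pi, rDensity n μ a c φ θ = 2 * Real.pi * P₀) ∧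
        (∀ (φ : Fin (N + 1) → ℂ) (c : ℂ),
          IsCanonicalFactorization (rDensity n μ a c φ) (extendZero φ) →
          ∫ θ in (-Real.pi)..Real.pi, rDensity n μ a c φ θ = 2 * Real.pi * P₀ →
          IsLeastFavorable n μ N a (classD0 P₀) (rDensity n μ a c φ) ∧
          SolvesExtremum n μ a (classD0 P₀) φ) ∧
        (∀ φ : Fin (N + 1) → ℂ,
          IsCanonicalFactorization (maDensity φ) (extendZero φ) →
          SolvesExtremum n μ a (classD0 P₀) φ →
          ∫ θ in (-Real.pi)..Real.pi, maDensity φ θ = 2 * Real.pi * P₀ →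
          (∃ c : ℂ, ∫ θ in (-Real.pi)..Real.pi, rDensity n μ a c φ θ = 2 * Real.pi * P₀) ∧
          ∀ c : ℂ, ∫ θ in (-Real.pi)..Real.pi, rDensity n μ a c φ θ = 2 * Real.pi * P₀ →
            rDensity n μ a c φ = maDensity φ)) := by
  obtain ⟨w, hw⟩ := exists_isOuterWeight n μ hμ
  have hs : ∀ c : ℂ, 0 ≤ (‖c‖ ^ 2)⁻¹ := fun c => by positivity
  refine ⟨fun f hf Ω _ P _ ξ hξ => isLeast_linearEstimateErrors hμ N a hw hf.1 hf.2.1 hξ,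
    fun φ₀ _ hP₀φ _ hmax => ?_, fun hlt => ?_⟩
  -- The supremum equals a real number, so some maximal vector φ exists. It supplies the bound sP₀,
  -- which φ₀ attains.
  · obtain ⟨φ, c, hφP, hcan⟩ := exists_of_nuPlusP_ne_bot (n := n) (μ := μ) (N := N) (a := a)
      (P₀ := P₀) (by rw [hmax]; exact EReal.coe_ne_bot _)
    have hE := (IsCanonicalFactorization.isExtremal hcan).2
    rw [IsExtremal.nuPlusP_eq hw hcan hφP, EReal.coe_eq_coe_iff] at hmax
    exact ⟨hE.isLeastFavorable (hs c) hw hP₀φ hmax.symm, fun hcf Ω _ P _ ξ hξ =>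
      hasMovingAverage hw (fun z hz => IsCanonicalFactorization.phiFun_ne_zero hcf hz) hξ⟩
  · obtain ⟨φ', c', hφP', hcan'⟩ := exists_of_nuPlusP_ne_bot (ne_bot_of_gt hlt)
    obtain ⟨hc', hE'⟩ := IsCanonicalFactorization.isExtremal hcan'
    refine ⟨⟨φ', c', hcan', by rw [IsCanonicalFactorization.integral_rDensity hcan', hφP']⟩,
      fun φ c hcan hint => ?_, fun φ hcan hφ hint => ?_⟩
    · have hP := IsCanonicalFactorization.sqNorm_eq hcan hint
      have hE := (IsCanonicalFactorization.isExtremal hcan).2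
      refine ⟨?_, hE.solvesExtremum hw (hs c) hP⟩
      rw [IsCanonicalFactorization.rDensity_eq_maDensity hcan]
      exact hE.isLeastFavorable (hs c) hw hP (by rw [hE.sqNorm_rVec_eq, hP])
    · have h2pi : (2 * Real.pi : ℝ) ≠ 0 := mul_ne_zero two_ne_zero Real.pi_ne_zero
      have hP : sqNorm φ = P₀ := by
        rw [integral_maDensity] at hint
        exact mul_left_cancel₀ h2pi hint
      have hcn : ‖c'‖ ^ 2 ≠ 0 := by simpa using hc'
      -- The constant c' belonging to the maximal vector φ' serves φ as well, because s is the same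
      -- for both.
      have heq : rDensity n μ a c' φ = maDensity φ :=
        hE'.rDensity_eq_maDensity hw hφP' hφ hP (mul_inv_cancel₀ hcn)
      refine ⟨⟨c', by rw [heq, hint]⟩, fun c hc => ?_⟩
      refine hE'.rDensity_eq_maDensity hw hφP' hφ hP ?_
      -- The power constraint fixes |c|, because the integral is 2π|c|²‖DAWφ‖² and P₀ > 0 rules out
      -- DAWφ = 0. Hence |c| = |c'| for every admissible c.
      have h : ∀ c : ℂ, ∫ θ in (-Real.pi)..Real.pi, rDensity n μ a c φ θ =
          2 * Real.pi * (‖c‖ ^ 2 * sqNorm (rVec n μ a φ)) := fun c => by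
        simp only [rDensity_eq]
        rw [intervalIntegral.integral_const_mul, integral_norm_rFun]
        ring
      have h1 := hc
      rw [h] at h1
      have h2 := hint
      rw [← heq, h] at h2
      have h3 : ‖c‖ ^ 2 * sqNorm (rVec n μ a φ) = P₀ := mul_left_cancel₀ h2pi h1
      have h4 : ‖c'‖ ^ 2 * sqNorm (rVec n μ a φ) = P₀ := mul_left_cancel₀ h2pi h2
      have h5 : sqNorm (rVec n μ a φ) ≠ 0 := fun h0 => by
        rw [h0, mul_zero] at h4
        exact hP₀.ne h4
      rw [mul_right_cancel₀ h5 (h3.trans h4.symm), mul_inv_cancel₀ hcn]
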